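/- Let $n\ge 0$, $T>0$, and let $f:\mathbb R^n\times[0,T]\to\mathbb R^n$ be Lebesgue measurable, with $f(\cdot,t)$ continuously differentiable for every $t\in[0,T]$ and with $f$ and its first $x$-derivatives bounded on $\mathbb R^n\times[0,T]$. Put $\delta_f(t)=\frac12\sup_{x\in\mathbb R^n}\bigl|\sum_{i=1}^n\frac{\partial f_i}{\partial x_i}(x,t)\bigr|$. Write $H^0=L_2(\mathbb R^n)$, $H^1=W_2^1(\mathbb R^n)$, $X^0_1=L^1([0,T]\to H^0)$, $X^1=L^2([0,T]\to H^1)$ (so $X^1\subset X^0_1$) and $\mathcal C^0=C([0,T]\to H^0)$, all spaces being real. (a) For all $s\in[0,T]$ and $x\in\mathbb R^n$ the problem $\frac{dy}{dt}(t)=f[y(t),t]$, $y(s)=x$, has exactly one solution $y^{x,s}$ on $[s,T]$, that is, exactly one continuous $y:[s,T]\to\mathbb R^n$ with $y(t)=x+\int_s^t f[y(\tau),\tau]\,d\tau$ for $t\in[s,T]$; and $\delta_f$ is integrable on $[0,T]$. (b) For every $\varphi\in X^1$ there is exactly one $v\in\mathcal C^0\cap X^1$ solving the backward transport problem $$\frac{\partial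 v}{\partial s}(x,s)+\sum_{i=1}^n f_i(x,s)\frac{\partial v}{\partial x_i}(x,s)=-\varphi(x,s),\qquad v(x,T)=0,$$ in the sense that $v(\cdot,s)=\int_s^T\bigl(\sum_i f_i(\cdot,t)\frac{\partial v}{\partial x_i}(\cdot,t)+\varphi(\cdot,t)\bigr)dt$ in $H^0$ for all $s\in[0,T]$. The solution operator $\varphi\mapsto v$ on $X^1$ has exactly one extension to a continuous linear operator $L:X^0_1\to\mathcal C^0$, and $\|L\|\le\exp\int_0^T\delta_f(t)\,dt$. (c) Let $\varphi:\mathbb R^n\times[0,T]\to\mathbb R$ be Lebesgue measurable with $\int_0^T\bigl(\int_{\mathbb R^n}|\varphi(x,t)|^2dx\bigr)^{1/2}dt<\infty$, i.e. $\varphi\in X^0_1$, and let $$V(x,s)=\int_s^T\varphi[y^{x,s}(t),t]\,dt .$$ Then for each $s\in[0,T]$ the integral converges absolutely for almost all $x\in\mathbb R^n$, the function $V(\cdot,s)$ belongs to $L_2(\mathbb R^n)$, and as an element of $L_2(\mathbb R^n)$ it does not change if $\varphi$ is changed on a null subset of $\mathbb R^n\times[0,T]$. The function $V$ (set equal to $0$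 where the integral does not converge absolutely) is Lebesgue measurable in $(x,s)$ on $\mathbb R^n\times[0,T]$. Moreover $V\in\mathcal C^0$ and $V=L\varphi$, that is, $V(\cdot,s)=(L\varphi)(\cdot,s)$ in $L_2(\mathbb R^n)$ for every $s\in[0,T]$. Finally, for every $s\in[0,T]$, $$\Bigl(\int_{\mathbb R^n}|V(x,s)|^2dx\Bigr)^{1/2}\le \exp\Bigl(\int_s^T\delta_f(t)\,dt\Bigr)\int_s^T\Bigl(\int_{\mathbb R^n}|\varphi(x,t)|^2dx\Bigr)^{1/2}dt .$$ -/

import Mathlib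

open MeasureTheory Set
open scoped ContDiff

noncomputable section

namespace Transport

/-- The Euclidean space `ℝⁿ`. -/
abbrev Space (n : ℕ) : Type := EuclideanSpace ℝ (Fin n)

/-- Lebesgue measure on the time interval `[0, T]`. -/
abbrev timeMeasure (T : ℝ) : Measure ℝ := volume.restrict (Icc 0 T)

/-- Lebesgue measure on `ℝⁿ × [0, T]`. A real or vector valued function is Lebesgue measurable on
`ℝⁿ × [0, T]` iff it is `AEMeasurable` for this measure. -/
abbrev spaceTimeMeasure (n : ℕ) (T : ℝ) : Measure (Space n × ℝ) :=
  (volume : Measure (Space n)).prod (timeMeasure T)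

/-- `H⁰ = L₂(ℝⁿ)`. -/
abbrev H0 (n : ℕ) : Type := Lp ℝ 2 (volume : Measure (Space n))

/-- `L¹([0, T] → L₂(ℝⁿ))`. -/
abbrev X10 (n : ℕ) (T : ℝ) : Type := Lp (H0 n) 1 (timeMeasure T)

/-- `C([0, T] → L₂(ℝⁿ))`, with the maximum norm. -/
abbrev C0 (n : ℕ) (T : ℝ) : Type := C(Icc (0 : ℝ) T, H0 n)

/-- Standing assumptions on the right-hand side `f : ℝⁿ × [0, T] → ℝⁿ`: it is Lebesgue measurable,
`f(·, t)` is continuously differentiable for every `t ∈ [0, T]`, and `f` and its first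
`x`-derivatives are bounded. -/
structure IsAdmissibleField {n : ℕ} (T : ℝ) (f : Space n → ℝ → Space n) : Prop where
  measurable : AEMeasurable (Function.uncurry f) (spaceTimeMeasure n T)
  contDiff : ∀ t ∈ Icc 0 T, ContDiff ℝ 1 (fun x => f x t)
  bounded : ∃ K : ℝ, ∀ t ∈ Icc 0 T, ∀ x, ‖f x t‖ ≤ K ∧ ‖fderiv ℝ (fun z => f z t) x‖ ≤ K

/-- `∑ᵢ ∂fᵢ/∂xᵢ (x, t)`. -/
def divergence {n : ℕ} (f : Space n → ℝ → Space n) (x : Space n) (t : ℝ) : ℝ :=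
  ∑ i, (fderiv ℝ (fun z => f z t) x (EuclideanSpace.single i 1)) i

/-- `δ_f(t) = (1/2) sup_x |∑ᵢ ∂fᵢ/∂xᵢ (x, t)|`. -/
def delta {n : ℕ} (f : Space n → ℝ → Space n) (t : ℝ) : ℝ :=
  1 / 2 * ⨆ x : Space n, |divergence f x t|

/-- `y` is a (Carathéodory) solution on `[s, T]` of `dy/dt = f(y(t), t)`, `y(s) = x`. -/
structure IsTrajectory {n : ℕ} (f : Space n → ℝ → Space n) (T s : ℝ) (x : Space n)
    (y : ℝ → Space n) : Prop where
  continuousOn : ContinuousOn y (Icc s T)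
  integrable : IntervalIntegrable (fun τ => f (y τ) τ) volume s T
  eq : ∀ t ∈ Icc s T, y t = x + ∫ τ in s..t, f (y τ) τ

/-- The trajectory functional `V(x, s) = ∫_s^T φ[y^{x,s}(t), t] dt`; `y x s t` stands for
`y^{x,s}(t)`. -/
def trajectoryFunctional {n : ℕ} (T : ℝ) (φ : Space n → ℝ → ℝ) (y : Space n → ℝ → ℝ → Space n)
    (x : Space n) (s : ℝ) : ℝ :=
  ∫ t in s..T, φ (y x s t) t

/-- `φ` belongs to `L¹([0, T] → L₂(ℝⁿ))`, as a Lebesgue measurable function on `ℝⁿ × [0, T]`. -/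
structure MemX10 {n : ℕ} (T : ℝ) (φ : Space n → ℝ → ℝ) : Prop where
  measurable : AEMeasurable (Function.uncurry φ) (spaceTimeMeasure n T)
  summable : ∫⁻ t in Icc 0 T, eLpNorm (fun x => φ x t) 2 volume < (⊤ : ENNReal)

/-- `g` is the weak partial derivative `∂u/∂xᵢ` on `ℝⁿ`. -/
def HasWeakPartial {n : ℕ} (i : Fin n) (u g : H0 n) : Prop :=
  ∀ ψ : Space n → ℝ, ContDiff ℝ ∞ ψ → HasCompactSupport ψ →
    ∫ x, u x * fderiv ℝ ψ x (EuclideanSpace.single i 1) = - ∫ x, g x * ψ x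

/-- `u ∈ L²([0, T] → W₂¹(ℝⁿ))`, with spatial weak gradient `D`. -/
structure HasX1Gradient {n : ℕ} (T : ℝ) (u : ℝ → H0 n) (D : Fin n → ℝ → H0 n) : Prop where
  memLp : MemLp u 2 (timeMeasure T)
  memLp_gradient : ∀ i, MemLp (D i) 2 (timeMeasure T)
  weak : ∀ i, ∀ᵐ t ∂(timeMeasure T), HasWeakPartial i (u t) (D i t)

/-- `u ∈ X¹ = L²([0, T] → W₂¹(ℝⁿ))`. -/
def MemX1 {n : ℕ} (T : ℝ) (u : ℝ → H0 n) : Prop :=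
  ∃ D : Fin n → ℝ → H0 n, HasX1Gradient T u D

/-- `v ∈ C([0, T] → L₂) ∩ X¹` solves `∂v/∂s + ∑ᵢ fᵢ ∂v/∂xᵢ = -Φ`, `v(·, T) = 0`: in integrated form,
`v(s) = ∫_s^T (A(t) v(t) + Φ(t)) dt` in `L₂(ℝⁿ)` for all `s ∈ [0, T]`, where `w(t) = A(t) v(t)` is
the function `x ↦ ∑ᵢ fᵢ(x, t) ∂v/∂xᵢ(x, t)`. -/
def IsTransportSolution {n : ℕ} {T : ℝ} (hT : 0 < T) (f : Space n → ℝ → Space n)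
    (Φ : X10 n T) (v : C0 n T) : Prop :=
  ∃ (D : Fin n → ℝ → H0 n) (w : ℝ → H0 n),
    HasX1Gradient T (IccExtend hT.le v) D ∧
    (∀ᵐ t ∂(timeMeasure T), w t =ᵐ[volume] fun x => ∑ i, f x t i * D i t x) ∧
    Integrable w (timeMeasure T) ∧
    ∀ s : Icc (0 : ℝ) T, v s = ∫ t in (s : ℝ)..T, (w t + Φ t)

/-- The continuous linear operator `L : L¹([0, T] → L₂) → C([0, T] → L₂)` extends the solution
operator `X¹ ∋ Φ ↦ v` of the transport problem. -/
def ExtendsSolutionOperator {n : ℕ} {T : ℝ} (hT : 0 < T) (f : Space n → ℝ → Space n)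
    (L : X10 n T →L[ℝ] C0 n T) : Prop :=
  ∀ Φ : X10 n T, MemX1 T Φ → IsTransportSolution hT f Φ (L Φ)

end Transport

end

/-!
# The transport equation with a coefficient measurable in time, solved along trajectories

The field `f` is first replaced by a field `g` that is jointly Borel, is of class `C¹` with uniform
bounds at every time, and agrees with `f` on all of `ℝⁿ` at almost every time
(`IsAdmissibleField.exists_regular`). This changes neither the trajectories nor the transport
problem, and it changes `δ_f` only on a null set of times.

The flow `Y_{s,t}` of `g` (`flow`) is a group of bi-Lipschitz homeomorphisms, differentiable in the
initial point (`hasFDerivAt_flow`), and by Liouville's formula its Jacobian is the exponential of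
the integral of `div g` along the trajectory (`det_flowDeriv`). Hence `Y_{s,t}` expands Lebesgue
measure at most by the factor `exp (2 |∫ δ|)`, and `h ↦ h ∘ Y_{s,t}` is a strongly continuous family
of operators on `L₂` with norm at most `exp |∫ δ|` (`compFlow`, `continuous_compFlow`). The operator
`L` is given by Duhamel's formula, `(LΦ)(s) = ∫ₛᵀ Φ(t) ∘ Y_{s,t} dt`, a Bochner integral in `L₂`
(`duhamelOp`); its norm bound is then immediate. Since a Bochner integral in `L₂` is the pointwise
integral almost everywhere (`coeFn_integral_ae`), `LΦ` is the trajectory functional. Everything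
about null sets follows because the flow preserves null sets.

It remains to identify `L` with the solution operator.

* Existence (`duhamel_eq_integral`). Composition with the flow preserves `W₂¹`, by the chain rule
  for smooth functions and their density in `W₂¹` (`hasWeakPartial_compFlow`), so `LΦ ∈ X¹` for
  `Φ ∈ X¹`. The equation is tested with a smooth `ψ`: after the substitution `x = Y_{r,s}(z)` the
  time derivative falls on `ψ(Y_{r,s}(z))` times the Jacobian, which satisfies the continuity
  equation (`jacobian_mul_sub`). This gives
  `⟨h ∘ Y_{s,r}, ψ⟩ - ⟨h, ψ⟩ = -∫ₛʳ ⟨h ∘ Y_{t,r}, ∑ᵢ ∂ᵢ(gᵢψ)⟩ dt` (`inner_compFlow_sub`), and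
  Fubini's theorem over the triangle `s < t < r < T` turns it into the equation for `LΦ`.
* Uniqueness (`IsTransportSolution.unique`). The difference `z` of two solutions satisfies
  `‖z(s)‖² = 2 ∫ₛᵀ ⟨A(t) z(t), z(t)⟩ dt` with `A = ∑ᵢ gᵢ ∂ᵢ`, and `2 ⟨A z, z⟩ = -⟨(div g) z, z⟩`,
  so that `z = 0` by Gronwall's inequality.
* `X¹` is dense in `X₁⁰`, so there is only one continuous extension (`ext_of_memX1`).
-/

namespace Transport

open Filter Topology

/-! ### Square integrable functions and measurability of `L₂`-valued maps -/

instance instSeparableSpaceH0 (n : ℕ) : TopologicalSpace.SeparableSpace (H0 n) := by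
  have : Fact ((2 : ENNReal) ≠ ⊤) := ⟨by norm_num⟩
  infer_instance

theorem inner_eq_integral {n : ℕ} (u v : H0 n) : inner ℝ u v = ∫ x, u x * v x := by
  rw [L2.inner_def]
  exact integral_congr_ae (ae_of_all _ fun x => by simp [mul_comm])

theorem norm_sq_eq_integral {n : ℕ} (u : H0 n) : ‖u‖ ^ 2 = ∫ x, u x ^ 2 := by
  rw [← real_inner_self_eq_norm_sq, inner_eq_integral]
  simp only [sq]

/-- A weakly measurable map into a separable Hilbert space is strongly measurable; it suffices to
test against a dense set. -/
theorem aestronglyMeasurable_of_forall_inner {H : Type*} [NormedAddCommGroup H]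
    [InnerProductSpace ℝ H] [CompleteSpace H] [TopologicalSpace.SeparableSpace H] {α : Type*}
    [MeasurableSpace α] {μ : Measure α} {S : Set H} (hS : Dense S) {F : α → H}
    (h : ∀ g ∈ S, AEStronglyMeasurable (fun a => inner ℝ (F a) g) μ) :
    AEStronglyMeasurable F μ := by
  have hall : ∀ g : H, AEStronglyMeasurable (fun a => inner ℝ (F a) g) μ := by
    intro g
    obtain ⟨u, huS, hu⟩ := mem_closure_iff_seq_limit.1 (hS g)
    refine aestronglyMeasurable_of_tendsto_ae atTop (fun k => h (u k) (huS k))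
      (ae_of_all _ fun a => ?_)
    exact (tendsto_const_nhds (x := F a)).inner hu
  obtain ⟨w, b, hb⟩ := exists_hilbertBasis ℝ H
  -- an orthonormal family in a separable space is countable
  have hcount : Countable w := by
    have hd : (univ : Set w).PairwiseDisjoint fun i => Metric.ball (b i) (1 / 2) := by
      intro i _ j _ hij
      refine Metric.ball_disjoint_ball ?_
      have h1 : dist (b i) (b j) ^ 2 = 2 := by
        rw [dist_eq_norm, norm_sub_sq_real, b.orthonormal.1 i, b.orthonormal.1 j,
          b.orthonormal.2 hij]
        norm_num
      nlinarith [dist_nonneg (x := b i) (y := b j)]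
    have := hd.countable_of_isOpen (fun i _ => Metric.isOpen_ball)
      (fun i _ => ⟨b i, Metric.mem_ball_self (by norm_num)⟩)
    exact countable_univ_iff.1 this
  refine aestronglyMeasurable_of_tendsto_ae (atTop : Filter (Finset w))
    (f := fun s a => ∑ i ∈ s, b.repr (F a) i • b i) (fun s => ?_)
    (ae_of_all _ fun a => b.hasSum_repr (F a))
  refine Finset.aestronglyMeasurable_fun_sum _ fun i _ => ?_
  refine AEStronglyMeasurable.smul_const ?_ _
  simp only [b.repr_apply_apply]
  simpa only [real_inner_comm] using hall (b i)

/-- The smooth compactly supported functions, as elements of `L₂`. -/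
def testSet (n : ℕ) : Set (H0 n) :=
  {f : H0 n | ∃ g : Space n → ℝ, f =ᵐ[volume] g ∧ HasCompactSupport g ∧ ContDiff ℝ ∞ g}

theorem dense_testSet (n : ℕ) : Dense (testSet n) :=
  Lp.dense_hasCompactSupport_contDiff (by norm_num)

theorem inner_eq_integral_right {n : ℕ} (u : H0 n) {v : H0 n} {g : Space n → ℝ}
    (h : v =ᵐ[volume] g) : inner ℝ u v = ∫ x, u x * g x := by
  rw [inner_eq_integral]
  exact integral_congr_ae (h.mono fun x hx => by simp only [hx])

theorem aestronglyMeasurable_of_test {n : ℕ} {α : Type*} [MeasurableSpace α] {μ : Measure α}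
    {F : α → H0 n}
    (h : ∀ ψ : Space n → ℝ, ContDiff ℝ ∞ ψ → HasCompactSupport ψ →
      AEStronglyMeasurable (fun a => ∫ x, F a x * ψ x) μ) : AEStronglyMeasurable F μ := by
  refine aestronglyMeasurable_of_forall_inner (dense_testSet n) fun g ⟨ψ, h1, h2, h3⟩ => ?_
  simpa only [inner_eq_integral_right _ h1] using h ψ h3 h2

/-- Two elements of `L₂` with the same integrals against smooth test functions are equal. -/
theorem eq_of_test {n : ℕ} {u v : H0 n}
    (h : ∀ ψ : Space n → ℝ, ContDiff ℝ ∞ ψ → HasCompactSupport ψ →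
      ∫ x, u x * ψ x = ∫ x, v x * ψ x) : u = v := by
  refine (dense_testSet n).eq_of_inner_left ℝ ?_
  rintro g ⟨ψ, h1, h2, h3⟩
  rw [inner_eq_integral_right _ h1, inner_eq_integral_right _ h1, h ψ h3 h2]

/-- A jointly measurable function whose sections are square integrable is a measurable map into
`L₂`. -/
theorem aestronglyMeasurable_of_section {n : ℕ} {α : Type*} [MeasurableSpace α] {μ : Measure α}
    [SFinite μ] {F : α → H0 n} {φ : Space n → α → ℝ}
    (hφ : AEStronglyMeasurable (Function.uncurry φ) ((volume : Measure (Space n)).prod μ))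
    (h : ∀ᵐ a ∂μ, F a =ᵐ[volume] fun x => φ x a) : AEStronglyMeasurable F μ := by
  refine aestronglyMeasurable_of_test fun ψ h3 _ => ?_
  have h1 : AEStronglyMeasurable (fun p : α × Space n => φ p.2 p.1 * ψ p.2) (μ.prod volume) :=
    (hφ.prod_swap).mul
      (h3.continuous.stronglyMeasurable.comp_measurable measurable_snd).aestronglyMeasurable
  refine h1.integral_prod_right'.congr ?_
  filter_upwards [h] with a ha
  exact integral_congr_ae (ha.mono fun x hx => by simp only [hx])

theorem setIntegral_abs_le {n : ℕ} {B : Set (Space n)} (hB : MeasurableSet B)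
    (hB' : volume B ≠ ⊤) (u : H0 n) :
    IntegrableOn (fun x => u x) B ∧ ∫ x in B, |u x| ≤ ‖indicatorConstLp 2 hB hB' (1 : ℝ)‖ * ‖u‖ := by
  refine ⟨?_, ?_⟩
  · exact integrableOn_Lp_of_measure_ne_top u (by norm_num) hB'
  · have h1 := L2.inner_indicatorConstLp_one (𝕜 := ℝ) hB hB' |u|
    have h2 : ∫ x in B, |u x| = ∫ x in B, (|u| : H0 n) x :=
      integral_congr_ae (ae_restrict_of_ae ((Lp.coeFn_abs u).mono fun x hx => hx.symm))
    rw [h2, ← h1]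
    refine (real_inner_le_norm _ _).trans_eq ?_
    rw [norm_abs_eq_norm]

/-- The Bochner integral of an `L₂`-valued map is the pointwise integral of any jointly measurable
representative, which converges absolutely almost everywhere. -/
theorem coeFn_integral_ae {n : ℕ} {α : Type*} [MeasurableSpace α] {μ : Measure α}
    [SFinite μ] {F : α → H0 n} {φ : Space n → α → ℝ}
    (hφ : AEStronglyMeasurable (Function.uncurry φ) ((volume : Measure (Space n)).prod μ))
    (hF : Integrable F μ) (h : ∀ᵐ a ∂μ, F a =ᵐ[volume] fun x => φ x a) :
    (∀ᵐ x, Integrable (φ x) μ) ∧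
      ((∫ a, F a ∂μ : H0 n) : Space n → ℝ) =ᵐ[volume] fun x => ∫ a, φ x a ∂μ := by
  have key : ∀ B : Set (Space n), MeasurableSet B → volume B < ⊤ →
      Integrable (Function.uncurry φ) ((volume.restrict B).prod μ) := by
    intro B hB hB'
    have hm : AEStronglyMeasurable (Function.uncurry φ) ((volume.restrict B).prod μ) :=
      hφ.mono_ac (Measure.AbsolutelyContinuous.prod Measure.absolutelyContinuous_restrict
        Measure.AbsolutelyContinuous.rfl)
    rw [integrable_prod_iff' hm]
    have hI : ∀ᵐ a ∂μ, (∫ x in B, ‖Function.uncurry φ (x, a)‖) = ∫ x in B, |F a x| := by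
      filter_upwards [h] with a ha
      exact integral_congr_ae (ae_restrict_of_ae (ha.mono fun x hx => by
        simp [hx, Function.uncurry]))
    refine ⟨?_, ?_⟩
    · filter_upwards [h] with a ha
      exact (setIntegral_abs_le hB hB'.ne (F a)).1.congr (ae_restrict_of_ae ha)
    · refine Integrable.mono' (hF.norm.const_mul ‖indicatorConstLp 2 hB hB'.ne (1 : ℝ)‖)
        hm.norm.prod_swap.integral_prod_right' ?_
      filter_upwards [hI] with a ha
      rw [ha, Real.norm_of_nonneg (integral_nonneg fun x => abs_nonneg _)]
      exact (setIntegral_abs_le hB hB'.ne (F a)).2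
  refine ⟨ae_of_forall_measure_lt_top_ae_restrict _ fun B hB hB' =>
    (key B hB hB').prod_right_ae, ?_⟩
  refine ae_eq_of_forall_setIntegral_eq_of_sigmaFinite
    (fun B hB hB' => integrableOn_Lp_of_measure_ne_top _ (by norm_num) hB'.ne)
    (fun B hB hB' => (key B hB hB').integral_prod_left) fun B hB hB' => ?_
  rw [integral_integral_swap (key B hB hB'),
    ← L2.inner_indicatorConstLp_one (𝕜 := ℝ) hB hB'.ne, ← integral_inner hF]
  refine integral_congr_ae ?_
  filter_upwards [h] with a ha
  rw [L2.inner_indicatorConstLp_one]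
  exact integral_congr_ae (ae_restrict_of_ae ha)

/-! ### Multiplication operators and dominated convergence in `L₂` -/

theorem tendsto_H0_of_dominated {n : ℕ} {ι : Type*} {l : Filter ι} [l.IsCountablyGenerated]
    {u : ι → H0 n} {v : H0 n} {F : ι → Space n → ℝ} {f b : Space n → ℝ}
    (hu : ∀ i, u i =ᵐ[volume] F i) (hv : v =ᵐ[volume] f) (hb : MemLp b 2)
    (hle : ∀ᶠ i in l, ∀ᵐ x, |F i x - f x| ≤ b x)
    (hlim : ∀ᵐ x, Tendsto (fun i => F i x) l (𝓝 (f x))) : Tendsto u l (𝓝 v) := by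
  have h1 : Tendsto (fun i => ‖u i - v‖ ^ 2) l (𝓝 0) := by
    have h2 : ∀ i, ‖u i - v‖ ^ 2 = ∫ x, (F i x - f x) ^ 2 := fun i => by
      rw [norm_sq_eq_integral]
      refine integral_congr_ae ?_
      filter_upwards [Lp.coeFn_sub (u i) v, hu i, hv] with x h1 h2 h3
      rw [h1, Pi.sub_apply, h2, h3]
    simp only [h2]
    have h3 : ∫ _ : Space n, (0 : ℝ) = 0 := by simp
    rw [← h3]
    refine tendsto_integral_filter_of_dominated_convergence (fun x => b x ^ 2) ?_ ?_
      hb.integrable_sq ?_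
    · exact Eventually.of_forall fun i => ((((Lp.aestronglyMeasurable (u i)).congr (hu i)).sub
        ((Lp.aestronglyMeasurable v).congr hv)).pow 2)
    · filter_upwards [hle] with i hi
      filter_upwards [hi] with x h4
      rw [Real.norm_of_nonneg (sq_nonneg _)]
      exact sq_le_sq' (by linarith [neg_abs_le (F i x - f x)]) ((le_abs_self _).trans h4)
    · filter_upwards [hlim] with x hx
      have := ((hx.sub_const (f x)).pow 2)
      simpa using this
  have h4 : Tendsto (fun i => ‖u i - v‖) l (𝓝 0) := by
    have := h1.sqrt
    simpa [Real.sqrt_sq] using this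
  exact tendsto_iff_norm_sub_tendsto_zero.2 h4

/-- Multiplication by the bounded measurable function `b`, as an operator on `L₂`. -/
noncomputable def mulOp {n : ℕ} (b : Space n → ℝ) (hb : AEStronglyMeasurable b volume) (C : ℝ)
    (hC : ∀ x, |b x| ≤ C) : H0 n →L[ℝ] H0 n :=
  have hmem : ∀ u : H0 n, MemLp (fun x => b x * u x) 2 volume := fun u =>
    (Lp.memLp u).of_le_mul (c := C) (hb.mul (Lp.aestronglyMeasurable u))
      (ae_of_all _ fun x => by
        rw [norm_mul]; exact mul_le_mul_of_nonneg_right (hC x) (norm_nonneg _))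
  LinearMap.mkContinuous
    { toFun := fun u => (hmem u).toLp
      map_add' := fun u v => by
        rw [← MemLp.toLp_add, MemLp.toLp_eq_toLp_iff]
        filter_upwards [Lp.coeFn_add u v] with x hx
        simp only [hx, Pi.add_apply, mul_add]
      map_smul' := fun c u => by
        rw [RingHom.id_apply, ← MemLp.toLp_const_smul, MemLp.toLp_eq_toLp_iff]
        filter_upwards [Lp.coeFn_smul c u] with x hx
        simp only [hx, Pi.smul_apply, smul_eq_mul]
        ring } C
    fun u => by
      refine Lp.norm_le_mul_norm_of_ae_le_mul ?_
      filter_upwards [(hmem u).coeFn_toLp] with x hx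
      simp only [LinearMap.coe_mk, AddHom.coe_mk, hx, norm_mul]
      exact mul_le_mul_of_nonneg_right (hC x) (norm_nonneg _)

theorem mulOp_coeFn {n : ℕ} {b : Space n → ℝ} (hb : AEStronglyMeasurable b volume) {C : ℝ}
    (hC : ∀ x, |b x| ≤ C) (u : H0 n) : mulOp b hb C hC u =ᵐ[volume] fun x => b x * u x :=
  MemLp.coeFn_toLp (f := fun x => b x * u x) ((Lp.memLp u).of_le_mul (c := C)
    (hb.mul (Lp.aestronglyMeasurable u)) (ae_of_all _ fun x => by
      rw [norm_mul]; exact mul_le_mul_of_nonneg_right (hC x) (norm_nonneg _)))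

theorem norm_mulOp_apply_le {n : ℕ} {b : Space n → ℝ} (hb : AEStronglyMeasurable b volume) {C : ℝ}
    (hC : ∀ x, |b x| ≤ C) (u : H0 n) : ‖mulOp b hb C hC u‖ ≤ C * ‖u‖ := by
  refine Lp.norm_le_mul_norm_of_ae_le_mul ?_
  filter_upwards [mulOp_coeFn hb hC u] with x hx
  rw [hx, norm_mul]
  exact mul_le_mul_of_nonneg_right (hC x) (norm_nonneg _)

/-! ### Smooth functions are dense in the Sobolev space `W₂¹(ℝⁿ)` -/

/-- The translate `x ↦ u(x - h)`. -/
noncomputable def translate {n : ℕ} (h : Space n) (u : H0 n) : H0 n :=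
  Lp.compMeasurePreserving (fun x => x - h) (measurePreserving_sub_right volume h) u

theorem translate_coeFn {n : ℕ} (h : Space n) (u : H0 n) :
    translate h u =ᵐ[volume] fun x => u (x - h) :=
  Lp.coeFn_compMeasurePreserving u (measurePreserving_sub_right volume h)

theorem translate_zero {n : ℕ} (u : H0 n) : translate 0 u = u := by
  refine Lp.ext ((translate_coeFn 0 u).trans ?_)
  simp

theorem continuous_translate {n : ℕ} (u : H0 n) : Continuous fun h : Space n => translate h u := by
  have hg : Continuous fun h : Space n => (⟨fun x => x - h, by fun_prop⟩ : C(Space n, Space n)) :=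
    ContinuousMap.continuous_of_continuous_uncurry _
      (by simp only [Function.uncurry_def, ContinuousMap.coe_mk]; fun_prop)
  exact Continuous.compMeasurePreservingLp (continuous_const (y := u)) hg
    (fun h => measurePreserving_sub_right volume h) (by norm_num)

/-- A weight `ρ` of integral one, supported near the origin, averages translates of `u` to
something near `u`; the average is represented by the convolution of `ρ` and `u`. -/
theorem exists_average_near {n : ℕ} {u : H0 n} {ε δ : ℝ}
    (hδ : ∀ h : Space n, ‖h‖ < δ → ‖translate h u - u‖ ≤ ε) {ρ : Space n → ℝ}
    (hρ : Continuous ρ) (hρc : HasCompactSupport ρ) (hρ0 : ∀ h, 0 ≤ ρ h)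
    (hρ1 : ∫ h, ρ h = 1) (hρs : ∀ h, δ ≤ ‖h‖ → ρ h = 0) :
    ∃ v : H0 n, v =ᵐ[volume] (fun x => ∫ h, ρ h * u (x - h)) ∧ ‖v - u‖ ≤ ε := by
  have hi : Integrable ρ := hρ.integrable_of_hasCompactSupport hρc
  have hF : Integrable (fun h => ρ h • translate h u) :=
    (hρ.smul (continuous_translate u)).integrable_of_hasCompactSupport hρc.smul_right
  have hφ : StronglyMeasurable (Function.uncurry fun x h : Space n => ρ h * u (x - h)) :=
    (hρ.comp continuous_snd).stronglyMeasurable.mul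
      ((Lp.stronglyMeasurable u).comp_measurable (measurable_fst.sub measurable_snd))
  have h1 := coeFn_integral_ae hφ.aestronglyMeasurable hF (ae_of_all _ fun h => by
    filter_upwards [Lp.coeFn_smul (ρ h) (translate h u), translate_coeFn h u] with x h1 h2
    rw [h1, Pi.smul_apply, h2, smul_eq_mul])
  refine ⟨_, h1.2, ?_⟩
  have h2 : (∫ h, ρ h • translate h u) - u = ∫ h, ρ h • (translate h u - u) := by
    have : ∫ h, ρ h • u = u := by rw [integral_smul_const, hρ1, one_smul]
    simp only [smul_sub]
    rw [integral_sub hF (hi.smul_const u), this]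
  rw [h2]
  have h3 : ∫ h, ρ h * ε = ε := by rw [integral_mul_const, hρ1, one_mul]
  rw [← h3]
  refine norm_integral_le_of_norm_le (hi.mul_const ε) (ae_of_all _ fun h => ?_)
  rw [norm_smul, Real.norm_of_nonneg (hρ0 h)]
  rcases lt_or_ge ‖h‖ δ with h4 | h4
  · exact mul_le_mul_of_nonneg_left (hδ h h4) (hρ0 h)
  · rw [hρs h h4, zero_mul, zero_mul]

/-- The convolution of `u` with a smooth kernel `ρ` is smooth, and its classical partial
derivatives are the convolutions of the weak ones with `ρ`. -/
theorem fderiv_average {n : ℕ} {u : H0 n} {D : Fin n → H0 n} (hD : ∀ i, HasWeakPartial i u (D i))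
    {ρ : Space n → ℝ} (hρ : ContDiff ℝ ∞ ρ) (hρc : HasCompactSupport ρ) :
    ContDiff ℝ ∞ (fun x => ∫ h, ρ h * u (x - h)) ∧
      ∀ i x, fderiv ℝ (fun x => ∫ h, ρ h * u (x - h)) x (EuclideanSpace.single i 1) =
        ∫ h, ρ h * D i (x - h) := by
  have hu : LocallyIntegrable (fun x => u x) volume :=
    (Lp.memLp u).locallyIntegrable (by norm_num)
  have hρ1 : ContDiff ℝ 1 ρ := hρ.of_le (by norm_cast)
  refine ⟨hρc.contDiff_convolution_left (ContinuousLinearMap.mul ℝ ℝ) hρ hu, fun i x => ?_⟩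
  have h1 := (hρc.hasFDerivAt_convolution_left (ContinuousLinearMap.mul ℝ ℝ) hρ1 hu x).fderiv
  have h2 : Integrable (fun t => (ContinuousLinearMap.precompL (Space n)
      (ContinuousLinearMap.mul ℝ ℝ)) (fderiv ℝ ρ t) (u (x - t))) :=
    (hρc.fderiv (𝕜 := ℝ)).convolutionExists_left _ (hρ1.continuous_fderiv (by norm_num)) hu x
  have h3 : fderiv ℝ (fun x => ∫ h, ρ h * u (x - h)) x (EuclideanSpace.single i 1) =
      ∫ t, fderiv ℝ ρ t (EuclideanSpace.single i 1) * u (x - t) := by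
    refine (congrArg (fun A : Space n →L[ℝ] ℝ => A (EuclideanSpace.single i 1)) h1).trans ?_
    unfold convolution
    rw [ContinuousLinearMap.integral_apply h2]
    simp
  have hψ : ContDiff ℝ ∞ fun y => ρ (x - y) := hρ.comp (contDiff_const.sub contDiff_id)
  have hψc : HasCompactSupport fun y => ρ (x - y) :=
    hρc.comp_homeomorph (Homeomorph.subLeft x)
  have hψ' : ∀ y, fderiv ℝ (fun y => ρ (x - y)) y (EuclideanSpace.single i 1) =
      - fderiv ℝ ρ (x - y) (EuclideanSpace.single i 1) := fun y => by
    have h4 : HasFDerivAt (fun y => ρ (x - y)) ((fderiv ℝ ρ (x - y)).comp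
        (-ContinuousLinearMap.id ℝ (Space n))) y :=
      ((hρ1.differentiable (by norm_num) _).hasFDerivAt).comp y ((hasFDerivAt_id y).const_sub x)
    rw [h4.fderiv]
    simp
  have h5 := hD i _ hψ hψc
  rw [h3, ← integral_sub_left_eq_self _ volume x, ← integral_sub_left_eq_self
    (fun h => ρ h * D i (x - h)) volume x]
  simp only [hψ', mul_neg, integral_neg, sub_sub_cancel] at h5 ⊢
  rw [neg_inj] at h5
  simpa only [mul_comm] using h5

theorem exists_smooth_approx {n : ℕ} {u : H0 n} {D : Fin n → H0 n}
    (hD : ∀ i, HasWeakPartial i u (D i)) {ε : ℝ} (hε : 0 < ε) :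
    ∃ (φ : Space n → ℝ) (v : H0 n) (w : Fin n → H0 n), ContDiff ℝ ∞ φ ∧ v =ᵐ[volume] φ ∧
      (∀ i, w i =ᵐ[volume] fun x => fderiv ℝ φ x (EuclideanSpace.single i 1)) ∧
      ‖v - u‖ ≤ ε ∧ ∀ i, ‖w i - D i‖ ≤ ε := by
  have hev : ∀ z : H0 n, ∀ᶠ h in 𝓝 (0 : Space n), ‖translate h z - z‖ ≤ ε := fun z => by
    have h1 : Tendsto (fun h => ‖translate h z - z‖) (𝓝 (0 : Space n)) (𝓝 0) := by
      have h2 := ((continuous_translate z).sub (continuous_const (y := z))).norm.tendsto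
        (0 : Space n)
      simpa [translate_zero] using h2
    exact h1.eventually_le_const hε
  obtain ⟨δ, hδ, hδ'⟩ := Metric.eventually_nhds_iff.1
    ((hev u).and (eventually_all.2 fun i => hev (D i)))
  let χ : ContDiffBump (0 : Space n) := ⟨δ / 2, δ, by linarith, by linarith⟩
  have hρs : ∀ h, δ ≤ ‖h‖ → χ.normed volume h = 0 := fun h hh => by
    by_contra h1
    have h2 : h ∈ Function.support (χ.normed volume) := h1
    rw [χ.support_normed_eq] at h2
    have h3 : ‖h‖ < δ := by simpa using h2
    linarith
  have hsm : ContDiff ℝ ∞ (χ.normed (volume : Measure (Space n))) := χ.contDiff_normed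
  have hav : ∀ z : H0 n, (∀ h : Space n, ‖h‖ < δ → ‖translate h z - z‖ ≤ ε) → _ := fun z hz =>
    exists_average_near hz hsm.continuous χ.hasCompactSupport_normed χ.nonneg_normed
      χ.integral_normed hρs
  obtain ⟨v, hv, hv'⟩ := hav u fun h hh => (hδ' (by simpa using hh)).1
  choose w hw hw' using fun i => hav (D i) fun h hh => (hδ' (by simpa using hh)).2 i
  obtain ⟨h1, h2⟩ := fderiv_average hD hsm χ.hasCompactSupport_normed
  refine ⟨_, v, w, h1, hv, fun i => ?_, hv', hw'⟩
  simp only [h2]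
  exact hw i

/-- Smooth functions in `W₂¹` are approximated in `W₂¹` by their products with cut-off functions
`χ(x/k)`. -/
theorem exists_cutoff_approx {n : ℕ} {φ : Space n → ℝ} (hφ : ContDiff ℝ ∞ φ) {v : H0 n}
    {w : Fin n → H0 n} (hv : v =ᵐ[volume] φ)
    (hw : ∀ i, w i =ᵐ[volume] fun x => fderiv ℝ φ x (EuclideanSpace.single i 1)) {ε : ℝ}
    (hε : 0 < ε) :
    ∃ ψ : Space n → ℝ, ContDiff ℝ ∞ ψ ∧ HasCompactSupport ψ ∧ ∃ (v' : H0 n) (w' : Fin n → H0 n),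
      v' =ᵐ[volume] ψ ∧
      (∀ i, w' i =ᵐ[volume] fun x => fderiv ℝ ψ x (EuclideanSpace.single i 1)) ∧
      ‖v' - v‖ ≤ ε ∧ ∀ i, ‖w' i - w i‖ ≤ ε := by
  let χ : ContDiffBump (0 : Space n) := ⟨1, 2, by norm_num, by norm_num⟩
  have hχ : ContDiff ℝ ∞ χ := χ.contDiff
  have hχ1 : ContDiff ℝ 1 χ := hχ.of_le (by norm_cast)
  have hφ1 : ContDiff ℝ 1 φ := hφ.of_le (by norm_cast)
  obtain ⟨C, hC⟩ := (hχ1.continuous_fderiv (by norm_num)).bounded_above_of_compact_support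
    (χ.hasCompactSupport.fderiv (𝕜 := ℝ))
  let r : ℕ → ℝ := fun k => ((k : ℝ) + 1)⁻¹
  have hr0 : ∀ k, 0 < r k := fun k => by positivity
  have hr1 : ∀ k, r k ≤ 1 := fun k => inv_le_one_of_one_le₀ (by
    have : (0 : ℝ) ≤ k := Nat.cast_nonneg k
    linarith)
  have hrlim : Tendsto r atTop (𝓝 0) := by
    simpa [r, one_div] using tendsto_one_div_add_atTop_nhds_zero_nat (𝕜 := ℝ)
  let ψ : ℕ → Space n → ℝ := fun k x => χ (r k • x) * φ x
  have hψ : ∀ k, ContDiff ℝ ∞ (ψ k) := fun k =>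
    (hχ.comp (contDiff_id.const_smul (r k))).mul hφ
  have hχc : ∀ k, HasCompactSupport fun x : Space n => χ (r k • x) := fun k =>
    χ.hasCompactSupport.comp_homeomorph (Homeomorph.smulOfNeZero (r k) (hr0 k).ne')
  have hψc : ∀ k, HasCompactSupport (ψ k) := fun k => (hχc k).mul_right
  have hψ1 : ∀ k, ContDiff ℝ 1 (ψ k) := fun k => (hψ k).of_le (by norm_cast)
  have hd : ∀ k x i, fderiv ℝ (ψ k) x (EuclideanSpace.single i 1) =
      χ (r k • x) * fderiv ℝ φ x (EuclideanSpace.single i 1) +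
        r k * fderiv ℝ χ (r k • x) (EuclideanSpace.single i 1) * φ x := fun k x i => by
    have h1 : HasFDerivAt (fun x : Space n => χ (r k • x))
        ((fderiv ℝ χ (r k • x)).comp (r k • ContinuousLinearMap.id ℝ (Space n))) x :=
      ((hχ1.differentiable (by norm_num) _).hasFDerivAt).comp x
        ((hasFDerivAt_id x).const_smul (r k))
    have h2 := h1.mul (hφ1.differentiable (by norm_num) x).hasFDerivAt
    rw [show ψ k = (fun x : Space n => χ (r k • x)) * φ from rfl, h2.fderiv]
    simp
    ring
  have hLv : ∀ k, MemLp (ψ k) 2 volume := fun k =>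
    (hψ k).continuous.memLp_of_hasCompactSupport (hψc k)
  have hLw : ∀ k i, MemLp (fun x => fderiv ℝ (ψ k) x (EuclideanSpace.single i 1)) 2 volume :=
    fun k i => Continuous.memLp_of_hasCompactSupport
      (((hψ1 k).continuous_fderiv (by norm_num)).clm_apply continuous_const)
      ((hψc k).fderiv_apply (𝕜 := ℝ) _)
  have hχlim : ∀ x : Space n, Tendsto (fun k => χ (r k • x)) atTop (𝓝 1) := fun x => by
    have h1 : Tendsto (fun k => r k • x) atTop (𝓝 0) := by simpa using hrlim.smul_const x
    have h2 := (hχ.continuous.tendsto (0 : Space n)).comp h1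
    rwa [χ.one_of_mem_closedBall (Metric.mem_closedBall_self (by norm_num))] at h2
  have hvlim : Tendsto (fun k => (hLv k).toLp) atTop (𝓝 v) := by
    refine tendsto_H0_of_dominated (fun k => (hLv k).coeFn_toLp) hv
      (((memLp_congr_ae hv).1 (Lp.memLp v)).norm) (Eventually.of_forall fun k =>
        ae_of_all _ fun x => ?_) (ae_of_all _ fun x => ?_)
    · have h1 : ψ k x - φ x = (χ (r k • x) - 1) * φ x := by simp only [ψ]; ring
      rw [h1, abs_mul, Real.norm_eq_abs]
      refine mul_le_of_le_one_left (abs_nonneg _) ?_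
      rw [abs_le]
      constructor <;> linarith [χ.nonneg (x := r k • x), χ.le_one (x := r k • x)]
    · simpa using (hχlim x).mul_const (φ x)
  have hwlim : ∀ i, Tendsto (fun k => (hLw k i).toLp) atTop (𝓝 (w i)) := fun i => by
    have hm1 : MemLp (fun x => fderiv ℝ φ x (EuclideanSpace.single i 1)) 2 volume :=
      (memLp_congr_ae (hw i)).1 (Lp.memLp (w i))
    have hm2 : MemLp φ 2 volume := (memLp_congr_ae hv).1 (Lp.memLp v)
    refine tendsto_H0_of_dominated (fun k => (hLw k i).coeFn_toLp) (hw i)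
      (hm1.norm.add (hm2.norm.const_mul C)) (Eventually.of_forall fun k =>
        ae_of_all _ fun x => ?_) (ae_of_all _ fun x => ?_)
    · have h1 : fderiv ℝ (ψ k) x (EuclideanSpace.single i 1)
          - fderiv ℝ φ x (EuclideanSpace.single i 1) =
          (χ (r k • x) - 1) * fderiv ℝ φ x (EuclideanSpace.single i 1) +
          r k * fderiv ℝ χ (r k • x) (EuclideanSpace.single i 1) * φ x := by rw [hd]; ring
      rw [h1]
      refine (abs_add_le _ _).trans (add_le_add ?_ ?_)
      · rw [abs_mul]; simp only [Real.norm_eq_abs]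
        refine mul_le_of_le_one_left (abs_nonneg _) ?_
        rw [abs_le]
        constructor <;> linarith [χ.nonneg (x := r k • x), χ.le_one (x := r k • x)]
      · rw [abs_mul]; simp only [Real.norm_eq_abs]
        refine mul_le_mul_of_nonneg_right ?_ (abs_nonneg _)
        rw [abs_mul, abs_of_pos (hr0 k)]
        have h2 : |fderiv ℝ χ (r k • x) (EuclideanSpace.single i 1)| ≤ C := by
          refine ((fderiv ℝ χ (r k • x)).le_opNorm _).trans ?_
          simpa using hC (r k • x)
        calc r k * |fderiv ℝ χ (r k • x) (EuclideanSpace.single i 1)|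
            ≤ 1 * |fderiv ℝ χ (r k • x) (EuclideanSpace.single i 1)| :=
              mul_le_mul_of_nonneg_right (hr1 k) (abs_nonneg _)
          _ ≤ C := by rwa [one_mul]
    · simp only [hd]
      have h1 : Tendsto (fun k => r k • x) atTop (𝓝 0) := by simpa using hrlim.smul_const x
      have h2 := (((hχ1.continuous_fderiv (by norm_num)).clm_apply
        (continuous_const (y := (EuclideanSpace.single i 1 : Space n)))).tendsto 0).comp h1
      have h3 := ((hχlim x).mul_const (fderiv ℝ φ x (EuclideanSpace.single i 1))).add
        ((hrlim.mul h2).mul_const (φ x))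
      simpa using h3
  have hev : ∀ᶠ k in atTop, ‖(hLv k).toLp - v‖ ≤ ε ∧ ∀ i, ‖(hLw k i).toLp - w i‖ ≤ ε :=
    ((tendsto_iff_norm_sub_tendsto_zero.1 hvlim).eventually_le_const hε).and
      (eventually_all.2 fun i =>
        (tendsto_iff_norm_sub_tendsto_zero.1 (hwlim i)).eventually_le_const hε)
  obtain ⟨k, hk⟩ := hev.exists
  exact ⟨ψ k, hψ k, hψc k, (hLv k).toLp, fun i => (hLw k i).toLp, (hLv k).coeFn_toLp,
    fun i => (hLw k i).coeFn_toLp, hk⟩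

/-- Smooth compactly supported functions are dense in `W₂¹(ℝⁿ)`. -/
theorem exists_seq_testFunction {n : ℕ} {u : H0 n} {D : Fin n → H0 n}
    (hD : ∀ i, HasWeakPartial i u (D i)) :
    ∃ (ψ : ℕ → Space n → ℝ) (v : ℕ → H0 n) (w : ℕ → Fin n → H0 n),
      (∀ k, ContDiff ℝ ∞ (ψ k)) ∧ (∀ k, HasCompactSupport (ψ k)) ∧
      (∀ k, v k =ᵐ[volume] ψ k) ∧
      (∀ k i, w k i =ᵐ[volume] fun x => fderiv ℝ (ψ k) x (EuclideanSpace.single i 1)) ∧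
      Tendsto v atTop (𝓝 u) ∧ ∀ i, Tendsto (fun k => w k i) atTop (𝓝 (D i)) := by
  have key : ∀ k : ℕ, ∃ ψ : Space n → ℝ, ContDiff ℝ ∞ ψ ∧ HasCompactSupport ψ ∧
      ∃ (v' : H0 n) (w' : Fin n → H0 n), v' =ᵐ[volume] ψ ∧
      (∀ i, w' i =ᵐ[volume] fun x => fderiv ℝ ψ x (EuclideanSpace.single i 1)) ∧
      ‖v' - u‖ ≤ 2 * (1 / ((k : ℝ) + 1)) ∧ ∀ i, ‖w' i - D i‖ ≤ 2 * (1 / ((k : ℝ) + 1)) := by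
    intro k
    have hε : 0 < 1 / ((k : ℝ) + 1) := by positivity
    obtain ⟨φ, v, w, h1, h2, h3, h4, h5⟩ := exists_smooth_approx hD hε
    obtain ⟨ψ, g1, g2, v', w', g3, g4, g5, g6⟩ := exists_cutoff_approx h1 h2 h3 hε
    refine ⟨ψ, g1, g2, v', w', g3, g4, ?_, fun i => ?_⟩
    · calc ‖v' - u‖ ≤ ‖v' - v‖ + ‖v - u‖ := norm_sub_le_norm_sub_add_norm_sub _ _ _
        _ ≤ _ := by linarith
    · calc ‖w' i - D i‖ ≤ ‖w' i - w i‖ + ‖w i - D i‖ := norm_sub_le_norm_sub_add_norm_sub _ _ _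
        _ ≤ _ := by linarith [g6 i, h5 i]
  choose ψ g1 g2 v w g3 g4 g5 g6 using key
  have hlim : Tendsto (fun k : ℕ => 2 * (1 / ((k : ℝ) + 1))) atTop (𝓝 0) := by
    simpa using tendsto_one_div_add_atTop_nhds_zero_nat.const_mul (2 : ℝ)
  exact ⟨ψ, v, w, g1, g2, g3, g4,
    tendsto_iff_norm_sub_tendsto_zero.2 (squeeze_zero (fun _ => norm_nonneg _) g5 hlim),
    fun i => tendsto_iff_norm_sub_tendsto_zero.2
      (squeeze_zero (fun _ => norm_nonneg _) (fun k => g6 k i) hlim)⟩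

/-! ### Integration by parts in `W₂¹(ℝⁿ)` -/

/-- The weak derivative may be tested against compactly supported functions of class `C¹`. -/
theorem integral_mul_fderiv_eq_of_weak {n : ℕ} {u : H0 n} {D : Fin n → H0 n}
    (hD : ∀ i, HasWeakPartial i u (D i)) {η : Space n → ℝ} (hη : ContDiff ℝ 1 η)
    (hηc : HasCompactSupport η) (i : Fin n) :
    ∫ x, u x * fderiv ℝ η x (EuclideanSpace.single i 1) = - ∫ x, D i x * η x := by
  obtain ⟨ψ, v, w, h1, h2, h3, h4, h5, h6⟩ := exists_seq_testFunction hD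
  have hη' : Continuous fun x => fderiv ℝ η x (EuclideanSpace.single i 1) :=
    (hη.continuous_fderiv (by norm_num)).clm_apply continuous_const
  have hm1 : MemLp η 2 volume := hη.continuous.memLp_of_hasCompactSupport hηc
  have hm2 : MemLp (fun x => fderiv ℝ η x (EuclideanSpace.single i 1)) 2 volume :=
    hη'.memLp_of_hasCompactSupport (hηc.fderiv_apply (𝕜 := ℝ) _)
  rw [← inner_eq_integral_right u hm2.coeFn_toLp, ← inner_eq_integral_right (D i) hm1.coeFn_toLp]
  refine tendsto_nhds_unique (h5.inner tendsto_const_nhds)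
    (((h6 i).inner tendsto_const_nhds).neg.congr fun k => ?_)
  have hψ1 : ContDiff ℝ 1 (ψ k) := (h1 k).of_le (by norm_cast)
  rw [inner_eq_integral_right (v k) hm2.coeFn_toLp, inner_eq_integral_right (w k i) hm1.coeFn_toLp]
  have e1 : ∫ x, v k x * fderiv ℝ η x (EuclideanSpace.single i 1) =
      ∫ x, ψ k x * fderiv ℝ η x (EuclideanSpace.single i 1) :=
    integral_congr_ae ((h3 k).mono fun x hx => by simp only [hx])
  have e2 : ∫ x, w k i x * η x = ∫ x, fderiv ℝ (ψ k) x (EuclideanSpace.single i 1) * η x :=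
    integral_congr_ae ((h4 k i).mono fun x hx => by simp only [hx])
  rw [e1, e2]
  have hψ' : Continuous fun x => fderiv ℝ (ψ k) x (EuclideanSpace.single i 1) :=
    (hψ1.continuous_fderiv (by norm_num)).clm_apply continuous_const
  refine (integral_mul_fderiv_eq_neg_fderiv_mul_of_integrable ?_ ?_ ?_
    (fun x _ => hψ1.differentiable (by norm_num) x)
    (fun x _ => hη.differentiable (by norm_num) x)).symm
  · exact (hψ'.mul hη.continuous).integrable_of_hasCompactSupport hηc.mul_left
  · exact (hψ1.continuous.mul hη').integrable_of_hasCompactSupport (h2 k).mul_right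
  · exact (hψ1.continuous.mul hη.continuous).integrable_of_hasCompactSupport hηc.mul_left

/-- For a bounded coefficient `b` of class `C¹` with bounded derivative,
`∫ b u ∂ᵢu = -½ ∫ (∂ᵢb) u²`. -/
theorem inner_mulOp_partial {n : ℕ} {u : H0 n} {D : Fin n → H0 n}
    (hD : ∀ i, HasWeakPartial i u (D i)) {b : Space n → ℝ} (hb : ContDiff ℝ 1 b) {C : ℝ}
    (hC : ∀ x, |b x| ≤ C) (i : Fin n) {b' : Space n → ℝ}
    (hb'e : b' = fun x => fderiv ℝ b x (EuclideanSpace.single i 1))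
    (hb' : AEStronglyMeasurable b' volume) {C' : ℝ} (hC' : ∀ x, |b' x| ≤ C') :
    2 * inner ℝ (mulOp b hb.continuous.aestronglyMeasurable C hC (D i)) u =
      - inner ℝ (mulOp b' hb' C' hC' u) u := by
  obtain ⟨ψ, v, w, h1, h2, h3, h4, h5, h6⟩ := exists_seq_testFunction hD
  refine tendsto_nhds_unique
    (((((mulOp b hb.continuous.aestronglyMeasurable C hC).continuous.tendsto _).comp
      (h6 i)).inner h5).const_mul 2)
    (((((mulOp b' hb' C' hC').continuous.tendsto _).comp h5).inner h5).neg.congr fun k => ?_)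
  have hψ1 : ContDiff ℝ 1 (ψ k) := (h1 k).of_le (by norm_cast)
  have hψ' : Continuous fun x => fderiv ℝ (ψ k) x (EuclideanSpace.single i 1) :=
    (hψ1.continuous_fderiv (by norm_num)).clm_apply continuous_const
  have hbc : Continuous b' := by
    rw [hb'e]; exact (hb.continuous_fderiv (by norm_num)).clm_apply continuous_const
  simp only [Function.comp_apply]
  rw [inner_eq_integral_right _ (h3 k), inner_eq_integral_right _ (h3 k)]
  have e1 : ∫ x, mulOp b' hb' C' hC' (v k) x * ψ k x = ∫ x, b' x * ψ k x * ψ k x := by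
    refine integral_congr_ae ?_
    filter_upwards [mulOp_coeFn hb' hC' (v k), h3 k] with x h7 h8
    rw [h7, h8]
  have e2 : ∫ x, mulOp b hb.continuous.aestronglyMeasurable C hC (w k i) x * ψ k x =
      ∫ x, b x * fderiv ℝ (ψ k) x (EuclideanSpace.single i 1) * ψ k x := by
    refine integral_congr_ae ?_
    filter_upwards [mulOp_coeFn hb.continuous.aestronglyMeasurable hC (w k i), h4 k i]
      with x h7 h8
    rw [h7, h8]
  rw [e1, e2]
  have hfd : ∀ x, fderiv ℝ (fun x => b x * ψ k x) x (EuclideanSpace.single i 1) =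
      b x * fderiv ℝ (ψ k) x (EuclideanSpace.single i 1) + b' x * ψ k x := fun x => by
    rw [hb'e, show (fun x => b x * ψ k x) = b * ψ k from rfl,
      ((hb.differentiable (by norm_num) x).hasFDerivAt.mul
      (hψ1.differentiable (by norm_num) x).hasFDerivAt).fderiv]
    simp
    ring
  have I1 : Integrable fun x => b x * fderiv ℝ (ψ k) x (EuclideanSpace.single i 1) * ψ k x :=
    ((hb.continuous.mul hψ').mul hψ1.continuous).integrable_of_hasCompactSupport (h2 k).mul_left
  have I2 : Integrable fun x => b' x * ψ k x * ψ k x :=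
    ((hbc.mul hψ1.continuous).mul hψ1.continuous).integrable_of_hasCompactSupport
      (h2 k).mul_left
  have h9 := integral_mul_fderiv_eq_neg_fderiv_mul_of_integrable (μ := volume)
    (f := ψ k) (g := fun x => b x * ψ k x) (v := EuclideanSpace.single i 1)
    (I1.congr (ae_of_all _ fun x => by ring))
    ((I1.add I2).congr (ae_of_all _ fun x => by simp only [Pi.add_apply, hfd]; ring))
    ((hψ1.continuous.mul (hb.continuous.mul hψ1.continuous)).integrable_of_hasCompactSupport
      (h2 k).mul_right)
    (fun x _ => hψ1.differentiable (by norm_num) x)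
    (fun x _ => (hb.mul hψ1).differentiable (by norm_num) x)
  have e3 : ∫ x, ψ k x * fderiv ℝ (fun x => b x * ψ k x) x (EuclideanSpace.single i 1) =
      (∫ x, b x * fderiv ℝ (ψ k) x (EuclideanSpace.single i 1) * ψ k x) +
        ∫ x, b' x * ψ k x * ψ k x := by
    rw [← integral_add I1 I2]
    exact integral_congr_ae (ae_of_all _ fun x => by simp only [hfd]; ring)
  have e4 : ∫ x, fderiv ℝ (ψ k) x (EuclideanSpace.single i 1) * (b x * ψ k x) =
      ∫ x, b x * fderiv ℝ (ψ k) x (EuclideanSpace.single i 1) * ψ k x :=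
    integral_congr_ae (ae_of_all _ fun x => by ring)
  rw [e3, e4] at h9
  linarith

/-! ### Carathéodory differential equations -/

section ODE

variable {E : Type*} [NormedAddCommGroup E]

/-- A right-hand side `G(x, t)` defined for all times, Lipschitz in `x` with a constant `K` that
also bounds `G(0, t)`, and measurable in `t` along continuous curves. -/
structure IsODEField (G : E → ℝ → E) (K : ℝ) : Prop where
  aestronglyMeasurable : ∀ y : ℝ → E, Continuous y →
    AEStronglyMeasurable (fun τ => G (y τ) τ) volume
  lipschitz : ∀ τ x x', ‖G x τ - G x' τ‖ ≤ K * ‖x - x'‖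
  bound : ∀ τ, ‖G 0 τ‖ ≤ K

theorem IsODEField.nonneg {G : E → ℝ → E} {K : ℝ} (hG : IsODEField G K) : 0 ≤ K :=
  (norm_nonneg _).trans (hG.bound 0)

theorem IsODEField.norm_le {G : E → ℝ → E} {K : ℝ} (hG : IsODEField G K) (x : E) (τ : ℝ) :
    ‖G x τ‖ ≤ K * (1 + ‖x‖) := by
  have h1 := hG.lipschitz τ x 0
  have h2 := hG.bound τ
  have h3 : ‖G x τ‖ ≤ ‖G x τ - G 0 τ‖ + ‖G 0 τ‖ := by
    simpa using norm_add_le (G x τ - G 0 τ) (G 0 τ)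
  rw [sub_zero] at h1
  linarith

theorem IsODEField.intervalIntegrable {G : E → ℝ → E} {K : ℝ} (hG : IsODEField G K) {y : ℝ → E}
    (hy : Continuous y) (a b : ℝ) : IntervalIntegrable (fun τ => G (y τ) τ) volume a b := by
  have h1 : Continuous fun τ => K * (1 + ‖y τ‖) := by fun_prop
  exact (h1.intervalIntegrable a b).mono_fun' (hG.aestronglyMeasurable y hy).restrict
    (ae_of_all _ fun τ => hG.norm_le _ _)

variable [NormedSpace ℝ E]

/-- `y` is a solution on the whole time axis of `dy/dt = G(y, t)`, `y(s) = x`. -/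
def IsODESolution (G : E → ℝ → E) (s : ℝ) (x : E) (y : ℝ → E) : Prop :=
  Continuous y ∧ ∀ t, y t = x + ∫ τ in s..t, G (y τ) τ

theorem norm_integral_le_exp_weight {h : ℝ → E} {C l s : ℝ} (hl : 0 < l) (hC : 0 ≤ C)
    (hh : ∀ τ, ‖h τ‖ ≤ C * Real.exp (l * |τ - s|)) (t : ℝ) :
    ‖∫ τ in s..t, h τ‖ ≤ C / l * Real.exp (l * |t - s|) := by
  have hcont : Continuous fun τ => C * Real.exp (l * |τ - s|) := by fun_prop
  rcases le_total s t with hst | hst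
  · have h1 := intervalIntegral.norm_integral_le_of_norm_le hst
      (ae_of_all volume fun τ _ => hh τ) (hcont.intervalIntegrable s t)
    have h2 : ∫ τ in s..t, C * Real.exp (l * |τ - s|) =
        C / l * Real.exp (l * (t - s)) - C / l * Real.exp (l * (s - s)) := by
      rw [← intervalIntegral.integral_eq_sub_of_hasDerivAt
        (f := fun τ => C / l * Real.exp (l * (τ - s)))
        (f' := fun τ => C * Real.exp (l * (τ - s)))]
      · refine intervalIntegral.integral_congr fun τ hτ => ?_
        rw [uIcc_of_le hst] at hτ
        simp only [abs_of_nonneg (sub_nonneg.2 hτ.1)]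
      · intro τ _
        have h3 : HasDerivAt (fun τ => l * (τ - s)) (l * 1) τ :=
          ((hasDerivAt_id τ).sub_const s).const_mul l
        convert! (h3.exp).const_mul (C / l) using 1
        field_simp
      · exact Continuous.intervalIntegrable (by fun_prop) _ _
    rw [abs_of_nonneg (sub_nonneg.2 hst)]
    have : 0 ≤ C / l * Real.exp (l * (s - s)) := by positivity
    linarith
  · have h1 := intervalIntegral.norm_integral_le_of_norm_le hst
      (ae_of_all volume fun τ _ => hh τ) (hcont.intervalIntegrable t s)
    have h2 : ∫ τ in t..s, C * Real.exp (l * |τ - s|) =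
        -(C / l) * Real.exp (l * (s - s)) - -(C / l) * Real.exp (l * (s - t)) := by
      rw [← intervalIntegral.integral_eq_sub_of_hasDerivAt
        (f := fun τ => -(C / l) * Real.exp (l * (s - τ)))
        (f' := fun τ => C * Real.exp (l * (s - τ)))]
      · refine intervalIntegral.integral_congr fun τ hτ => ?_
        rw [uIcc_of_le hst] at hτ
        simp only [abs_of_nonpos (sub_nonpos.2 hτ.2), neg_sub]
      · intro τ _
        have h3 : HasDerivAt (fun τ => l * (s - τ)) (l * -1) τ :=
          ((hasDerivAt_id τ).const_sub s).const_mul l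
        convert! (h3.exp).const_mul (-(C / l)) using 1
        field_simp
      · exact Continuous.intervalIntegrable (by fun_prop) _ _
    rw [intervalIntegral.integral_symm, norm_neg, abs_of_nonpos (sub_nonpos.2 hst), neg_sub]
    have : 0 ≤ C / l * Real.exp (l * (s - s)) := by positivity
    linarith

/-- Global existence. In terms of `u(t) = e^{-λ|t-s|} (y(t) - x)` the integral equation is a fixed
point equation for a contraction of the space of bounded continuous functions on `ℝ`. -/
theorem IsODEField.exists_solution [CompleteSpace E] {G : E → ℝ → E} {K : ℝ}
    (hG : IsODEField G K) (s : ℝ) (x : E) : ∃ y, IsODESolution G s x y := by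
  have hK := hG.nonneg
  set l : ℝ := 2 * K + 1 with hl
  have hl0 : 0 < l := by positivity
  let c : (BoundedContinuousFunction ℝ E) → ℝ → E := fun u τ => x + Real.exp (l * |τ - s|) • u τ
  have hc : ∀ u, Continuous (c u) := fun u =>
    continuous_const.add (Continuous.smul (by fun_prop) u.continuous)
  have hint : ∀ u a b, IntervalIntegrable (fun τ => G (c u τ) τ) volume a b := fun u =>
    hG.intervalIntegrable (hc u)
  have hcont : ∀ u, Continuous fun t => Real.exp (-(l * |t - s|)) • ∫ τ in s..t, G (c u τ) τ :=
    fun u => Continuous.smul (by fun_prop)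
      (intervalIntegral.continuous_primitive (fun a b => hint u a b) s)
  have hexp : ∀ τ, 1 ≤ Real.exp (l * |τ - s|) := fun τ => Real.one_le_exp (by positivity)
  have hcancel : ∀ t C : ℝ, Real.exp (-(l * |t - s|)) * (C * Real.exp (l * |t - s|)) = C :=
    fun t C => by rw [mul_left_comm, ← Real.exp_add]; simp
  have hbd : ∀ u t, ‖Real.exp (-(l * |t - s|)) • ∫ τ in s..t, G (c u τ) τ‖ ≤
      K * (1 + ‖x‖ + ‖u‖) / l := fun u t => by
    have h1 : ∀ τ, ‖G (c u τ) τ‖ ≤ K * (1 + ‖x‖ + ‖u‖) * Real.exp (l * |τ - s|) := fun τ => by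
      refine (hG.norm_le _ _).trans ?_
      rw [mul_assoc]
      refine mul_le_mul_of_nonneg_left ?_ hK
      have h2 : ‖c u τ‖ ≤ ‖x‖ + Real.exp (l * |τ - s|) * ‖u‖ := by
        refine (norm_add_le _ _).trans ?_
        rw [norm_smul, Real.norm_of_nonneg (Real.exp_pos _).le]
        gcongr
        exact u.norm_coe_le_norm τ
      nlinarith [hexp τ, norm_nonneg x]
    have h2 := norm_integral_le_exp_weight hl0 (by positivity) h1 t
    rw [norm_smul, Real.norm_of_nonneg (Real.exp_pos _).le]
    refine (mul_le_mul_of_nonneg_left h2 (Real.exp_pos _).le).trans_eq (hcancel _ _)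
  let Γ : BoundedContinuousFunction ℝ E → BoundedContinuousFunction ℝ E := fun u =>
    BoundedContinuousFunction.ofNormedAddCommGroup _ (hcont u) _ (hbd u)
  have hΓ : ContractingWith (1 / 2) Γ := by
    refine ⟨by rw [← NNReal.coe_lt_coe]; norm_num, LipschitzWith.of_dist_le_mul fun u v => ?_⟩
    rw [BoundedContinuousFunction.dist_le (by positivity)]
    intro t
    have h1 : ∀ τ, ‖G (c u τ) τ - G (c v τ) τ‖ ≤ K * dist u v * Real.exp (l * |τ - s|) := by
      intro τ
      refine (hG.lipschitz _ _ _).trans ?_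
      rw [mul_assoc]
      refine mul_le_mul_of_nonneg_left ?_ hK
      have h2 : c u τ - c v τ = Real.exp (l * |τ - s|) • (u τ - v τ) := by
        simp only [c, smul_sub]; abel
      rw [h2, norm_smul, Real.norm_of_nonneg (Real.exp_pos _).le, mul_comm, ← dist_eq_norm]
      exact mul_le_mul_of_nonneg_right (u.dist_coe_le_dist τ) (Real.exp_pos _).le
    have h2 := norm_integral_le_exp_weight hl0 (by positivity) h1 t
    have h3 : Γ u t - Γ v t =
        Real.exp (-(l * |t - s|)) • ∫ τ in s..t, (G (c u τ) τ - G (c v τ) τ) := by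
      rw [intervalIntegral.integral_sub (hint u _ _) (hint v _ _), smul_sub]
      rfl
    rw [dist_eq_norm, h3, norm_smul, Real.norm_of_nonneg (Real.exp_pos _).le]
    refine ((mul_le_mul_of_nonneg_left h2 (Real.exp_pos _).le).trans_eq (hcancel _ _)).trans ?_
    rw [div_le_iff₀ hl0]
    have : (((1 / 2 : NNReal)) : ℝ) = 1 / 2 := by norm_num
    rw [this]
    nlinarith [dist_nonneg (x := u) (y := v)]
  have hfix := hΓ.fixedPoint_isFixedPt
  set u := hΓ.fixedPoint with hu
  refine ⟨c u, hc u, fun t => ?_⟩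
  have h1 : u t = Real.exp (-(l * |t - s|)) • ∫ τ in s..t, G (c u τ) τ := by
    conv_lhs => rw [← hfix]
    rfl
  change x + Real.exp (l * |t - s|) • u t = _
  rw [h1, smul_smul, ← Real.exp_add]
  simp

end ODE

theorem gronwall_forward {d : ℝ → ℝ} {a K s b : ℝ} (hK : 0 ≤ K) (hd : Continuous d)
    (h : ∀ t ∈ Icc s b, d t ≤ a + K * ∫ τ in s..t, d τ) {t : ℝ} (ht : t ∈ Icc s b) :
    d t ≤ a * Real.exp (K * (t - s)) := by
  let φ : ℝ → ℝ := fun t => Real.exp (-(K * (t - s))) * (a + K * ∫ τ in s..t, d τ)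
  have hφ : ∀ t, HasDerivAt φ (Real.exp (-(K * (t - s))) * (-(K * 1)) *
      (a + K * ∫ τ in s..t, d τ) + Real.exp (-(K * (t - s))) * (K * d t)) t := fun t => by
    have h1 : HasDerivAt (fun t => -(K * (t - s))) (-(K * 1)) t :=
      (((hasDerivAt_id t).sub_const s).const_mul K).neg
    have h2 : HasDerivAt (fun t => ∫ τ in s..t, d τ) (d t) t :=
      (hd.integral_hasStrictDerivAt s t).hasDerivAt
    exact h1.exp.mul ((h2.const_mul K).const_add a)
  have hanti : AntitoneOn φ (Icc s b) := by
    refine antitoneOn_of_deriv_nonpos (convex_Icc _ _)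
      (fun t _ => (hφ t).continuousAt.continuousWithinAt)
      (fun t _ => (hφ t).differentiableAt.differentiableWithinAt) fun t ht => ?_
    rw [interior_Icc] at ht
    rw [(hφ t).deriv]
    have h1 := h t ⟨ht.1.le, ht.2.le⟩
    have h2 : 0 ≤ Real.exp (-(K * (t - s))) * K := by positivity
    nlinarith
  have h1 := hanti ⟨le_rfl, ht.1.trans ht.2⟩ ht ht.1
  have h2 : φ s = a := by simp [φ]
  rw [h2] at h1
  have h3 : a + K * ∫ τ in s..t, d τ = Real.exp (K * (t - s)) * φ t := by
    simp only [φ]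
    rw [← mul_assoc, ← Real.exp_add]
    simp
  calc d t ≤ a + K * ∫ τ in s..t, d τ := h t ht
    _ = Real.exp (K * (t - s)) * φ t := h3
    _ ≤ Real.exp (K * (t - s)) * a := by gcongr
    _ = _ := mul_comm _ _

/-- Grönwall's inequality in integral form, in either direction of time. -/
theorem gronwall {d : ℝ → ℝ} {a K s t : ℝ} (hK : 0 ≤ K) (hd : Continuous d) (hd0 : ∀ τ, 0 ≤ d τ)
    (h : ∀ τ ∈ uIcc s t, d τ ≤ a + K * |∫ σ in s..τ, d σ|) :
    d t ≤ a * Real.exp (K * |t - s|) := by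
  rcases le_total s t with hst | hst
  · rw [abs_of_nonneg (sub_nonneg.2 hst)]
    refine gronwall_forward hK hd (fun τ hτ => ?_) (right_mem_Icc.2 hst)
    have h1 := h τ (by rwa [uIcc_of_le hst])
    rwa [abs_of_nonneg (intervalIntegral.integral_nonneg hτ.1 fun σ _ => hd0 σ)] at h1
  · rw [abs_of_nonpos (sub_nonpos.2 hst)]
    have h1 := gronwall_forward (d := fun τ => d (-τ)) (a := a) (s := -s) (b := -t) (t := -t) hK
      (by fun_prop) (fun τ hτ => ?_) (right_mem_Icc.2 (by linarith))
    · simp only [neg_neg] at h1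
      refine h1.trans_eq (by ring_nf)
    · have h2 := h (-τ) (by rw [uIcc_of_ge hst]; constructor <;> linarith [hτ.1, hτ.2])
      have h3 : ∫ σ in (-s)..τ, d (-σ) = -∫ σ in s..(-τ), d σ := by
        rw [intervalIntegral.integral_comp_neg, neg_neg, intervalIntegral.integral_symm]
      have h4 : 0 ≤ ∫ σ in (-s)..τ, d (-σ) :=
        intervalIntegral.integral_nonneg hτ.1 fun σ _ => hd0 _
      rw [h3] at h4 ⊢
      rwa [abs_of_nonpos (by linarith)] at h2

section ODE

variable {E : Type*} [NormedAddCommGroup E] [NormedSpace ℝ E]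

theorem IsODESolution.dist_le {G : E → ℝ → E} {K : ℝ} (hG : IsODEField G K) {s : ℝ} {x x' : E}
    {y z : ℝ → E} (hy : IsODESolution G s x y) (hz : IsODESolution G s x' z) (t : ℝ) :
    ‖y t - z t‖ ≤ ‖x - x'‖ * Real.exp (K * |t - s|) := by
  refine gronwall (d := fun τ => ‖y τ - z τ‖) hG.nonneg (hy.1.sub hz.1).norm
    (fun τ => norm_nonneg _) fun τ _ => ?_
  have h1 : y τ - z τ = (x - x') + ∫ σ in s..τ, (G (y σ) σ - G (z σ) σ) := by
    rw [intervalIntegral.integral_sub (hG.intervalIntegrable hy.1 _ _)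
      (hG.intervalIntegrable hz.1 _ _), hy.2 τ, hz.2 τ]
    abel
  rw [h1]
  refine (norm_add_le _ _).trans (add_le_add le_rfl ?_)
  have hc : Continuous fun σ => K * ‖y σ - z σ‖ := (hy.1.sub hz.1).norm.const_mul K
  have h2 := intervalIntegral.norm_integral_le_abs_of_norm_le (a := s) (b := τ) (μ := volume)
    (f := fun σ => G (y σ) σ - G (z σ) σ) (g := fun σ => K * ‖y σ - z σ‖)
    (ae_of_all _ fun σ => hG.lipschitz σ _ _)
    (hc.intervalIntegrable _ _)
  rwa [intervalIntegral.integral_const_mul, abs_mul, abs_of_nonneg hG.nonneg] at h2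

theorem IsODESolution.eq {G : E → ℝ → E} {K : ℝ} (hG : IsODEField G K) {s : ℝ} {x : E}
    {y z : ℝ → E} (hy : IsODESolution G s x y) (hz : IsODESolution G s x z) : y = z := by
  funext t
  have := hy.dist_le hG hz t
  rw [sub_self, norm_zero, zero_mul] at this
  exact sub_eq_zero.1 (norm_le_zero_iff.1 this)

theorem IsODESolution.restart {G : E → ℝ → E} {K : ℝ} (hG : IsODEField G K) {s : ℝ} {x : E}
    {y : ℝ → E} (hy : IsODESolution G s x y) (r : ℝ) : IsODESolution G r (y r) y := by
  refine ⟨hy.1, fun t => ?_⟩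
  rw [hy.2 t, hy.2 r, add_assoc, intervalIntegral.integral_add_adjacent_intervals
    (hG.intervalIntegrable hy.1 _ _) (hG.intervalIntegrable hy.1 _ _)]

open Classical in
/-- The flow `Y_{s,t}(x)`: the value at time `t` of the solution that is at `x` at time `s`. -/
noncomputable def flow (G : E → ℝ → E) (s t : ℝ) (x : E) : E :=
  if h : ∃ y, IsODESolution G s x y then h.choose t else x

variable [CompleteSpace E] {G : E → ℝ → E} {K : ℝ}

theorem isODESolution_flow (hG : IsODEField G K) (s : ℝ) (x : E) :
    IsODESolution G s x (fun t => flow G s t x) := by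
  have h := hG.exists_solution s x
  have : (fun t => flow G s t x) = h.choose := by funext t; rw [flow, dif_pos h]
  rw [this]
  exact h.choose_spec

theorem flow_self (hG : IsODEField G K) (s : ℝ) (x : E) : flow G s s x = x := by
  have := (isODESolution_flow hG s x).2 s
  simpa using this

theorem flow_flow (hG : IsODEField G K) (s r t : ℝ) (x : E) :
    flow G r t (flow G s r x) = flow G s t x :=
  congrFun ((isODESolution_flow hG r (flow G s r x)).eq hG
    ((isODESolution_flow hG s x).restart hG r)) t

theorem flow_flow_cancel (hG : IsODEField G K) (s t : ℝ) (x : E) :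
    flow G t s (flow G s t x) = x := by
  rw [flow_flow hG, flow_self hG]

theorem norm_flow_sub_flow_le (hG : IsODEField G K) (s t : ℝ) (x x' : E) :
    ‖flow G s t x - flow G s t x'‖ ≤ ‖x - x'‖ * Real.exp (K * |t - s|) :=
  (isODESolution_flow hG s x).dist_le hG (isODESolution_flow hG s x') t

theorem norm_flow_sub_flow_time_le (hG : IsODEField G K) (hb : ∀ x τ, ‖G x τ‖ ≤ K) (s t t' : ℝ)
    (x : E) : ‖flow G s t x - flow G s t' x‖ ≤ K * |t - t'| := by
  have h1 := ((isODESolution_flow hG s x).restart hG t').2 t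
  simp only at h1
  rw [h1, add_sub_cancel_left]
  exact intervalIntegral.norm_integral_le_of_norm_le_const fun τ _ => hb _ _

theorem norm_flow_sub_le (hG : IsODEField G K) (hb : ∀ x τ, ‖G x τ‖ ≤ K) (s t : ℝ)
    (x : E) : ‖flow G s t x - x‖ ≤ K * |t - s| := by
  have := norm_flow_sub_flow_time_le hG hb s t s x
  rwa [flow_self hG] at this

theorem continuous_flow (hG : IsODEField G K) (hb : ∀ x τ, ‖G x τ‖ ≤ K) :
    Continuous fun p : ℝ × ℝ × E => flow G p.1 p.2.1 p.2.2 := by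
  rw [continuous_iff_continuousAt]
  rintro ⟨s, t, x⟩
  have h1 : ∀ p : ℝ × ℝ × E, ‖flow G p.1 p.2.1 p.2.2 - flow G s t x‖ ≤
      (‖p.2.2 - x‖ + K * |s - p.1|) * Real.exp (K * |p.2.1 - p.1|) + K * |p.2.1 - t| := by
    rintro ⟨s', t', x'⟩
    simp only
    have e1 : ‖flow G s' t' x' - flow G s t' x‖ ≤
        (‖x' - x‖ + K * |s - s'|) * Real.exp (K * |t' - s'|) := by
      have e2 := norm_flow_sub_flow_le hG s' t' x' (flow G s s' x)
      rw [flow_flow hG] at e2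
      refine e2.trans (mul_le_mul_of_nonneg_right ?_ (Real.exp_pos _).le)
      have e3 := norm_flow_sub_le hG hb s s' x
      rw [abs_sub_comm] at e3
      calc ‖x' - flow G s s' x‖ = ‖(x' - x) - (flow G s s' x - x)‖ := by congr 1; abel
        _ ≤ _ := (norm_sub_le _ _).trans (add_le_add le_rfl e3)
    calc ‖flow G s' t' x' - flow G s t x‖
        ≤ ‖flow G s' t' x' - flow G s t' x‖ + ‖flow G s t' x - flow G s t x‖ :=
          norm_sub_le_norm_sub_add_norm_sub _ _ _
      _ ≤ _ := add_le_add e1 (norm_flow_sub_flow_time_le hG hb s t' t x)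
  refine tendsto_iff_norm_sub_tendsto_zero.2 (squeeze_zero (fun _ => norm_nonneg _) h1 ?_)
  have hc : Continuous fun p : ℝ × ℝ × E =>
      (‖p.2.2 - x‖ + K * |s - p.1|) * Real.exp (K * |p.2.1 - p.1|) + K * |p.2.1 - t| := by
    fun_prop
  have h2 := hc.tendsto (s, t, x)
  simpa using h2

end ODE

/-! ### Regular fields and the differentiability of their flow -/

/-- A field defined for all times which is jointly Borel measurable, of class `C¹` in `x` at every
time, and bounded by `K` together with its `x`-derivative. An admissible field coincides with such
a field at almost all times. -/
structure IsRegularField {n : ℕ} (g : Space n → ℝ → Space n) (K : ℝ) : Prop where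
  measurable : Measurable (Function.uncurry g)
  contDiff : ∀ t, ContDiff ℝ 1 (fun x => g x t)
  bound : ∀ x t, ‖g x t‖ ≤ K
  bound_fderiv : ∀ x t, ‖fderiv ℝ (fun z => g z t) x‖ ≤ K

/-- At almost every time `f` agrees, on a countable dense set of points, with a Borel function; at
those times `g = f`, at all others `g = 0`. Joint measurability of `g` follows from its continuity
in `x`. -/
theorem IsAdmissibleField.exists_regular {n : ℕ} {T : ℝ} (hT : 0 < T)
    {f : Space n → ℝ → Space n} (hf : IsAdmissibleField T f) :
    ∃ g K, IsRegularField g K ∧ ∀ᵐ t ∂(timeMeasure T), ∀ x, f x t = g x t := by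
  obtain ⟨K, hK⟩ := hf.bounded
  obtain ⟨F, hF, hfF⟩ := hf.measurable
  have hK0 : 0 ≤ K := (norm_nonneg _).trans (hK 0 ⟨le_rfl, hT.le⟩ 0).1
  have h1 : ∀ᵐ x : Space n, ∀ᵐ t ∂(timeMeasure T), f x t = F (x, t) :=
    Measure.ae_ae_of_ae_prod hfF
  obtain ⟨D, hDs, hDc, hD⟩ := (Measure.dense_of_ae h1).exists_countable_dense_subset
  have h2 : ∀ᵐ t ∂(timeMeasure T), t ∈ Icc 0 T ∧ ∀ x ∈ D, f x t = F (x, t) :=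
    (ae_restrict_mem measurableSet_Icc).and
      ((ae_ball_iff hDc).2 fun x hx => hDs hx)
  obtain ⟨S, hS, hSm, hSp⟩ := h2.exists_measurable_mem
  classical
  let g : Space n → ℝ → Space n := fun x t => if t ∈ S then f x t else 0
  have hg1 : ∀ t ∈ S, (fun x => g x t) = fun x => f x t := fun t ht => by
    funext x; simp only [g, if_pos ht]
  have hg2 : ∀ t, t ∉ S → (fun x => g x t) = fun _ => 0 := fun t ht => by
    funext x; simp only [g, if_neg ht]
  have hcd : ∀ t, ContDiff ℝ 1 fun x => g x t := fun t => by
    by_cases ht : t ∈ S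
    · rw [hg1 t ht]; exact hf.contDiff t (hSp t ht).1
    · rw [hg2 t ht]; exact contDiff_const
  have hmD : ∀ x ∈ D, Measurable (g x) := fun x hx => by
    have : g x = fun t => if t ∈ S then F (x, t) else 0 := by
      funext t
      by_cases ht : t ∈ S
      · simp only [g, if_pos ht, (hSp t ht).2 x hx]
      · simp only [g, if_neg ht]
    rw [this]
    exact Measurable.ite hSm (hF.comp measurable_prodMk_left) measurable_const
  have hm : ∀ x, Measurable (g x) := fun x => by
    obtain ⟨u, huD, hu⟩ := mem_closure_iff_seq_limit.1 (hD x)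
    refine measurable_of_tendsto_metrizable (fun k => hmD (u k) (huD k)) ?_
    exact tendsto_pi_nhds.2 fun t => ((hcd t).continuous.tendsto x).comp hu
  refine ⟨g, K, ⟨measurable_uncurry_of_continuous_of_measurable (fun t => (hcd t).continuous) hm,
    hcd, fun x t => ?_, fun x t => ?_⟩, ?_⟩
  · by_cases ht : t ∈ S
    · simp only [g, if_pos ht]; exact (hK t (hSp t ht).1 x).1
    · simpa only [g, if_neg ht, norm_zero] using hK0
  · by_cases ht : t ∈ S
    · rw [hg1 t ht]; exact (hK t (hSp t ht).1 x).2
    · rw [hg2 t ht]; simpa using hK0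
  · filter_upwards [hS] with t ht x
    simp only [g, if_pos ht]

section Regular

variable {n : ℕ} {g : Space n → ℝ → Space n} {K : ℝ}

theorem IsRegularField.toODE (hg : IsRegularField g K) : IsODEField g K where
  aestronglyMeasurable y hy :=
    (hg.measurable.comp (hy.measurable.prodMk measurable_id)).aestronglyMeasurable
  lipschitz τ x x' := Convex.norm_image_sub_le_of_norm_fderiv_le
    (fun z _ => (hg.contDiff τ).differentiable (by norm_num) z)
    (fun z _ => hg.bound_fderiv z τ) convex_univ (mem_univ _) (mem_univ _)
  bound τ := hg.bound 0 τ

theorem IsRegularField.measurable_fderiv_apply (hg : IsRegularField g K) (v : Space n) :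
    Measurable fun p : Space n × ℝ => fderiv ℝ (fun z => g z p.2) p.1 v := by
  have h1 : ∀ k : ℕ, Measurable fun p : Space n × ℝ =>
      ((k : ℝ) + 1) • (g (p.1 + ((k : ℝ) + 1)⁻¹ • v) p.2 - g p.1 p.2) := fun k => by
    have h2 : Measurable fun p : Space n × ℝ => g (p.1 + ((k : ℝ) + 1)⁻¹ • v) p.2 :=
      hg.measurable.comp ((measurable_fst.add_const _).prodMk measurable_snd)
    exact (h2.sub hg.measurable).const_smul ((k : ℝ) + 1)
  refine measurable_of_tendsto_metrizable h1 (tendsto_pi_nhds.2 fun p => ?_)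
  have h2 := ((hg.contDiff p.2).differentiable (by norm_num) p.1).hasFDerivAt
  have hc : Tendsto (fun k : ℕ => ‖(k : ℝ) + 1‖) atTop atTop := by
    have : Tendsto (fun k : ℕ => (k : ℝ) + 1) atTop atTop :=
      tendsto_atTop_add_const_right _ _ tendsto_natCast_atTop_atTop
    exact tendsto_norm_atTop_atTop.comp this
  exact h2.lim v hc

theorem clm_eq_sum {m : ℕ} (A : Space m →L[ℝ] Space m) :
    A = ∑ i, (EuclideanSpace.proj i : Space m →L[ℝ] ℝ).smulRight
      (A (EuclideanSpace.single i 1)) := by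
  ext1 x
  have hx : x = ∑ i, x i • (EuclideanSpace.single i 1 : Space m) := by
    ext j
    simp [Finset.sum_apply, Pi.single_apply]
  conv_lhs => rw [hx]
  simp [map_sum]

theorem IsRegularField.measurable_fderiv (hg : IsRegularField g K) :
    Measurable fun p : Space n × ℝ => fderiv ℝ (fun z => g z p.2) p.1 := by
  have h1 : (fun p : Space n × ℝ => fderiv ℝ (fun z => g z p.2) p.1) = fun p =>
      ∑ i, (ContinuousLinearMap.smulRightL ℝ (Space n) (Space n)
        (EuclideanSpace.proj i : Space n →L[ℝ] ℝ))
        (fderiv ℝ (fun z => g z p.2) p.1 (EuclideanSpace.single i 1)) := by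
    funext p
    rw [clm_eq_sum (fderiv ℝ (fun z => g z p.2) p.1)]
    simp
  rw [h1]
  refine Finset.measurable_sum _ fun i _ => ?_
  exact (ContinuousLinearMap.continuous _).measurable.comp
    (hg.measurable_fderiv_apply (EuclideanSpace.single i 1))

/-- The coefficient `∂g/∂x (Y_{s,τ}(x), τ)` of the equation of variations. -/
noncomputable def variation (g : Space n → ℝ → Space n) (s : ℝ) (x : Space n) (τ : ℝ) :
    Space n →L[ℝ] Space n :=
  fderiv ℝ (fun z => g z τ) (flow g s τ x)

theorem IsRegularField.continuous_flow (hg : IsRegularField g K) :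
    Continuous fun p : ℝ × ℝ × Space n => flow g p.1 p.2.1 p.2.2 :=
  Transport.continuous_flow hg.toODE hg.bound

theorem IsRegularField.measurable_variation (hg : IsRegularField g K) (s : ℝ) (x : Space n) :
    Measurable (variation g s x) :=
  hg.measurable_fderiv.comp ((isODESolution_flow hg.toODE s x).1.measurable.prodMk measurable_id)

theorem IsRegularField.isODEField_variation (hg : IsRegularField g K) (s : ℝ) (x : Space n) :
    IsODEField (fun (Z : Space n →L[ℝ] Space n) τ => (variation g s x τ).comp Z) K where
  aestronglyMeasurable y hy := by
    have h1 := (hg.measurable_variation s x).aestronglyMeasurable (μ := volume)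
    exact (ContinuousLinearMap.compL ℝ (Space n) (Space n) (Space n)).aestronglyMeasurable_comp₂
      h1 hy.aestronglyMeasurable
  lipschitz τ Z Z' := by
    rw [← ContinuousLinearMap.comp_sub]
    exact (ContinuousLinearMap.opNorm_comp_le _ _).trans
      (mul_le_mul_of_nonneg_right (hg.bound_fderiv _ _) (norm_nonneg _))
  bound τ := by simpa using hg.toODE.nonneg

/-- The fundamental matrix of the equation of variations along the trajectory from `(x, s)`. -/
noncomputable def flowDeriv (g : Space n → ℝ → Space n) (s t : ℝ) (x : Space n) :
    Space n →L[ℝ] Space n :=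
  flow (fun (Z : Space n →L[ℝ] Space n) τ => (variation g s x τ).comp Z) s t
    (ContinuousLinearMap.id ℝ _)

theorem hasFDerivAt_flow (hg : IsRegularField g K) (s t : ℝ) (x : Space n) :
    HasFDerivAt (flow g s t) (flowDeriv g s t x) x := by
  have hO := hg.toODE
  have hK := hO.nonneg
  have hA := hg.isODEField_variation s x
  have hZ := isODESolution_flow hA s (ContinuousLinearMap.id ℝ _)
  change IsODESolution _ _ _ (fun t => flowDeriv g s t x) at hZ
  have hy := isODESolution_flow hO s
  set A := variation g s x with hAdef
  -- the error of linearization along the trajectory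
  let e : Space n → ℝ → Space n := fun h σ =>
    g (flow g s σ (x + h)) σ - g (flow g s σ x) σ - A σ (flow g s σ (x + h) - flow g s σ x)
  let a : Space n → ℝ := fun h => ∫ σ in uIoc s t, ‖e h σ‖
  have hAm := hg.measurable_variation s x
  have hem : ∀ h, Measurable (e h) := fun h =>
    ((hg.measurable.comp ((hy (x + h)).1.measurable.prodMk measurable_id)).sub
      (hg.measurable.comp ((hy x).1.measurable.prodMk measurable_id))).sub
        (isBoundedBilinearMap_apply.continuous.measurable.comp
          (hAm.prodMk ((hy (x + h)).1.sub (hy x).1).measurable))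
  have hdiff : ∀ h σ, ‖flow g s σ (x + h) - flow g s σ x‖ ≤ ‖h‖ * Real.exp (K * |σ - s|) :=
    fun h σ => by simpa using norm_flow_sub_flow_le hO s σ (x + h) x
  have heb : ∀ h σ, ‖e h σ‖ ≤ 2 * K * Real.exp (K * |σ - s|) * ‖h‖ := fun h σ => by
    have h1 : ‖A σ (flow g s σ (x + h) - flow g s σ x)‖ ≤
        K * ‖flow g s σ (x + h) - flow g s σ x‖ :=
      (A σ).le_of_opNorm_le (hg.bound_fderiv _ _) _
    have h2 := hO.lipschitz σ (flow g s σ (x + h)) (flow g s σ x)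
    have h3 := mul_le_mul_of_nonneg_left (hdiff h σ) hK
    have h4 := norm_sub_le (g (flow g s σ (x + h)) σ - g (flow g s σ x) σ)
      (A σ (flow g s σ (x + h) - flow g s σ x))
    calc ‖e h σ‖ ≤ _ := h4
      _ ≤ _ := by linarith
  have hec : ∀ h : Space n, Continuous fun σ => 2 * K * Real.exp (K * |σ - s|) * ‖h‖ := fun h =>
    Continuous.mul (by fun_prop) continuous_const
  have hei : ∀ h a b, IntervalIntegrable (e h) volume a b := fun h a b =>
    ((hec h).intervalIntegrable a b).mono_fun' (hem h).aestronglyMeasurable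
      (ae_of_all _ fun σ => heb h σ)
  have hr : ∀ h, ‖flow g s t (x + h) - flow g s t x - flowDeriv g s t x h‖ ≤
      a h * Real.exp (K * |t - s|) := fun h => by
    have hAc : Continuous fun τ =>
        flow g s τ (x + h) - flow g s τ x - flowDeriv g s τ x h :=
      ((hy (x + h)).1.sub (hy x).1).sub (hZ.1.clm_apply continuous_const)
    refine gronwall (d := fun τ => ‖flow g s τ (x + h) - flow g s τ x - flowDeriv g s τ x h‖)
      hK hAc.norm (fun τ => norm_nonneg _) fun τ hτ => ?_
    have i1 : IntervalIntegrable (fun σ => A σ (flow g s σ (x + h) - flow g s σ x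
        - flowDeriv g s σ x h)) volume s τ := by
      refine ((hAc.norm.const_mul K).intervalIntegrable s τ).mono_fun' ?_
        (ae_of_all _ fun σ => (A σ).le_of_opNorm_le (hg.bound_fderiv _ _) _)
      exact (isBoundedBilinearMap_apply.continuous.measurable.comp
          (hAm.prodMk hAc.measurable)).aestronglyMeasurable
    have i2 : IntervalIntegrable (fun σ => (A σ).comp (flowDeriv g s σ x)) volume s τ :=
      hA.intervalIntegrable hZ.1 s τ
    have e1 : flow g s τ (x + h) - flow g s τ x - flowDeriv g s τ x h =
        (∫ σ in s..τ, e h σ) + ∫ σ in s..τ, A σ (flow g s σ (x + h) - flow g s σ x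
          - flowDeriv g s σ x h) := by
      have e2 := congrArg (fun B : Space n →L[ℝ] Space n => B h) (hZ.2 τ)
      simp only [add_apply, ContinuousLinearMap.id_apply] at e2
      rw [ContinuousLinearMap.intervalIntegral_apply i2] at e2
      have i3 : IntervalIntegrable (fun σ => ((A σ).comp (flowDeriv g s σ x)) h) volume s τ :=
        intervalIntegrable_iff.2 ((ContinuousLinearMap.apply ℝ (Space n) h).integrable_comp
          (intervalIntegrable_iff.1 i2))
      have hy2 : ∀ z, flow g s τ z = z + ∫ σ in s..τ, g (flow g s σ z) σ := fun z => (hy z).2 τ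
      rw [e2, hy2 (x + h), hy2 x, ← intervalIntegral.integral_add (hei h s τ) i1,
        show ∀ p q r u : Space n, p + h + q - (p + r) - (h + u) = q - r - u from
          fun p q r u => by abel,
        ← intervalIntegral.integral_sub (hO.intervalIntegrable (hy (x + h)).1 _ _)
          (hO.intervalIntegrable (hy x).1 _ _), ← intervalIntegral.integral_sub
          ((hO.intervalIntegrable (hy (x + h)).1 _ _).sub
          (hO.intervalIntegrable (hy x).1 _ _)) i3]
      refine intervalIntegral.integral_congr fun σ _ => ?_
      simp only [e, map_sub, ContinuousLinearMap.comp_apply]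
      abel
    rw [e1]
    refine (norm_add_le _ _).trans (add_le_add ?_ ?_)
    · rw [intervalIntegral.norm_intervalIntegral_eq]
      refine (norm_integral_le_integral_norm _).trans ?_
      refine setIntegral_mono_set ?_ (ae_of_all _ fun σ => norm_nonneg _) ?_
      · exact (intervalIntegrable_iff.1 (hei h s t)).norm
      · exact (uIoc_subset_uIoc_of_uIcc_subset_uIcc
          (uIcc_subset_uIcc_left hτ)).eventuallyLE
    · have h2 := intervalIntegral.norm_integral_le_abs_of_norm_le (a := s) (b := τ) (μ := volume)
        (f := fun σ => A σ (flow g s σ (x + h) - flow g s σ x - flowDeriv g s σ x h))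
        (g := fun σ => K * ‖flow g s σ (x + h) - flow g s σ x - flowDeriv g s σ x h‖)
        (ae_of_all _ fun σ => (A σ).le_of_opNorm_le (hg.bound_fderiv _ _) _)
        ((hAc.norm.const_mul K).intervalIntegrable _ _)
      rwa [intervalIntegral.integral_const_mul, abs_mul, abs_of_nonneg hK] at h2
  have hlim : Tendsto (fun h => a h / ‖h‖) (𝓝 0) (𝓝 0) := by
    have h1 : ∀ h, a h / ‖h‖ = ∫ σ in uIoc s t, ‖e h σ‖ / ‖h‖ := fun h => by
      rw [integral_div]
    simp only [h1]
    have h0 : ∫ _ in uIoc s t, (0 : ℝ) = 0 := by simp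
    rw [← h0]
    refine tendsto_integral_filter_of_dominated_convergence
      (fun σ => 2 * K * Real.exp (K * |σ - s|)) ?_ ?_ ?_ ?_
    · exact Eventually.of_forall fun h => ((hem h).norm.div_const _).aestronglyMeasurable
    · refine Eventually.of_forall fun h => ae_of_all _ fun σ => ?_
      rw [norm_div, norm_norm, norm_norm]
      exact div_le_of_le_mul₀ (norm_nonneg _) (by positivity) (heb h σ)
    · have hc : Continuous fun σ => 2 * K * Real.exp (K * |σ - s|) := by fun_prop
      exact intervalIntegrable_iff.1 (hc.intervalIntegrable s t)
    · refine ae_of_all _ fun σ => ?_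
      have h2 := ((hg.contDiff σ).differentiable (by norm_num) (flow g s σ x)).hasFDerivAt
      have h3 : (fun h => flow g s σ (x + h) - flow g s σ x) =O[𝓝 0] fun h => h :=
        Asymptotics.IsBigO.of_bound (Real.exp (K * |σ - s|))
          (Eventually.of_forall fun h => (hdiff h σ).trans_eq (mul_comm _ _))
      have h4 : Tendsto (fun h => flow g s σ (x + h)) (𝓝 0) (𝓝 (flow g s σ x)) := by
        refine tendsto_iff_norm_sub_tendsto_zero.2 ?_
        exact (h3.trans_tendsto tendsto_id).norm.trans (by simp)
      have h5 := (h2.isLittleO.comp_tendsto h4).trans_isBigO h3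
      exact h5.norm_norm.tendsto_div_nhds_zero
  rw [hasFDerivAt_iff_isLittleO_nhds_zero]
  have h6 : a =o[𝓝 0] fun h => ‖h‖ := by
    rw [Asymptotics.isLittleO_iff_tendsto]
    · exact hlim
    · intro h hh
      rw [norm_eq_zero] at hh
      subst hh
      have : ∀ σ, e 0 σ = 0 := fun σ => by simp [e]
      simp [a, this]
  refine Asymptotics.IsBigO.trans_isLittleO (Asymptotics.IsBigO.of_bound
    (Real.exp (K * |t - s|)) (Eventually.of_forall fun h => ?_))
    (Asymptotics.isLittleO_norm_right.1 h6)
  refine (hr h).trans ?_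
  rw [mul_comm]
  exact mul_le_mul_of_nonneg_left (le_abs_self _) (Real.exp_pos _).le

/-! ### Liouville's formula -/

/-- The chain rule for a `C¹` function along an absolutely continuous curve with essentially
bounded velocity. -/
theorem comp_sub_comp_eq_integral {V : Type*} [NormedAddCommGroup V] [NormedSpace ℝ V]
    [FiniteDimensional ℝ V] {Ψ : V → ℝ} (hΨ : ContDiff ℝ 1 Ψ) {X h : ℝ → V} {a b C : ℝ}
    (hX : Continuous X) (hXh : ∀ t, X t = X a + ∫ τ in a..t, h τ)
    (hh : IntervalIntegrable h volume a b) (hC : ∀ τ ∈ uIcc a b, ‖h τ‖ ≤ C) :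
    Ψ (X b) - Ψ (X a) = ∫ τ in a..b, fderiv ℝ Ψ (X τ) (h τ) := by
  have : CompleteSpace V := FiniteDimensional.complete ℝ V
  have hD : Continuous (fderiv ℝ Ψ) := hΨ.continuous_fderiv (by norm_num)
  obtain ⟨R, hR⟩ := (isCompact_uIcc (a := a) (b := b)).exists_bound_of_continuousOn
    hX.continuousOn
  have : ProperSpace V := FiniteDimensional.proper ℝ V
  obtain ⟨M, hM⟩ := (isCompact_closedBall (0 : V) R).exists_bound_of_continuousOn hD.continuousOn
  have hC0 : 0 ≤ C := (norm_nonneg _).trans (hC a left_mem_uIcc)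
  have hM0 : 0 ≤ M := (norm_nonneg _).trans
    (hM (X a) (mem_closedBall_zero_iff.2 (hR a left_mem_uIcc)))
  have hint : IntervalIntegrable (fun τ => fderiv ℝ Ψ (X τ) (h τ)) volume a b := by
    rw [intervalIntegrable_iff] at hh ⊢
    refine Integrable.mono' (hh.norm.const_mul M) ?_ ?_
    · exact (ContinuousLinearMap.id ℝ (V →L[ℝ] ℝ)).aestronglyMeasurable_comp₂
        (hD.comp hX).aestronglyMeasurable hh.aestronglyMeasurable
    · refine (ae_restrict_mem measurableSet_uIoc).mono fun τ hτ => ?_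
      exact (fderiv ℝ Ψ (X τ)).le_of_opNorm_le
        (hM _ (mem_closedBall_zero_iff.2 (hR τ (uIoc_subset_uIcc hτ)))) _
  have hlipX : ∀ t ∈ uIcc a b, ∀ t' ∈ uIcc a b, ‖X t - X t'‖ ≤ C * |t - t'| := by
    intro t ht t' ht'
    have hi : ∀ u ∈ uIcc a b, IntervalIntegrable h volume a u := fun u hu =>
      hh.mono_set (uIcc_subset_uIcc_left hu)
    rw [hXh t, hXh t', add_sub_add_left_eq_sub,
      intervalIntegral.integral_interval_sub_left (hi t ht) (hi t' ht')]
    refine intervalIntegral.norm_integral_le_of_norm_le_const fun τ hτ => hC τ ?_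
    exact uIcc_subset_uIcc ht' ht (uIoc_subset_uIcc hτ)
  have hac1 : AbsolutelyContinuousOnInterval (fun t => Ψ (X t)) a b := by
    refine (LipschitzOnWith.of_dist_le_mul (K := Real.toNNReal (M * C))
      fun t ht t' ht' => ?_).absolutelyContinuousOnInterval
    rw [dist_eq_norm, Real.dist_eq]
    have h1 := Convex.norm_image_sub_le_of_norm_fderiv_le (𝕜 := ℝ) (f := Ψ)
      (fun z _ => hΨ.differentiable (by norm_num) z) hM (convex_closedBall (0 : V) R)
      (mem_closedBall_zero_iff.2 (hR t' ht')) (mem_closedBall_zero_iff.2 (hR t ht))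
    refine h1.trans ?_
    rw [Real.coe_toNNReal _ (by positivity), mul_assoc]
    exact mul_le_mul_of_nonneg_left (hlipX t ht t' ht') hM0
  have hac2 := hint.absolutelyContinuousOnInterval_intervalIntegral (left_mem_uIcc (a := a) (b := b))
  obtain ⟨c, hc⟩ := (hac1.sub hac2).const_of_ae_hasDerivAt_zero (by
    filter_upwards [hh.ae_hasDerivAt_integral, hint.ae_hasDerivAt_integral] with τ h1 h2 hτ
    have h3 : HasDerivAt X (h τ) τ := by
      have h4 := (h1 hτ a left_mem_uIcc).const_add (X a)
      exact h4.congr_of_eventuallyEq (Eventually.of_forall hXh)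
    have h5 := ((hΨ.differentiable (by norm_num) (X τ)).hasFDerivAt.comp_hasDerivAt τ h3).sub
      (h2 hτ a left_mem_uIcc)
    simpa using! h5)
  have h1 := hc a left_mem_uIcc
  have h2 := hc b right_mem_uIcc
  simp only [Pi.sub_apply, intervalIntegral.integral_same, sub_zero] at h1 h2
  linarith

/-- The matrix of an endomorphism of `ℝⁿ` in the standard basis. -/
noncomputable def toMat {m : ℕ} (A : Space m →L[ℝ] Space m) : Matrix (Fin m) (Fin m) ℝ :=
  Matrix.of fun i j => A (EuclideanSpace.single j 1) i

theorem toMat_eq_toMatrix {m : ℕ} (A : Space m →L[ℝ] Space m) :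
    toMat A = LinearMap.toMatrix (EuclideanSpace.basisFun (Fin m) ℝ).toBasis
      (EuclideanSpace.basisFun (Fin m) ℝ).toBasis (A : Space m →ₗ[ℝ] Space m) := by
  ext i j
  simp [toMat, LinearMap.toMatrix_apply]

theorem det_eq_det_toMat {m : ℕ} (A : Space m →L[ℝ] Space m) : A.det = (toMat A).det := by
  rw [toMat_eq_toMatrix, LinearMap.det_toMatrix]

theorem toMat_comp {m : ℕ} (A B : Space m →L[ℝ] Space m) :
    toMat (A.comp B) = toMat A * toMat B := by
  simp only [toMat_eq_toMatrix, ← LinearMap.toMatrix_comp]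
  rfl

theorem contDiff_det (m : ℕ) : ContDiff ℝ 1 fun A : Space m →L[ℝ] Space m => A.det := by
  simp only [det_eq_det_toMat, Matrix.det_apply]
  refine ContDiff.sum fun σ _ => ContDiff.const_smul _ (contDiff_prod fun i _ => ?_)
  exact ((EuclideanSpace.proj (𝕜 := ℝ) (σ i)).comp (ContinuousLinearMap.apply ℝ (Space m)
    (EuclideanSpace.single i (1 : ℝ)))).contDiff

/-- The trace of an endomorphism of `ℝⁿ`, written as in the definition of `divergence`: for the
derivative of `g(·, t)` at `x` it is `divergence g x t` by definition. -/
noncomputable def clmTrace {m : ℕ} (A : Space m →L[ℝ] Space m) : ℝ :=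
  ∑ i, A (EuclideanSpace.single i 1) i

theorem hasDerivAt_det_line {m : ℕ} (A Z : Space m →L[ℝ] Space m) :
    HasDerivAt (fun r : ℝ => (Z + r • A.comp Z).det) (clmTrace A * Z.det) 0 := by
  have h1 : ∀ r : ℝ, (Z + r • A.comp Z).det = (1 + (toMat A).trace * r +
      (Matrix.det (1 + (Polynomial.X : Polynomial ℝ) •
        (toMat A).map Polynomial.C)).divX.divX.eval r * r ^ 2) * Z.det := fun r => by
    rw [← Matrix.det_one_add_smul, det_eq_det_toMat, det_eq_det_toMat, ← Matrix.det_mul]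
    congr 1
    rw [add_mul, one_mul, smul_mul_assoc, ← toMat_comp]
    ext i j
    simp [toMat]
  simp only [h1]
  have h2 : HasDerivAt (fun r : ℝ => 1 + (toMat A).trace * r +
      (Matrix.det (1 + (Polynomial.X : Polynomial ℝ) •
        (toMat A).map Polynomial.C)).divX.divX.eval r * r ^ 2) (clmTrace A) 0 := by
    have h3 := (((hasDerivAt_id (0 : ℝ)).const_mul (toMat A).trace).const_add 1).add
      ((Polynomial.hasDerivAt (Matrix.det (1 + (Polynomial.X : Polynomial ℝ) •
        (toMat A).map Polynomial.C)).divX.divX (0 : ℝ)).mul (hasDerivAt_pow 2 (0 : ℝ)))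
    convert! h3 using 1
    simp [clmTrace, toMat, Matrix.trace]
  exact h2.mul_const _

theorem abs_clmTrace_le {m : ℕ} (A : Space m →L[ℝ] Space m) : |clmTrace A| ≤ m * ‖A‖ := by
  refine (Finset.abs_sum_le_sum_abs _ _).trans ?_
  refine (Finset.sum_le_card_nsmul _ _ ‖A‖ fun i _ => ?_).trans (by simp)
  refine (PiLp.norm_apply_le (A (EuclideanSpace.single i 1)) i).trans ?_
  simpa using A.le_opNorm (EuclideanSpace.single i 1)

theorem IsRegularField.abs_divergence_le (hg : IsRegularField g K) (x : Space n) (t : ℝ) :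
    |divergence g x t| ≤ n * K :=
  (abs_clmTrace_le _).trans (mul_le_mul_of_nonneg_left (hg.bound_fderiv x t) (Nat.cast_nonneg n))

theorem IsRegularField.measurable_divergence (hg : IsRegularField g K) :
    Measurable fun p : Space n × ℝ => divergence g p.1 p.2 := by
  refine Finset.measurable_sum _ fun i _ => ?_
  exact (EuclideanSpace.proj (𝕜 := ℝ) i).continuous.measurable.comp
    (hg.measurable_fderiv_apply (EuclideanSpace.single i 1))

/-- The integral of the divergence along the trajectory from `(x, s)`, up to time `t`. -/
noncomputable def divIntegral (g : Space n → ℝ → Space n) (s t : ℝ) (x : Space n) : ℝ :=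
  ∫ τ in s..t, divergence g (flow g s τ x) τ

theorem IsRegularField.measurable_div_flow (hg : IsRegularField g K) (s : ℝ) (x : Space n) :
    Measurable fun τ => divergence g (flow g s τ x) τ :=
  hg.measurable_divergence.comp
    ((isODESolution_flow hg.toODE s x).1.measurable.prodMk measurable_id)

theorem IsRegularField.intervalIntegrable_div_flow (hg : IsRegularField g K) (s : ℝ)
    (x : Space n) (a b : ℝ) :
    IntervalIntegrable (fun τ => divergence g (flow g s τ x) τ) volume a b :=
  (intervalIntegrable_const (c := n * K)).mono_fun' (hg.measurable_div_flow s x).aestronglyMeasurable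
    (ae_of_all _ fun _ => hg.abs_divergence_le _ _)

/-- Liouville's formula for the Jacobian of the flow. -/
theorem det_flowDeriv (hg : IsRegularField g K) (s t : ℝ) (x : Space n) :
    (flowDeriv g s t x).det = Real.exp (divIntegral g s t x) := by
  have hK := hg.toODE.nonneg
  have hA := hg.isODEField_variation s x
  have hZ := isODESolution_flow hA s (ContinuousLinearMap.id ℝ _)
  change IsODESolution _ _ _ (fun t => flowDeriv g s t x) at hZ
  have hdi := hg.intervalIntegrable_div_flow s x
  let Ψ : (Space n →L[ℝ] Space n) × ℝ → ℝ := fun p => p.1.det * Real.exp (-p.2)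
  have hΨ : ContDiff ℝ 1 Ψ := ((contDiff_det n).comp contDiff_fst).mul contDiff_snd.neg.exp
  let X : ℝ → (Space n →L[ℝ] Space n) × ℝ := fun τ => (flowDeriv g s τ x, divIntegral g s τ x)
  let h : ℝ → (Space n →L[ℝ] Space n) × ℝ := fun τ =>
    ((variation g s x τ).comp (flowDeriv g s τ x), divergence g (flow g s τ x) τ)
  have hX : Continuous X := hZ.1.prodMk
    (intervalIntegral.continuous_primitive (fun a b => hdi a b) s)
  have hh1 : ∀ a b, IntervalIntegrable (fun τ => (variation g s x τ).comp (flowDeriv g s τ x))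
    volume a b := hA.intervalIntegrable hZ.1
  have hh : ∀ a b, IntervalIntegrable h volume a b := fun a b => by
    have h1 := hh1 a b
    have h2 := hdi a b
    rw [intervalIntegrable_iff] at h1 h2 ⊢
    exact h1.prodMk h2
  have hXh : ∀ τ, X τ = X s + ∫ σ in s..τ, h σ := fun τ => by
    have h0 : X s = (ContinuousLinearMap.id ℝ _, 0) := by
      simp only [X, divIntegral, intervalIntegral.integral_same]
      rw [flowDeriv, flow_self hA]
    rw [h0]
    refine Prod.ext ?_ ?_
    · have e1 := (ContinuousLinearMap.fst ℝ (Space n →L[ℝ] Space n) ℝ).intervalIntegral_comp_comm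
        (hh s τ)
      simp only [ContinuousLinearMap.coe_fst'] at e1
      rw [Prod.fst_add, ← e1]
      exact hZ.2 τ
    · have e1 := (ContinuousLinearMap.snd ℝ (Space n →L[ℝ] Space n) ℝ).intervalIntegral_comp_comm
        (hh s τ)
      simp only [ContinuousLinearMap.coe_snd'] at e1
      rw [Prod.snd_add, ← e1, zero_add]
      rfl
  obtain ⟨R, hR⟩ := (isCompact_uIcc (a := s) (b := t)).exists_bound_of_continuousOn
    hZ.1.continuousOn
  have hC : ∀ τ ∈ uIcc s t, ‖h τ‖ ≤ max (K * R) (n * K) := fun τ hτ => by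
    refine max_le_max ?_ (hg.abs_divergence_le _ _)
    exact (ContinuousLinearMap.opNorm_comp_le _ _).trans
      (mul_le_mul (hg.bound_fderiv _ _) (hR τ hτ) (norm_nonneg _) hK)
  have hzero : ∀ τ, fderiv ℝ Ψ (X τ) (h τ) = 0 := fun τ => by
    have h0 : X τ + (0 : ℝ) • h τ = X τ :=
      (congrArg (X τ + ·) (zero_smul ℝ (h τ))).trans (add_zero _)
    have h1 : HasDerivAt (fun r : ℝ => X τ + r • h τ) (h τ) 0 := by
      simpa using ((hasDerivAt_id (0 : ℝ)).smul_const (h τ)).const_add (X τ)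
    have h2 : HasDerivAt (fun r : ℝ => Ψ (X τ + r • h τ)) (fderiv ℝ Ψ (X τ) (h τ)) 0 := by
      have h3 : HasFDerivAt Ψ (fderiv ℝ Ψ (X τ)) (X τ + (0 : ℝ) • h τ) := by
        rw [h0]
        exact (hΨ.differentiable (by norm_num) _).hasFDerivAt
      exact h3.comp_hasDerivAt 0 h1
    have h4 := hasDerivAt_det_line (variation g s x τ) (flowDeriv g s τ x)
    have h5 : HasDerivAt (fun r : ℝ => Real.exp (-(divIntegral g s τ x +
        r * divergence g (flow g s τ x) τ))) (Real.exp (-(divIntegral g s τ x +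
        0 * divergence g (flow g s τ x) τ)) * -(1 * divergence g (flow g s τ x) τ)) 0 :=
      ((((hasDerivAt_id (0 : ℝ)).mul_const _).const_add _).neg).exp
    refine (h2.unique (h4.mul h5)).trans ?_
    have h6 : clmTrace (variation g s x τ) = divergence g (flow g s τ x) τ := rfl
    have h7 : flowDeriv g s τ x + (0 : ℝ) • (variation g s x τ).comp (flowDeriv g s τ x) =
        flowDeriv g s τ x :=
      (congrArg (flowDeriv g s τ x + ·) (zero_smul ℝ _)).trans (add_zero _)
    rw [h6, h7]
    simp only [zero_mul, add_zero, h0]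
    simp only [X]
    ring
  have hmain := comp_sub_comp_eq_integral hΨ hX hXh (hh s t) hC
  simp only [hzero, intervalIntegral.integral_zero] at hmain
  have e0 : Ψ (X s) = 1 := by
    simp only [Ψ, X, divIntegral, intervalIntegral.integral_same, neg_zero, Real.exp_zero, mul_one]
    rw [flowDeriv, flow_self hA, det_eq_det_toMat]
    have : toMat (ContinuousLinearMap.id ℝ (Space n)) = 1 := by
      ext i j
      simp [toMat, Matrix.one_apply]
    rw [this, Matrix.det_one]
  have e1 : (flowDeriv g s t x).det * Real.exp (-divIntegral g s t x) = 1 := by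
    have : Ψ (X t) = 1 := by linarith
    exact this
  rw [Real.exp_neg] at e1
  field_simp at e1
  exact e1

/-! ### Change of variables along the flow -/

theorem abs_divergence_le_delta (hg : IsRegularField g K) (x : Space n) (t : ℝ) :
    |divergence g x t| ≤ 2 * delta g t := by
  have h1 : BddAbove (range fun x : Space n => |divergence g x t|) :=
    ⟨n * K, by rintro _ ⟨x, rfl⟩; exact hg.abs_divergence_le x t⟩
  have h2 := le_ciSup h1 x
  rw [delta]
  linarith

theorem delta_nonneg {m : ℕ} (f : Space m → ℝ → Space m) (t : ℝ) : 0 ≤ delta f t :=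
  mul_nonneg (by norm_num) (Real.iSup_nonneg fun _ => abs_nonneg _)

theorem delta_le (hg : IsRegularField g K) (t : ℝ) : delta g t ≤ n * K := by
  have h1 : (⨆ x : Space n, |divergence g x t|) ≤ n * K :=
    ciSup_le fun x => hg.abs_divergence_le x t
  have h2 : (0 : ℝ) ≤ n * K := mul_nonneg (Nat.cast_nonneg n) hg.toODE.nonneg
  rw [delta]
  linarith

theorem IsRegularField.continuous_divergence (hg : IsRegularField g K) (t : ℝ) :
    Continuous fun x => divergence g x t := by
  refine continuous_finsetSum _ fun i _ => ?_
  exact (EuclideanSpace.proj (𝕜 := ℝ) i).continuous.comp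
    (((hg.contDiff t).continuous_fderiv (by norm_num)).clm_apply continuous_const)

theorem measurable_delta (hg : IsRegularField g K) : Measurable (delta g) := by
  have h1 : ∀ t, (⨆ x : Space n, |divergence g x t|) =
      ⨆ k, |divergence g (TopologicalSpace.denseSeq (Space n) k) t| := fun t => by
    have hb : BddAbove (range fun k =>
        |divergence g (TopologicalSpace.denseSeq (Space n) k) t|) :=
      ⟨n * K, by rintro _ ⟨x, rfl⟩; exact hg.abs_divergence_le _ t⟩
    refine le_antisymm (ciSup_le fun x => ?_) (ciSup_le fun k => ?_)
    · refine (TopologicalSpace.denseRange_denseSeq (Space n)).induction_on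
        (p := fun x => |divergence g x t| ≤ _) x ?_ fun k => le_ciSup hb k
      exact isClosed_le (hg.continuous_divergence t).abs continuous_const
    · have h2 : BddAbove (range fun x : Space n => |divergence g x t|) :=
        ⟨n * K, by rintro _ ⟨x, rfl⟩; exact hg.abs_divergence_le x t⟩
      exact le_ciSup h2 (TopologicalSpace.denseSeq (Space n) k)
  have h2 : delta g = fun t => 1 / 2 *
      ⨆ k, |divergence g (TopologicalSpace.denseSeq (Space n) k) t| := by
    funext t
    rw [delta, h1]
  rw [h2]
  refine (Measurable.iSup fun k => ?_).const_mul _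
  exact (hg.measurable_divergence.comp measurable_prodMk_left).abs

theorem intervalIntegrable_delta (hg : IsRegularField g K) (a b : ℝ) :
    IntervalIntegrable (delta g) volume a b :=
  (intervalIntegrable_const (c := n * K)).mono_fun' (measurable_delta hg).aestronglyMeasurable
    (ae_of_all _ fun t => by
      simpa only [Real.norm_of_nonneg (delta_nonneg g t)] using delta_le hg t)

theorem abs_divIntegral_le (hg : IsRegularField g K) (s t : ℝ) (x : Space n) :
    |divIntegral g s t x| ≤ 2 * |∫ τ in s..t, delta g τ| := by
  have h1 := intervalIntegral.norm_integral_le_abs_of_norm_le (a := s) (b := t) (μ := volume)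
    (f := fun τ => divergence g (flow g s τ x) τ) (g := fun τ => 2 * delta g τ)
    (ae_of_all _ fun τ => abs_divergence_le_delta hg _ _)
    ((intervalIntegrable_delta hg s t).const_mul 2)
  rwa [intervalIntegral.integral_const_mul, abs_mul, abs_two] at h1

theorem lintegral_jacobian_mul (hg : IsRegularField g K) (s t : ℝ) (h : Space n → ENNReal) :
    ∫⁻ x, ENNReal.ofReal (Real.exp (divIntegral g s t x)) * h (flow g s t x) = ∫⁻ z, h z := by
  have h1 := lintegral_image_eq_lintegral_abs_det_fderiv_mul volume MeasurableSet.univ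
    (fun x _ => (hasFDerivAt_flow hg s t x).hasFDerivWithinAt)
    (fun x _ x' _ hxx => by
      rw [← flow_flow_cancel hg.toODE s t x, hxx, flow_flow_cancel hg.toODE]) h
  have h2 : flow g s t '' univ = univ :=
    eq_univ_of_forall fun z => ⟨flow g t s z, mem_univ _, flow_flow_cancel hg.toODE t s z⟩
  rw [h2, Measure.restrict_univ] at h1
  rw [h1]
  refine lintegral_congr fun x => ?_
  rw [det_flowDeriv hg, abs_of_pos (Real.exp_pos _)]

theorem IsRegularField.measurable_flow (hg : IsRegularField g K) (s t : ℝ) :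
    Measurable (flow g s t) := by
  have h1 : Continuous fun x : Space n => ((s, t, x) : ℝ × ℝ × Space n) := by fun_prop
  exact (hg.continuous_flow.comp h1).measurable

/-- The flow expands Lebesgue measure at most by the factor `exp (2 |∫ₛᵗ δ|)`. -/
theorem map_flow_le (hg : IsRegularField g K) (s t : ℝ) :
    Measure.map (flow g s t) volume ≤
      ENNReal.ofReal (Real.exp (2 * |∫ τ in s..t, delta g τ|)) • volume := by
  refine Measure.le_iff.2 fun B hB => ?_
  rw [Measure.map_apply (hg.measurable_flow s t) hB, Measure.smul_apply, smul_eq_mul]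
  set c := Real.exp (2 * |∫ τ in s..t, delta g τ|) with hc
  have h1 := lintegral_jacobian_mul hg s t (B.indicator 1)
  rw [lintegral_indicator_one hB] at h1
  have h2 : volume (flow g s t ⁻¹' B) = ∫⁻ x, B.indicator 1 (flow g s t x) := by
    rw [← lintegral_indicator_one (hg.measurable_flow s t hB)]
    rfl
  rw [h2, ← h1, ← lintegral_const_mul' _ _ ENNReal.ofReal_ne_top]
  refine lintegral_mono fun x => ?_
  rw [← mul_assoc, ← ENNReal.ofReal_mul (by positivity), hc, ← Real.exp_add]
  refine le_mul_of_one_le_left' (ENNReal.one_le_ofReal.2 (Real.one_le_exp ?_))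
  linarith [neg_abs_le (divIntegral g s t x), abs_divIntegral_le hg s t x]

end Regular

/-! ### Composition with the flow as an operator on `L₂` -/

section Composition

variable {n : ℕ} {g : Space n → ℝ → Space n} {K : ℝ}

theorem quasiMeasurePreserving_flow (hg : IsRegularField g K) (s t : ℝ) :
    Measure.QuasiMeasurePreserving (flow g s t) volume volume :=
  ⟨hg.measurable_flow s t, (Measure.absolutelyContinuous_of_le (map_flow_le hg s t)).trans
    Measure.smul_absolutelyContinuous⟩

theorem eLpNorm_comp_flow_le (hg : IsRegularField g K) (s t : ℝ) {h : Space n → ℝ}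
    (hh : AEStronglyMeasurable h volume) :
    eLpNorm (fun x => h (flow g s t x)) 2 volume ≤
      ENNReal.ofReal (Real.exp |∫ τ in s..t, delta g τ|) * eLpNorm h 2 volume := by
  have hq := quasiMeasurePreserving_flow hg s t
  have h1 : eLpNorm (fun x => h (flow g s t x)) 2 volume =
      eLpNorm h 2 (Measure.map (flow g s t) volume) :=
    (eLpNorm_map_measure (hh.mono_ac hq.absolutelyContinuous) hq.measurable.aemeasurable).symm
  rw [h1]
  refine (eLpNorm_mono_measure h (map_flow_le hg s t)).trans_eq ?_
  rw [eLpNorm_smul_measure_of_ne_top (by norm_num), smul_eq_mul]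
  congr 1
  rw [ENNReal.ofReal_rpow_of_pos (Real.exp_pos _), ← Real.exp_mul]
  congr 2
  norm_num
  ring

theorem memLp_comp_flow (hg : IsRegularField g K) (s t : ℝ) {h : Space n → ℝ}
    (hh : MemLp h 2 volume) : MemLp (fun x => h (flow g s t x)) 2 volume :=
  ⟨hh.1.comp_quasiMeasurePreserving (quasiMeasurePreserving_flow hg s t),
    (eLpNorm_comp_flow_le hg s t hh.1).trans_lt
      (ENNReal.mul_lt_top ENNReal.ofReal_lt_top hh.2)⟩

/-- The operator `h ↦ h ∘ Y_{s,t}` on `L₂(ℝⁿ)`. -/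
noncomputable def compFlow (hg : IsRegularField g K) (s t : ℝ) : H0 n →L[ℝ] H0 n :=
  LinearMap.mkContinuous
    { toFun := fun h => (memLp_comp_flow hg s t (Lp.memLp h)).toLp
      map_add' := fun u v => by
        rw [← MemLp.toLp_add, MemLp.toLp_eq_toLp_iff]
        exact (quasiMeasurePreserving_flow hg s t).ae_eq_comp (Lp.coeFn_add u v)
      map_smul' := fun c u => by
        rw [RingHom.id_apply, ← MemLp.toLp_const_smul, MemLp.toLp_eq_toLp_iff]
        exact (quasiMeasurePreserving_flow hg s t).ae_eq_comp (Lp.coeFn_smul c u) }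
    (Real.exp |∫ τ in s..t, delta g τ|) fun u => by
      simp only [LinearMap.coe_mk, AddHom.coe_mk]
      rw [Lp.norm_toLp, Lp.norm_def]
      have h1 := eLpNorm_comp_flow_le hg s t (Lp.aestronglyMeasurable u)
      have h2 := ENNReal.toReal_mono (ENNReal.mul_ne_top ENNReal.ofReal_ne_top
        (Lp.eLpNorm_ne_top u)) h1
      rwa [ENNReal.toReal_mul, ENNReal.toReal_ofReal (Real.exp_pos _).le] at h2

theorem compFlow_coeFn (hg : IsRegularField g K) (s t : ℝ) (h : H0 n) :
    compFlow hg s t h =ᵐ[volume] fun x => h (flow g s t x) :=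
  MemLp.coeFn_toLp (memLp_comp_flow hg s t (Lp.memLp h))

theorem compFlow_coeFn' (hg : IsRegularField g K) (s t : ℝ) {h : H0 n} {ψ : Space n → ℝ}
    (hψ : h =ᵐ[volume] ψ) : compFlow hg s t h =ᵐ[volume] fun x => ψ (flow g s t x) :=
  (compFlow_coeFn hg s t h).trans ((quasiMeasurePreserving_flow hg s t).ae_eq_comp hψ)

theorem norm_compFlow_apply_le (hg : IsRegularField g K) (s t : ℝ) (h : H0 n) :
    ‖compFlow hg s t h‖ ≤ Real.exp |∫ τ in s..t, delta g τ| * ‖h‖ :=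
  ContinuousLinearMap.le_of_opNorm_le _
    (LinearMap.mkContinuous_norm_le _ (Real.exp_pos _).le _) h

theorem norm_compFlow_apply_le' (hg : IsRegularField g K) (s t : ℝ) (h : H0 n) :
    ‖compFlow hg s t h‖ ≤ Real.exp (n * K * |t - s|) * ‖h‖ := by
  refine (norm_compFlow_apply_le hg s t h).trans ?_
  gcongr
  exact intervalIntegral.norm_integral_le_of_norm_le_const fun τ _ => by
    rw [Real.norm_of_nonneg (delta_nonneg g τ)]; exact delta_le hg τ

theorem continuous_compFlow_of_test (hg : IsRegularField g K) {h : H0 n} {ψ : Space n → ℝ}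
    (hh : h =ᵐ[volume] ψ) (hψ : Continuous ψ) (hψc : HasCompactSupport ψ) :
    Continuous fun p : ℝ × ℝ => compFlow hg p.1 p.2 h := by
  rw [continuous_iff_continuousAt]
  intro p₀
  obtain ⟨C, hC⟩ := hψ.bounded_above_of_compact_support hψc
  obtain ⟨R, hR⟩ := hψc.isCompact.isBounded.subset_closedBall (0 : Space n)
  have hC0 : 0 ≤ C := (norm_nonneg _).trans (hC 0)
  have hK := hg.toODE.nonneg
  set M := |p₀.2 - p₀.1| + 1 with hM
  set B := Metric.closedBall (0 : Space n) (R + K * M) with hB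
  -- outside the ball `B` the point `Y_{s,t}(x)` is not in the support of `ψ`
  have hout : ∀ p : ℝ × ℝ, |p.2 - p.1| ≤ M → ∀ x, x ∉ B → ψ (flow g p.1 p.2 x) = 0 := by
    intro p hp x hx
    by_contra hne
    have h1 := hR (subset_tsupport ψ hne)
    rw [mem_closedBall_zero_iff] at h1
    refine hx (mem_closedBall_zero_iff.2 ?_)
    have h2 := norm_flow_sub_le hg.toODE hg.bound p.1 p.2 x
    have h3 : ‖x‖ ≤ ‖flow g p.1 p.2 x‖ + ‖flow g p.1 p.2 x - x‖ := by
      calc ‖x‖ = ‖flow g p.1 p.2 x - (flow g p.1 p.2 x - x)‖ := by congr 1; abel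
        _ ≤ _ := norm_sub_le _ _
    have h4 := mul_le_mul_of_nonneg_left hp hK
    linarith
  have hnear : ∀ᶠ p : ℝ × ℝ in 𝓝 p₀, |p.2 - p.1| ≤ M := by
    have hc : Continuous fun p : ℝ × ℝ => |p.2 - p.1| := by fun_prop
    exact (hc.tendsto p₀).eventually_le_const (by rw [hM]; linarith)
  refine tendsto_H0_of_dominated (b := B.indicator fun _ => 2 * C)
    (fun p => compFlow_coeFn' hg p.1 p.2 hh) (compFlow_coeFn' hg p₀.1 p₀.2 hh)
    (memLp_indicator_const 2 Metric.isClosed_closedBall.measurableSet (2 * C)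
      (Or.inr (measure_closedBall_lt_top).ne)) ?_ ?_
  · filter_upwards [hnear] with p hp
    refine ae_of_all _ fun x => ?_
    by_cases hx : x ∈ B
    · rw [indicator_of_mem hx]
      refine (abs_sub _ _).trans ?_
      have h1 := hC (flow g p.1 p.2 x)
      have h2 := hC (flow g p₀.1 p₀.2 x)
      rw [Real.norm_eq_abs] at h1 h2
      linarith
    · rw [indicator_of_notMem hx, hout p hp x hx, hout p₀ (by rw [hM]; linarith) x hx]
      simp
  · refine ae_of_all _ fun x => ?_
    have hc : Continuous fun p : ℝ × ℝ => ((p.1, p.2, x) : ℝ × ℝ × Space n) := by fun_prop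
    exact (hψ.comp (hg.continuous_flow.comp hc)).tendsto p₀

/-- Strong continuity of the family `h ↦ h ∘ Y_{s,t}`. -/
theorem continuous_compFlow (hg : IsRegularField g K) :
    Continuous fun p : (ℝ × ℝ) × H0 n => compFlow hg p.1.1 p.1.2 p.2 := by
  have hK := hg.toODE.nonneg
  have hbc : Continuous fun p : ℝ × ℝ => Real.exp (n * K * |p.2 - p.1|) := by fun_prop
  have h1 : ∀ h : H0 n, Continuous fun p : ℝ × ℝ => compFlow hg p.1 p.2 h := by
    intro h
    rw [continuous_iff_continuousAt]
    intro p₀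
    refine Metric.tendsto_nhds.2 fun ε hε => ?_
    set B := Real.exp (n * K * |p₀.2 - p₀.1|) + 1 with hB
    have hB0 : 0 < B := by positivity
    obtain ⟨h', hh', ⟨ψ, e1, e2, e3⟩⟩ := Metric.dense_iff.1 (dense_testSet n) h (ε / (3 * B))
      (by positivity)
    rw [Metric.mem_ball, dist_eq_norm] at hh'
    have hd : B * ‖h' - h‖ < ε / 3 := by
      rw [lt_div_iff₀ (by positivity)] at hh' ⊢
      linarith
    have g1 := Metric.tendsto_nhds.1
      ((continuous_compFlow_of_test hg e1 e3.continuous e2).tendsto p₀) (ε / 3) (by positivity)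
    have g2 : ∀ᶠ p : ℝ × ℝ in 𝓝 p₀, Real.exp (n * K * |p.2 - p.1|) ≤ B :=
      (hbc.tendsto p₀).eventually_le_const (by rw [hB]; linarith)
    filter_upwards [g1, g2] with p k1 k2
    have k3 : ∀ q : ℝ × ℝ, Real.exp (n * K * |q.2 - q.1|) ≤ B →
        ‖compFlow hg q.1 q.2 h' - compFlow hg q.1 q.2 h‖ < ε / 3 := fun q hq => by
      rw [← map_sub]
      exact ((norm_compFlow_apply_le' hg _ _ _).trans
        (mul_le_mul_of_nonneg_right hq (norm_nonneg _))).trans_lt hd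
    have k4 := k3 p k2
    have k5 := k3 p₀ (by rw [hB]; linarith)
    rw [dist_eq_norm] at k1 ⊢
    calc ‖compFlow hg p.1 p.2 h - compFlow hg p₀.1 p₀.2 h‖
        = ‖-(compFlow hg p.1 p.2 h' - compFlow hg p.1 p.2 h) +
          (compFlow hg p.1 p.2 h' - compFlow hg p₀.1 p₀.2 h') +
          (compFlow hg p₀.1 p₀.2 h' - compFlow hg p₀.1 p₀.2 h)‖ := by congr 1; abel
      _ ≤ ‖compFlow hg p.1 p.2 h' - compFlow hg p.1 p.2 h‖ +
          ‖compFlow hg p.1 p.2 h' - compFlow hg p₀.1 p₀.2 h'‖ +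
          ‖compFlow hg p₀.1 p₀.2 h' - compFlow hg p₀.1 p₀.2 h‖ := by
        refine (norm_add₃_le).trans ?_
        rw [norm_neg]
      _ < ε := by linarith
  rw [continuous_iff_continuousAt]
  rintro ⟨p₀, h₀⟩
  refine tendsto_iff_norm_sub_tendsto_zero.2 ?_
  have h2 : ∀ p : (ℝ × ℝ) × H0 n, ‖compFlow hg p.1.1 p.1.2 p.2 - compFlow hg p₀.1 p₀.2 h₀‖ ≤
      Real.exp (n * K * |p.1.2 - p.1.1|) * ‖p.2 - h₀‖ +
        ‖compFlow hg p.1.1 p.1.2 h₀ - compFlow hg p₀.1 p₀.2 h₀‖ := fun p => by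
    refine (norm_sub_le_norm_sub_add_norm_sub _ (compFlow hg p.1.1 p.1.2 h₀) _).trans
      (add_le_add ?_ le_rfl)
    rw [← map_sub]
    exact norm_compFlow_apply_le' hg _ _ _
  refine squeeze_zero (fun _ => norm_nonneg _) h2 ?_
  have h3 : Continuous fun p : (ℝ × ℝ) × H0 n => Real.exp (n * K * |p.1.2 - p.1.1|) * ‖p.2 - h₀‖ +
        ‖compFlow hg p.1.1 p.1.2 h₀ - compFlow hg p₀.1 p₀.2 h₀‖ :=
    ((hbc.comp continuous_fst).mul (continuous_snd.sub continuous_const).norm).add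
      ((((h1 h₀).comp continuous_fst)).sub continuous_const).norm
  simpa using h3.tendsto (p₀, h₀)

theorem continuous_compFlow_comp (hg : IsRegularField g K) {X : Type*} [TopologicalSpace X]
    {a b : X → ℝ} {h : X → H0 n} (ha : Continuous a) (hb : Continuous b) (hh : Continuous h) :
    Continuous fun x => compFlow hg (a x) (b x) (h x) := by
  have h1 := (ha.prodMk hb).prodMk hh
  have h2 := (continuous_compFlow hg).comp h1
  exact h2

theorem aestronglyMeasurable_compFlow (hg : IsRegularField g K) {X : Type*} [MeasurableSpace X]
    {μ : Measure X} {a b : X → ℝ} {h : X → H0 n} (ha : Measurable a) (hb : Measurable b)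
    (hh : AEStronglyMeasurable h μ) :
    AEStronglyMeasurable (fun x => compFlow hg (a x) (b x) (h x)) μ := by
  have h1 := (ha.stronglyMeasurable.prodMk hb.stronglyMeasurable).aestronglyMeasurable.prodMk hh
  have h2 := (continuous_compFlow hg).comp_aestronglyMeasurable h1
  exact h2

/-! ### Duhamel's formula -/

theorem integrable_compFlow (hg : IsRegularField g K) {T : ℝ} {Φ : ℝ → H0 n}
    (hΦ : Integrable Φ (timeMeasure T)) (s : ℝ) :
    Integrable (fun t => compFlow hg s t (Φ t)) (timeMeasure T) := by
  have hK := hg.toODE.nonneg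
  refine Integrable.mono' (hΦ.norm.const_mul (Real.exp (n * K * (T + |s|)))) ?_ ?_
  · exact aestronglyMeasurable_compFlow hg measurable_const measurable_id hΦ.aestronglyMeasurable
  · refine (ae_restrict_mem measurableSet_Icc).mono fun t ht => ?_
    refine (norm_compFlow_apply_le' hg s t _).trans ?_
    gcongr
    refine (abs_sub _ _).trans ?_
    rw [abs_of_nonneg ht.1]
    linarith [ht.2]

/-- The solution `v(s) = ∫ₛᵀ Φ(t) ∘ Y_{s,t} dt` of the backward transport problem. -/
noncomputable def duhamel (hg : IsRegularField g K) (T : ℝ) (Φ : ℝ → H0 n) (s : ℝ) : H0 n :=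
  ∫ t in s..T, compFlow hg s t (Φ t)

theorem intervalIntegrable_of_timeMeasure {F : Type*} [NormedAddCommGroup F] {T : ℝ} {Φ : ℝ → F}
    (hΦ : Integrable Φ (timeMeasure T)) {a b : ℝ} (ha : a ∈ Icc 0 T) (hb : b ∈ Icc 0 T) :
    IntervalIntegrable Φ volume a b :=
  intervalIntegrable_iff.2 (IntegrableOn.mono_set hΦ
    (uIoc_subset_uIcc.trans (uIcc_subset_Icc ha hb)))

theorem norm_duhamel_le (hg : IsRegularField g K) {T : ℝ} {Φ : ℝ → H0 n}
    (hΦ : Integrable Φ (timeMeasure T)) {s : ℝ} (hs : s ∈ Icc 0 T) :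
    ‖duhamel hg T Φ s‖ ≤ Real.exp (∫ t in s..T, delta g t) * ∫ t in s..T, ‖Φ t‖ := by
  have hT : T ∈ Icc 0 T := ⟨hs.1.trans hs.2, le_rfl⟩
  rw [← intervalIntegral.integral_const_mul]
  refine intervalIntegral.norm_integral_le_of_norm_le hs.2 (ae_of_all _ fun t ht => ?_)
    ((intervalIntegrable_of_timeMeasure hΦ.norm hs hT).const_mul _)
  refine (norm_compFlow_apply_le hg s t _).trans ?_
  gcongr
  rw [abs_of_nonneg (intervalIntegral.integral_nonneg ht.1.le fun τ _ => delta_nonneg g τ)]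
  exact intervalIntegral.integral_mono_interval le_rfl ht.1.le ht.2
    (ae_of_all _ fun τ => delta_nonneg g τ) (intervalIntegrable_delta hg s T)

theorem continuous_duhamel (hg : IsRegularField g K) {T : ℝ} {Φ : ℝ → H0 n}
    (hΦ : Integrable Φ (timeMeasure T)) :
    Continuous fun s : Icc (0 : ℝ) T => duhamel hg T Φ s := by
  have hK := hg.toODE.nonneg
  have h1 : ∀ s : Icc (0 : ℝ) T, duhamel hg T Φ s =
      ∫ t, (Ioc (s : ℝ) T).indicator (fun t => compFlow hg s t (Φ t)) t ∂(timeMeasure T) := by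
    intro s
    rw [duhamel, intervalIntegral.integral_of_le s.2.2, integral_indicator measurableSet_Ioc,
      Measure.restrict_restrict measurableSet_Ioc,
      inter_eq_left.2 (Ioc_subset_Icc_self.trans (Icc_subset_Icc_left s.2.1))]
  simp only [h1]
  rw [continuous_iff_continuousAt]
  intro s₀
  refine continuousAt_of_dominated (bound := fun t => Real.exp (n * K * T) * ‖Φ t‖)
    (Eventually.of_forall fun s => (integrable_compFlow hg hΦ s).aestronglyMeasurable.indicator
      measurableSet_Ioc) (Eventually.of_forall fun s => ?_) (hΦ.norm.const_mul _) ?_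
  · refine (ae_restrict_mem measurableSet_Icc).mono fun t ht => ?_
    refine (norm_indicator_le_norm_self _ _).trans ((norm_compFlow_apply_le' hg s t _).trans ?_)
    gcongr
    rw [abs_le]
    constructor <;> linarith [ht.1, ht.2, s.2.1, s.2.2]
  · have hne : ∀ᵐ t : ℝ ∂(timeMeasure T), t ≠ (s₀ : ℝ) :=
      ae_restrict_of_ae (by simp [ae_iff, measure_singleton])
    filter_upwards [hne] with t ht
    have hcont : Continuous fun s : Icc (0 : ℝ) T => compFlow hg s t (Φ t) :=
      continuous_compFlow_comp hg continuous_subtype_val continuous_const continuous_const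
    have hcoe : Tendsto (fun s : Icc (0 : ℝ) T => (s : ℝ)) (𝓝 s₀) (𝓝 s₀) :=
      continuous_subtype_val.tendsto s₀
    rcases lt_or_gt_of_ne ht with h2 | h2
    · have h3 : ∀ᶠ s : Icc (0 : ℝ) T in 𝓝 s₀,
          (Ioc (s : ℝ) T).indicator (fun t => compFlow hg s t (Φ t)) t = 0 := by
        filter_upwards [hcoe.eventually (lt_mem_nhds h2)] with s hs
        exact indicator_of_notMem (fun h => absurd h.1 (not_lt.2 hs.le)) _
      exact (continuousAt_const (y := (0 : H0 n))).congr (h3.mono fun _ h => h.symm)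
    · by_cases htT : t ≤ T
      · have h3 : ∀ᶠ s : Icc (0 : ℝ) T in 𝓝 s₀,
            (Ioc (s : ℝ) T).indicator (fun t => compFlow hg s t (Φ t)) t =
              compFlow hg s t (Φ t) := by
          filter_upwards [hcoe.eventually (gt_mem_nhds h2)] with s hs
          exact if_pos ⟨hs, htT⟩
        exact hcont.continuousAt.congr (h3.mono fun _ h => h.symm)
      · have h3 : ∀ s : Icc (0 : ℝ) T,
            (Ioc (s : ℝ) T).indicator (fun t => compFlow hg s t (Φ t)) t = 0 :=
          fun s => indicator_of_notMem (fun h => htT h.2) _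
        simp only [h3]
        exact continuousAt_const

/-- The operator `L : L¹([0, T] → L₂) → C([0, T] → L₂)` given by Duhamel's formula. -/
noncomputable def duhamelOp (hg : IsRegularField g K) (T : ℝ) : X10 n T →L[ℝ] C0 n T :=
  LinearMap.mkContinuous
    { toFun := fun Φ => ⟨fun s => duhamel hg T Φ s, continuous_duhamel hg (L1.integrable_coeFn Φ)⟩
      map_add' := fun Φ Ψ => by
        ext1 s
        simp only [ContinuousMap.coe_mk, ContinuousMap.add_apply, duhamel]
        have hT : T ∈ Icc 0 T := ⟨s.2.1.trans s.2.2, le_rfl⟩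
        rw [← intervalIntegral.integral_add
          (intervalIntegrable_of_timeMeasure
            (integrable_compFlow hg (L1.integrable_coeFn Φ) s) s.2 hT)
          (intervalIntegrable_of_timeMeasure
            (integrable_compFlow hg (L1.integrable_coeFn Ψ) s) s.2 hT)]
        refine intervalIntegral.integral_congr_ae_restrict ?_
        refine ae_mono (Measure.restrict_mono (uIoc_subset_uIcc.trans
          (uIcc_subset_Icc s.2 hT)) le_rfl) ?_
        filter_upwards [Lp.coeFn_add Φ Ψ] with t ht
        rw [ht, Pi.add_apply, map_add]
      map_smul' := fun c Φ => by
        ext1 s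
        simp only [ContinuousMap.coe_mk, ContinuousMap.smul_apply, duhamel, RingHom.id_apply]
        have hT : T ∈ Icc 0 T := ⟨s.2.1.trans s.2.2, le_rfl⟩
        rw [← intervalIntegral.integral_smul]
        refine intervalIntegral.integral_congr_ae_restrict ?_
        refine ae_mono (Measure.restrict_mono (uIoc_subset_uIcc.trans
          (uIcc_subset_Icc s.2 hT)) le_rfl) ?_
        filter_upwards [Lp.coeFn_smul c Φ] with t ht
        rw [ht, Pi.smul_apply, map_smul] }
    (Real.exp (∫ t in (0 : ℝ)..T, delta g t)) fun Φ => by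
      have hΦ := L1.integrable_coeFn Φ
      refine (ContinuousMap.norm_le _ (by positivity)).2 fun s => ?_
      have hT0 : 0 ≤ T := s.2.1.trans s.2.2
      have hT : T ∈ Icc 0 T := ⟨hT0, le_rfl⟩
      refine (norm_duhamel_le hg hΦ s.2).trans ?_
      have h1 : ∫ t in s..T, delta g t ≤ ∫ t in (0 : ℝ)..T, delta g t :=
        intervalIntegral.integral_mono_interval s.2.1 s.2.2 le_rfl
          (ae_of_all _ fun τ => delta_nonneg g τ) (intervalIntegrable_delta hg 0 T)
      have h2 : ∫ t in s..T, ‖Φ t‖ ≤ ‖Φ‖ := by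
        rw [L1.norm_eq_integral_norm, intervalIntegral.integral_of_le s.2.2]
        exact setIntegral_mono_set hΦ.norm (ae_of_all _ fun _ => norm_nonneg _)
          (Ioc_subset_Icc_self.trans (Icc_subset_Icc_left s.2.1)).eventuallyLE
      exact mul_le_mul (Real.exp_le_exp.2 h1) h2
        (intervalIntegral.integral_nonneg s.2.2 fun _ _ => norm_nonneg _) (Real.exp_pos _).le

theorem norm_duhamelOp_le (hg : IsRegularField g K) (T : ℝ) :
    ‖duhamelOp hg T‖ ≤ Real.exp (∫ t in (0 : ℝ)..T, delta g t) :=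
  LinearMap.mkContinuous_norm_le _ (Real.exp_pos _).le _

end Composition

/-! ### Weak derivatives of compositions with the flow -/

section WeakDerivative

variable {n : ℕ}

theorem inner_toLp (u : H0 n) {ψ : Space n → ℝ} (h : MemLp ψ 2 volume) :
    inner ℝ u h.toLp = ∫ x, u x * ψ x :=
  inner_eq_integral_right u h.coeFn_toLp

theorem memLp_test {ψ : Space n → ℝ} (hψ : ContDiff ℝ 1 ψ) (hc : HasCompactSupport ψ) :
    MemLp ψ 2 (volume : Measure (Space n)) :=
  hψ.continuous.memLp_of_hasCompactSupport hc

theorem memLp_fderiv_test {ψ : Space n → ℝ} (hψ : ContDiff ℝ 1 ψ) (hc : HasCompactSupport ψ)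
    (v : Space n) : MemLp (fun x => fderiv ℝ ψ x v) 2 (volume : Measure (Space n)) :=
  ((hψ.continuous_fderiv (by norm_num)).clm_apply continuous_const).memLp_of_hasCompactSupport
    (hc.fderiv_apply (𝕜 := ℝ) v)

theorem HasWeakPartial.inner_eq {i : Fin n} {u w : H0 n} (h : HasWeakPartial i u w)
    {ψ : Space n → ℝ} (hψ : ContDiff ℝ ∞ ψ) (hc : HasCompactSupport ψ) :
    inner ℝ u (memLp_fderiv_test (hψ.of_le (by norm_cast)) hc
      (EuclideanSpace.single i 1)).toLp =
      - inner ℝ w (memLp_test (hψ.of_le (by norm_cast)) hc).toLp := by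
  rw [inner_toLp, inner_toLp]
  exact h ψ hψ hc

theorem hasWeakPartial_of_tendsto {i : Fin n} {u w : H0 n} {u' w' : ℕ → H0 n}
    (h : ∀ k, HasWeakPartial i (u' k) (w' k)) (hu : Tendsto u' atTop (𝓝 u))
    (hw : Tendsto w' atTop (𝓝 w)) : HasWeakPartial i u w := by
  intro ψ hψ hc
  rw [← inner_toLp u (memLp_fderiv_test (hψ.of_le (by norm_cast)) hc _),
    ← inner_toLp w (memLp_test (hψ.of_le (by norm_cast)) hc)]
  exact tendsto_nhds_unique (hu.inner tendsto_const_nhds)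
    (((hw.inner tendsto_const_nhds).neg).congr fun k => ((h k).inner_eq hψ hc).symm)

theorem hasWeakPartial_integral {i : Fin n} {α : Type*} [MeasurableSpace α] {μ : Measure α}
    {F D : α → H0 n} (hF : Integrable F μ) (hD : Integrable D μ)
    (h : ∀ᵐ a ∂μ, HasWeakPartial i (F a) (D a)) :
    HasWeakPartial i (∫ a, F a ∂μ) (∫ a, D a ∂μ) := by
  intro ψ hψ hc
  rw [← inner_toLp _ (memLp_fderiv_test (hψ.of_le (by norm_cast)) hc _),
    ← inner_toLp _ (memLp_test (hψ.of_le (by norm_cast)) hc),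
    real_inner_comm, real_inner_comm (MemLp.toLp _ _), ← integral_inner hF, ← integral_inner hD,
    ← integral_neg]
  refine integral_congr_ae (h.mono fun a ha => ?_)
  simp only
  rw [real_inner_comm, real_inner_comm (D a)]
  exact ha.inner_eq hψ hc

theorem aestronglyMeasurable_weakPartial {i : Fin n} {α : Type*} [MeasurableSpace α]
    {μ : Measure α} {F D : α → H0 n} (hF : AEStronglyMeasurable F μ)
    (h : ∀ᵐ a ∂μ, HasWeakPartial i (F a) (D a)) : AEStronglyMeasurable D μ := by
  refine aestronglyMeasurable_of_test fun ψ hψ hc => ?_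
  have h1 := (hF.inner (𝕜 := ℝ) (aestronglyMeasurable_const (b :=
    (memLp_fderiv_test (hψ.of_le (by norm_cast)) hc (EuclideanSpace.single i 1)).toLp))).neg
  refine h1.congr (h.mono fun a ha => ?_)
  simp only [Pi.neg_apply]
  rw [inner_toLp, ha ψ hψ hc, neg_neg]

variable {g : Space n → ℝ → Space n} {K : ℝ}

theorem norm_flowDeriv_le (hg : IsRegularField g K) (s t : ℝ) (x : Space n) :
    ‖flowDeriv g s t x‖ ≤ Real.exp (K * |t - s|) :=
  (hasFDerivAt_flow hg s t x).le_of_lip' (Real.exp_pos _).le (Eventually.of_forall fun z => by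
    rw [mul_comm]; exact norm_flow_sub_flow_le hg.toODE s t z x)

theorem abs_flowDeriv_apply_le (hg : IsRegularField g K) (s t : ℝ) (i j : Fin n) (x : Space n) :
    |flowDeriv g s t x (EuclideanSpace.single i 1) j| ≤ Real.exp (K * |t - s|) := by
  refine (PiLp.norm_apply_le (flowDeriv g s t x (EuclideanSpace.single i 1)) j).trans ?_
  refine (ContinuousLinearMap.le_opNorm _ _).trans ?_
  simpa using norm_flowDeriv_le hg s t x

theorem measurable_flowDeriv_apply (hg : IsRegularField g K) (s t : ℝ) (i j : Fin n) :
    Measurable fun x => flowDeriv g s t x (EuclideanSpace.single i 1) j := by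
  have h1 := measurable_fderiv_apply_const ℝ (flow g s t) (EuclideanSpace.single i 1)
  have h2 : ∀ x, fderiv ℝ (flow g s t) x = flowDeriv g s t x :=
    fun x => (hasFDerivAt_flow hg s t x).fderiv
  simp only [h2] at h1
  exact (EuclideanSpace.proj (𝕜 := ℝ) j).continuous.measurable.comp h1

/-- The weak derivative `∂ᵢ(u ∘ Y_{s,t}) = ∑ⱼ (Dⱼu ∘ Y_{s,t}) ∂ᵢ(Y_{s,t})ⱼ`, as a function of the
weak gradient `D` of `u`. -/
noncomputable def compFlowPartial (hg : IsRegularField g K) (s t : ℝ) (i : Fin n)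
    (D : Fin n → H0 n) : H0 n :=
  ∑ j, mulOp (fun x => flowDeriv g s t x (EuclideanSpace.single i 1) j)
    (measurable_flowDeriv_apply hg s t i j).aestronglyMeasurable _
    (abs_flowDeriv_apply_le hg s t i j) (compFlow hg s t (D j))

theorem norm_compFlowPartial_le (hg : IsRegularField g K) (s t : ℝ) (i : Fin n)
    (D : Fin n → H0 n) : ‖compFlowPartial hg s t i D‖ ≤
      Real.exp (K * |t - s|) * Real.exp (n * K * |t - s|) * ∑ j, ‖D j‖ := by
  rw [Finset.mul_sum]
  refine norm_sum_le_of_le _ fun j _ => ?_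
  rw [mul_assoc]
  exact (norm_mulOp_apply_le _ _ _).trans
    (mul_le_mul_of_nonneg_left (norm_compFlow_apply_le' hg s t _) (Real.exp_pos _).le)

theorem apply_eq_sum_single (A : Space n →L[ℝ] ℝ) (v : Space n) :
    A v = ∑ j, v j * A (EuclideanSpace.single j 1) := by
  have hx : v = ∑ j, v j • (EuclideanSpace.single j 1 : Space n) := by
    ext k
    simp [Finset.sum_apply, Pi.single_apply]
  conv_lhs => rw [hx]
  simp [map_sum]

theorem compFlowPartial_coeFn (hg : IsRegularField g K) (s t : ℝ) (i : Fin n)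
    {D : Fin n → H0 n} {ψ : Space n → ℝ} (hψ : ContDiff ℝ 1 ψ)
    (hD : ∀ j, D j =ᵐ[volume] fun x => fderiv ℝ ψ x (EuclideanSpace.single j 1)) :
    compFlowPartial hg s t i D =ᵐ[volume]
      fun x => fderiv ℝ (fun z => ψ (flow g s t z)) x (EuclideanSpace.single i 1) := by
  refine (Lp.coeFn_finsetSum _ _).trans ?_
  have h1 : ∀ᵐ x : Space n, ∀ j : Fin n, compFlow hg s t (D j) x =
      fderiv ℝ ψ (flow g s t x) (EuclideanSpace.single j 1) :=
    ae_all_iff.2 fun j => compFlow_coeFn' hg s t (hD j)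
  have h2 : ∀ᵐ x : Space n, ∀ j : Fin n,
      mulOp (fun x => flowDeriv g s t x (EuclideanSpace.single i 1) j)
        (measurable_flowDeriv_apply hg s t i j).aestronglyMeasurable _
        (abs_flowDeriv_apply_le hg s t i j) (compFlow hg s t (D j)) x =
      flowDeriv g s t x (EuclideanSpace.single i 1) j * compFlow hg s t (D j) x :=
    ae_all_iff.2 fun j => mulOp_coeFn _ _ _
  filter_upwards [h1, h2] with x h3 h4
  have h5 : HasFDerivAt (fun z => ψ (flow g s t z))
      ((fderiv ℝ ψ (flow g s t x)).comp (flowDeriv g s t x)) x :=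
    (hψ.differentiable (by norm_num) _).hasFDerivAt.comp x (hasFDerivAt_flow hg s t x)
  rw [h5.fderiv, ContinuousLinearMap.comp_apply, apply_eq_sum_single, Finset.sum_apply]
  exact Finset.sum_congr rfl fun j _ => by rw [h4, h3]

/-- The flow preserves `W₂¹`. -/
theorem hasWeakPartial_compFlow (hg : IsRegularField g K) (s t : ℝ) (i : Fin n) {u : H0 n}
    {D : Fin n → H0 n} (hD : ∀ j, HasWeakPartial j u (D j)) :
    HasWeakPartial i (compFlow hg s t u) (compFlowPartial hg s t i D) := by
  obtain ⟨ψ, v, w, h1, h2, h3, h4, h5, h6⟩ := exists_seq_testFunction hD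
  refine hasWeakPartial_of_tendsto (u' := fun k => compFlow hg s t (v k))
    (w' := fun k => compFlowPartial hg s t i (w k)) (fun k η hη hηc => ?_)
    (((compFlow hg s t).continuous.tendsto _).comp h5) ?_
  · have hψ1 : ContDiff ℝ 1 (ψ k) := (h1 k).of_le (by norm_cast)
    have hη1 : ContDiff ℝ 1 η := hη.of_le (by norm_cast)
    have e1 := compFlow_coeFn' hg s t (h3 k)
    have e2 := compFlowPartial_coeFn hg s t i hψ1 (h4 k)
    have i1 := memLp_test hη1 hηc
    have i2 := memLp_fderiv_test hη1 hηc (EuclideanSpace.single i 1)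
    have i3 := (memLp_congr_ae e1).1 (Lp.memLp _)
    have i4 := (memLp_congr_ae e2).1 (Lp.memLp _)
    have j1 : ∫ x, compFlow hg s t (v k) x * fderiv ℝ η x (EuclideanSpace.single i 1) =
        ∫ x, ψ k (flow g s t x) * fderiv ℝ η x (EuclideanSpace.single i 1) :=
      integral_congr_ae (e1.mono fun x hx => by simp only [hx])
    have j2 : ∫ x, compFlowPartial hg s t i (w k) x * η x =
        ∫ x, fderiv ℝ (fun z => ψ k (flow g s t z)) x (EuclideanSpace.single i 1) * η x :=
      integral_congr_ae (e2.mono fun x hx => by simp only [hx])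
    rw [j1, j2]
    refine integral_mul_fderiv_eq_neg_fderiv_mul_of_integrable (i4.integrable_mul i1)
      (i3.integrable_mul i2) (i3.integrable_mul i1) (fun x _ => ?_)
      (fun x _ => hη1.differentiable (by norm_num) x)
    exact (hψ1.differentiable (by norm_num) _).comp x
      (hasFDerivAt_flow hg s t x).differentiableAt
  · exact tendsto_finsetSum _ fun j _ =>
      ((mulOp _ _ _ _).continuous.tendsto _).comp (((compFlow hg s t).continuous.tendsto _).comp
        (h6 j))

/-- Duhamel's formula for the weak gradient of the solution. -/
noncomputable def duhamelPartial (hg : IsRegularField g K) (T : ℝ) (i : Fin n)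
    (D : Fin n → ℝ → H0 n) (s : ℝ) : H0 n :=
  ∫ t in s..T, compFlowPartial hg s t i fun j => D j t

variable {T : ℝ} {Φ : ℝ → H0 n} {D : Fin n → ℝ → H0 n}

theorem integrable_compFlowPartial (hg : IsRegularField g K) (hΦ : Integrable Φ (timeMeasure T))
    (hDi : ∀ j, Integrable (D j) (timeMeasure T))
    (hD : ∀ j, ∀ᵐ t ∂(timeMeasure T), HasWeakPartial j (Φ t) (D j t)) {s : ℝ} (hs : s ∈ Icc 0 T)
    (i : Fin n) : Integrable (fun t => compFlowPartial hg s t i fun j => D j t) (timeMeasure T) ∧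
      ∫ t, ‖compFlowPartial hg s t i fun j => D j t‖ ∂(timeMeasure T) ≤
        ∫ t, Real.exp (K * T) * Real.exp (n * K * T) * ∑ j, ‖D j t‖ ∂(timeMeasure T) := by
  have hK := hg.toODE.nonneg
  have hb : Integrable (fun t => Real.exp (K * T) * Real.exp (n * K * T) * ∑ j, ‖D j t‖)
      (timeMeasure T) := (integrable_finsetSum _ fun j _ => (hDi j).norm).const_mul _
  have hle : ∀ᵐ t ∂(timeMeasure T), ‖compFlowPartial hg s t i fun j => D j t‖ ≤
      Real.exp (K * T) * Real.exp (n * K * T) * ∑ j, ‖D j t‖ := by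
    refine (ae_restrict_mem measurableSet_Icc).mono fun t ht => ?_
    refine (norm_compFlowPartial_le hg s t i _).trans ?_
    have h1 : |t - s| ≤ T := by
      rw [abs_le]
      constructor <;> linarith [ht.1, ht.2, hs.1, hs.2]
    have h2 : 0 ≤ ∑ j, ‖D j t‖ := Finset.sum_nonneg fun _ _ => norm_nonneg _
    gcongr
  have h1 : Integrable (fun t => compFlowPartial hg s t i fun j => D j t) (timeMeasure T) := by
    refine hb.mono' (aestronglyMeasurable_weakPartial (i := i)
      (integrable_compFlow hg hΦ s).aestronglyMeasurable ?_) hle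
    filter_upwards [ae_all_iff.2 hD] with t ht
    exact hasWeakPartial_compFlow hg s t i ht
  exact ⟨h1, integral_mono_ae h1.norm hb hle⟩

theorem hasWeakPartial_duhamel (hg : IsRegularField g K) (hΦ : Integrable Φ (timeMeasure T))
    (hDi : ∀ j, Integrable (D j) (timeMeasure T))
    (hD : ∀ j, ∀ᵐ t ∂(timeMeasure T), HasWeakPartial j (Φ t) (D j t)) {s : ℝ} (hs : s ∈ Icc 0 T)
    (i : Fin n) : HasWeakPartial i (duhamel hg T Φ s) (duhamelPartial hg T i D s) := by
  have hsub : Ioc s T ⊆ Icc 0 T := Ioc_subset_Icc_self.trans (Icc_subset_Icc_left hs.1)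
  rw [duhamel, duhamelPartial, intervalIntegral.integral_of_le hs.2,
    intervalIntegral.integral_of_le hs.2]
  refine hasWeakPartial_integral (IntegrableOn.mono_set (integrable_compFlow hg hΦ s) hsub)
    (IntegrableOn.mono_set (integrable_compFlowPartial hg hΦ hDi hD hs i).1 hsub) ?_
  refine ae_mono (Measure.restrict_mono hsub le_rfl) ?_
  filter_upwards [ae_all_iff.2 hD] with t ht
  exact hasWeakPartial_compFlow hg s t i ht

theorem norm_duhamelPartial_le (hg : IsRegularField g K) (hΦ : Integrable Φ (timeMeasure T))
    (hDi : ∀ j, Integrable (D j) (timeMeasure T))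
    (hD : ∀ j, ∀ᵐ t ∂(timeMeasure T), HasWeakPartial j (Φ t) (D j t)) {s : ℝ} (hs : s ∈ Icc 0 T)
    (i : Fin n) : ‖duhamelPartial hg T i D s‖ ≤
      ∫ t, Real.exp (K * T) * Real.exp (n * K * T) * ∑ j, ‖D j t‖ ∂(timeMeasure T) := by
  obtain ⟨h1, h2⟩ := integrable_compFlowPartial hg hΦ hDi hD hs i
  refine le_trans ?_ h2
  rw [duhamelPartial, intervalIntegral.integral_of_le hs.2]
  exact (norm_integral_le_integral_norm _).trans (setIntegral_mono_set h1.norm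
    (ae_of_all _ fun _ => norm_nonneg _)
    (Ioc_subset_Icc_self.trans (Icc_subset_Icc_left hs.1)).eventuallyLE)

theorem memLp_duhamel (hg : IsRegularField g K) (hΦ : Integrable Φ (timeMeasure T)) :
    MemLp (duhamel hg T Φ) 2 (timeMeasure T) := by
  have hc : ContinuousOn (duhamel hg T Φ) (Icc 0 T) :=
    continuousOn_iff_continuous_domRestrict.2 (continuous_duhamel hg hΦ)
  obtain ⟨C, hC⟩ := isCompact_Icc.exists_bound_of_continuousOn hc
  exact MemLp.of_bound (hc.aestronglyMeasurable measurableSet_Icc) C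
    ((ae_restrict_mem measurableSet_Icc).mono fun t ht => hC t ht)

theorem memLp_duhamelPartial (hg : IsRegularField g K) (hΦ : Integrable Φ (timeMeasure T))
    (hDi : ∀ j, Integrable (D j) (timeMeasure T))
    (hD : ∀ j, ∀ᵐ t ∂(timeMeasure T), HasWeakPartial j (Φ t) (D j t)) (i : Fin n) :
    MemLp (duhamelPartial hg T i D) 2 (timeMeasure T) :=
  MemLp.of_bound (aestronglyMeasurable_weakPartial (i := i)
    (memLp_duhamel hg hΦ).aestronglyMeasurable ((ae_restrict_mem measurableSet_Icc).mono
      fun _ ht => hasWeakPartial_duhamel hg hΦ hDi hD ht i)) _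
    ((ae_restrict_mem measurableSet_Icc).mono fun _ ht =>
      norm_duhamelPartial_le hg hΦ hDi hD ht i)

end WeakDerivative

/-! ### The transport operator and its formal adjoint -/

section Adjoint

variable {n : ℕ} {g : Space n → ℝ → Space n} {K : ℝ}

/-- `∑ᵢ ∂(gᵢ ψ)/∂xᵢ (x, t)`, the negative of the formal adjoint of `∑ᵢ gᵢ ∂/∂xᵢ` applied to `ψ`. -/
noncomputable def divMul (g : Space n → ℝ → Space n) (ψ : Space n → ℝ) (x : Space n) (t : ℝ) : ℝ :=
  fderiv ℝ ψ x (g x t) + ψ x * divergence g x t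

theorem continuous_divMul (hg : IsRegularField g K) {ψ : Space n → ℝ} (hψ : ContDiff ℝ 1 ψ)
    (t : ℝ) : Continuous fun x => divMul g ψ x t :=
  ((hψ.continuous_fderiv (by norm_num)).clm_apply (hg.contDiff t).continuous).add
    (hψ.continuous.mul (hg.continuous_divergence t))

theorem measurable_divMul (hg : IsRegularField g K) {ψ : Space n → ℝ} (hψ : ContDiff ℝ 1 ψ) :
    Measurable fun p : Space n × ℝ => divMul g ψ p.1 p.2 := by
  have h1 : Measurable fun p : Space n × ℝ => fderiv ℝ ψ p.1 (g p.1 p.2) := by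
    have h2 : Continuous fun q : Space n × Space n => fderiv ℝ ψ q.1 q.2 :=
      ((hψ.continuous_fderiv (by norm_num)).comp continuous_fst).clm_apply continuous_snd
    exact h2.measurable.comp (measurable_fst.prodMk hg.measurable)
  exact h1.add ((hψ.continuous.measurable.comp measurable_fst).mul hg.measurable_divergence)

theorem divMul_of_notMem {ψ : Space n → ℝ} {x : Space n} (hx : x ∉ tsupport ψ) (t : ℝ) :
    divMul g ψ x t = 0 := by
  rw [divMul, fderiv_of_notMem_tsupport ℝ hx, image_eq_zero_of_notMem_tsupport hx]
  simp

theorem exists_abs_divMul_le (hg : IsRegularField g K) {ψ : Space n → ℝ} (hψ : ContDiff ℝ 1 ψ)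
    (hc : HasCompactSupport ψ) : ∃ M, 0 ≤ M ∧ ∀ x t, |divMul g ψ x t| ≤ M := by
  have hK := hg.toODE.nonneg
  obtain ⟨C, hC⟩ := hψ.continuous.bounded_above_of_compact_support hc
  obtain ⟨C', hC'⟩ := (hψ.continuous_fderiv (by norm_num)).bounded_above_of_compact_support
    (hc.fderiv (𝕜 := ℝ))
  have h1 := (norm_nonneg _).trans (hC 0)
  have h2 := (norm_nonneg _).trans (hC' 0)
  refine ⟨C' * K + C * (n * K), by positivity, fun x t => (abs_add_le _ _).trans
    (add_le_add ?_ ?_)⟩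
  · exact (ContinuousLinearMap.le_opNorm _ _).trans
      (mul_le_mul (hC' x) (hg.bound x t) (norm_nonneg _) h2)
  · rw [abs_mul]
    exact mul_le_mul (hC x) (hg.abs_divergence_le x t) (abs_nonneg _) h1

theorem memLp_divMul (hg : IsRegularField g K) {ψ : Space n → ℝ} (hψ : ContDiff ℝ 1 ψ)
    (hc : HasCompactSupport ψ) (t : ℝ) : MemLp (fun x => divMul g ψ x t) 2 volume :=
  (continuous_divMul hg hψ t).memLp_of_hasCompactSupport
    (HasCompactSupport.intro hc fun _ hx => divMul_of_notMem hx t)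

/-- The function `∑ᵢ ∂(gᵢ ψ)/∂xᵢ` as an element of `L₂` depending on time. -/
noncomputable def divMulLp (hg : IsRegularField g K) {ψ : Space n → ℝ} (hψ : ContDiff ℝ 1 ψ)
    (hc : HasCompactSupport ψ) (t : ℝ) : H0 n :=
  (memLp_divMul hg hψ hc t).toLp

theorem aestronglyMeasurable_divMulLp (hg : IsRegularField g K) {ψ : Space n → ℝ}
    (hψ : ContDiff ℝ 1 ψ) (hc : HasCompactSupport ψ) (μ : Measure ℝ) [SFinite μ] :
    AEStronglyMeasurable (divMulLp hg hψ hc) μ :=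
  aestronglyMeasurable_of_section (φ := divMul g ψ)
    (measurable_divMul hg hψ).aestronglyMeasurable
    (ae_of_all _ fun t => (memLp_divMul hg hψ hc t).coeFn_toLp)

theorem exists_norm_divMulLp_le (hg : IsRegularField g K) {ψ : Space n → ℝ}
    (hψ : ContDiff ℝ 1 ψ) (hc : HasCompactSupport ψ) :
    ∃ C, 0 ≤ C ∧ ∀ t, ‖divMulLp hg hψ hc t‖ ≤ C := by
  obtain ⟨M, hM0, hM⟩ := exists_abs_divMul_le hg hψ hc
  have hb : MemLp ((tsupport ψ).indicator fun _ => M) 2 (volume : Measure (Space n)) :=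
    memLp_indicator_const 2 hc.isCompact.measurableSet M (Or.inr hc.isCompact.measure_lt_top.ne)
  refine ⟨‖hb.toLp‖, norm_nonneg _, fun t => Lp.norm_le_norm_of_ae_le ?_⟩
  filter_upwards [(memLp_divMul hg hψ hc t).coeFn_toLp, hb.coeFn_toLp] with x h1 h2
  rw [divMulLp, h1, h2]
  by_cases hx : x ∈ tsupport ψ
  · rw [indicator_of_mem hx, Real.norm_of_nonneg hM0]
    exact hM x t
  · rw [divMul_of_notMem hx, norm_zero]
    exact norm_nonneg _

theorem abs_apply_le (hg : IsRegularField g K) (t : ℝ) (i : Fin n) (x : Space n) :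
    |g x t i| ≤ K :=
  (PiLp.norm_apply_le (g x t) i).trans (hg.bound x t)

theorem contDiff_component (hg : IsRegularField g K) (t : ℝ) (i : Fin n) :
    ContDiff ℝ 1 fun x => g x t i :=
  (EuclideanSpace.proj (𝕜 := ℝ) i).contDiff.comp (hg.contDiff t)

theorem fderiv_component (hg : IsRegularField g K) (t : ℝ) (i : Fin n) (x v : Space n) :
    fderiv ℝ (fun x => g x t i) x v = fderiv ℝ (fun x => g x t) x v i := by
  have h1 := ((hg.contDiff t).differentiable (by norm_num) x).hasFDerivAt
  have h2 := (EuclideanSpace.proj (𝕜 := ℝ) i).hasFDerivAt.comp x h1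
  have h3 : fderiv ℝ (fun x => g x t i) x = _ := h2.fderiv
  rw [h3]
  rfl

/-- The function `∑ᵢ gᵢ(·, t) Dᵢ` in `L₂`. -/
noncomputable def transportOp (hg : IsRegularField g K) (t : ℝ) (D : Fin n → H0 n) : H0 n :=
  ∑ i, mulOp (fun x => g x t i) (contDiff_component hg t i).continuous.aestronglyMeasurable K
    (abs_apply_le hg t i) (D i)

theorem transportOp_coeFn (hg : IsRegularField g K) (t : ℝ) (D : Fin n → H0 n) :
    transportOp hg t D =ᵐ[volume] fun x => ∑ i, g x t i * D i x := by
  refine (Lp.coeFn_finsetSum _ _).trans ?_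
  have h1 : ∀ᵐ x : Space n, ∀ i : Fin n, mulOp (fun x => g x t i)
      (contDiff_component hg t i).continuous.aestronglyMeasurable K (abs_apply_le hg t i) (D i) x =
      g x t i * D i x := ae_all_iff.2 fun i => mulOp_coeFn _ _ _
  filter_upwards [h1] with x hx
  rw [Finset.sum_apply]
  exact Finset.sum_congr rfl fun i _ => hx i

theorem norm_transportOp_le (hg : IsRegularField g K) (t : ℝ) (D : Fin n → H0 n) :
    ‖transportOp hg t D‖ ≤ ∑ i, K * ‖D i‖ :=
  norm_sum_le_of_le _ fun _ _ => norm_mulOp_apply_le _ _ _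

/-- Integration by parts for the transport operator. -/
theorem inner_transportOp (hg : IsRegularField g K) (t : ℝ) {u : H0 n} {D : Fin n → H0 n}
    (hD : ∀ i, HasWeakPartial i u (D i)) {ψ : Space n → ℝ} (hψ : ContDiff ℝ 1 ψ)
    (hc : HasCompactSupport ψ) :
    inner ℝ (transportOp hg t D) (memLp_test hψ hc).toLp =
      - inner ℝ u (divMulLp hg hψ hc t) := by
  have hη : ∀ i, ContDiff ℝ 1 fun x => g x t i * ψ x := fun i => (contDiff_component hg t i).mul hψ
  have hηc : ∀ i, HasCompactSupport fun x => g x t i * ψ x := fun i => hc.mul_left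
  have h1 : ∀ i, inner ℝ (mulOp (fun x => g x t i)
      (contDiff_component hg t i).continuous.aestronglyMeasurable K (abs_apply_le hg t i) (D i))
      (memLp_test hψ hc).toLp =
      - ∫ x, u x * fderiv ℝ (fun x => g x t i * ψ x) x (EuclideanSpace.single i 1) := fun i => by
    rw [integral_mul_fderiv_eq_of_weak hD (hη i) (hηc i), neg_neg, inner_toLp]
    refine integral_congr_ae ?_
    filter_upwards [mulOp_coeFn (contDiff_component hg t i).continuous.aestronglyMeasurable
      (abs_apply_le hg t i) (D i)] with x hx
    simp only [hx]
    ring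
  have h2 : ∀ x, ∑ i, fderiv ℝ (fun x => g x t i * ψ x) x (EuclideanSpace.single i 1) =
      divMul g ψ x t := fun x => by
    rw [divMul, divergence, apply_eq_sum_single, Finset.mul_sum, ← Finset.sum_add_distrib]
    refine Finset.sum_congr rfl fun i _ => ?_
    rw [fderiv_fun_mul ((contDiff_component hg t i).differentiable (by norm_num) x)
      (hψ.differentiable (by norm_num) x)]
    simp only [_root_.add_apply, _root_.smul_apply, smul_eq_mul,
      fderiv_component hg]
  rw [transportOp, sum_inner, Finset.sum_congr rfl fun i _ => h1 i, Finset.sum_neg_distrib,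
    divMulLp, inner_toLp, ← integral_finsetSum]
  · simp only [← Finset.mul_sum, h2]
  · exact fun i _ => (Lp.memLp u).integrable_mul (memLp_fderiv_test (hη i) (hηc i) _)

/-! ### The transport equation for compositions with the flow -/

theorem integral_jacobian_mul (hg : IsRegularField g K) (s t : ℝ) (F : Space n → ℝ) :
    ∫ x, Real.exp (divIntegral g s t x) * F (flow g s t x) = ∫ z, F z := by
  have h1 := integral_image_eq_integral_abs_det_fderiv_smul volume MeasurableSet.univ
    (fun x _ => (hasFDerivAt_flow hg s t x).hasFDerivWithinAt)
    (fun x _ x' _ hxx => by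
      rw [← flow_flow_cancel hg.toODE s t x, hxx, flow_flow_cancel hg.toODE]) F
  have h2 : flow g s t '' univ = univ :=
    eq_univ_of_forall fun z => ⟨flow g t s z, mem_univ _, flow_flow_cancel hg.toODE t s z⟩
  rw [h2, Measure.restrict_univ] at h1
  rw [h1]
  refine integral_congr_ae (ae_of_all _ fun x => ?_)
  simp only
  rw [det_flowDeriv hg, abs_of_pos (Real.exp_pos _), smul_eq_mul]

theorem integral_compFlow_mul (hg : IsRegularField g K) (s r : ℝ) (h : H0 n) (η : Space n → ℝ) :
    ∫ x, compFlow hg s r h x * η x =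
      ∫ z, h z * (Real.exp (divIntegral g r s z) * η (flow g r s z)) := by
  have h1 : ∫ x, compFlow hg s r h x * η x = ∫ x, h (flow g s r x) * η x :=
    integral_congr_ae ((compFlow_coeFn hg s r h).mono fun x hx => by simp only [hx])
  rw [h1, ← integral_jacobian_mul hg r s]
  refine integral_congr_ae (ae_of_all _ fun z => ?_)
  simp only
  rw [flow_flow_cancel hg.toODE]
  ring

/-- The product of a test function and the Jacobian, transported along a trajectory, satisfies the
continuity equation. -/
theorem jacobian_mul_sub (hg : IsRegularField g K) {ψ : Space n → ℝ} (hψ : ContDiff ℝ 1 ψ)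
    (r s : ℝ) (z : Space n) :
    Real.exp (divIntegral g r s z) * ψ (flow g r s z) - ψ z =
      ∫ t in r..s, Real.exp (divIntegral g r t z) * divMul g ψ (flow g r t z) t := by
  have hO := hg.toODE
  have hY := isODESolution_flow hO r z
  have hdi := hg.intervalIntegrable_div_flow r z
  let Ψ : Space n × ℝ → ℝ := fun p => Real.exp p.2 * ψ p.1
  have hΨ : ContDiff ℝ 1 Ψ := contDiff_snd.exp.mul (hψ.comp contDiff_fst)
  let X : ℝ → Space n × ℝ := fun τ => (flow g r τ z, divIntegral g r τ z)
  let h : ℝ → Space n × ℝ := fun τ =>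
    (g (flow g r τ z) τ, divergence g (flow g r τ z) τ)
  have hX : Continuous X := hY.1.prodMk
    (intervalIntegral.continuous_primitive (fun a b => hdi a b) r)
  have hh : ∀ a b, IntervalIntegrable h volume a b := fun a b => by
    have h1 := hO.intervalIntegrable hY.1 a b
    have h2 := hdi a b
    rw [intervalIntegrable_iff] at h1 h2 ⊢
    exact h1.prodMk h2
  have h0 : X r = (z, 0) := by
    simp only [X, divIntegral, intervalIntegral.integral_same]
    rw [flow_self hO]
  have hXh : ∀ τ, X τ = X r + ∫ σ in r..τ, h σ := fun τ => by
    rw [h0]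
    refine Prod.ext ?_ ?_
    · have e1 := (ContinuousLinearMap.fst ℝ (Space n) ℝ).intervalIntegral_comp_comm (hh r τ)
      simp only [ContinuousLinearMap.coe_fst'] at e1
      rw [Prod.fst_add, ← e1]
      exact hY.2 τ
    · have e1 := (ContinuousLinearMap.snd ℝ (Space n) ℝ).intervalIntegral_comp_comm (hh r τ)
      simp only [ContinuousLinearMap.coe_snd'] at e1
      rw [Prod.snd_add, ← e1, zero_add]
      rfl
  have hC : ∀ τ ∈ uIcc r s, ‖h τ‖ ≤ max K (n * K) := fun τ _ =>
    max_le_max (hg.bound _ _) (hg.abs_divergence_le _ _)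
  have hd : ∀ τ, fderiv ℝ Ψ (X τ) (h τ) =
      Real.exp (divIntegral g r τ z) * divMul g ψ (flow g r τ z) τ := fun τ => by
    have e1 : HasFDerivAt (fun p : Space n × ℝ => ψ p.1)
        ((fderiv ℝ ψ (X τ).1).comp (ContinuousLinearMap.fst ℝ (Space n) ℝ)) (X τ) :=
      (hψ.differentiable (by norm_num) _).hasFDerivAt.comp (X τ) hasFDerivAt_fst
    have e2 : HasFDerivAt (fun p : Space n × ℝ => Real.exp p.2)
        (Real.exp (X τ).2 • ContinuousLinearMap.snd ℝ (Space n) ℝ) (X τ) := hasFDerivAt_snd.exp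
    have e3 : fderiv ℝ Ψ (X τ) = _ := (e2.mul e1).fderiv
    rw [e3]
    simp only [_root_.add_apply, _root_.smul_apply, smul_eq_mul,
      ContinuousLinearMap.comp_apply, ContinuousLinearMap.coe_fst', ContinuousLinearMap.coe_snd',
      divMul, X, h]
    ring
  have hmain := comp_sub_comp_eq_integral hΨ hX hXh (hh r s) hC
  simp only [hd, h0] at hmain
  rw [← hmain]
  simp [Ψ, X]

theorem measurable_divIntegral (hg : IsRegularField g K) (r : ℝ) :
    Measurable fun p : ℝ × Space n => divIntegral g r p.1 p.2 := by
  -- for fixed `t` it is the logarithm of the determinant of a Fréchet derivative, which is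
  -- measurable as such
  refine measurable_uncurry_of_continuous_of_measurable (u := fun t z => divIntegral g r t z)
    (fun z => intervalIntegral.continuous_primitive
      (fun a b => hg.intervalIntegrable_div_flow r z a b) r) fun t => ?_
  have h1 : (fun z => divIntegral g r t z) =
      fun z => Real.log (fderiv ℝ (flow g r t) z).det := by
    funext z
    rw [(hasFDerivAt_flow hg r t z).fderiv, det_flowDeriv hg, Real.log_exp]
  rw [h1]
  exact Real.measurable_log.comp ((contDiff_det n).continuous.measurable.comp
    (measurable_fderiv ℝ (flow g r t)))

theorem abs_divIntegral_le' (hg : IsRegularField g K) (r t : ℝ) (z : Space n) :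
    |divIntegral g r t z| ≤ n * K * |t - r| :=
  intervalIntegral.norm_integral_le_of_norm_le_const (C := n * K)
    (f := fun τ => divergence g (flow g r τ z) τ) fun _ _ => hg.abs_divergence_le _ _

/-- Weak form of the transport equation `∂ₛ(h ∘ Y_{s,r}) + ∑ᵢ gᵢ ∂ᵢ(h ∘ Y_{s,r}) = 0` for
`h ∈ L₂`. -/
theorem inner_compFlow_sub (hg : IsRegularField g K) {ψ : Space n → ℝ} (hψ : ContDiff ℝ 1 ψ)
    (hc : HasCompactSupport ψ) (h : H0 n) (r s : ℝ) :
    inner ℝ (compFlow hg s r h) (memLp_test hψ hc).toLp - inner ℝ h (memLp_test hψ hc).toLp =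
      ∫ t in r..s, inner ℝ (compFlow hg t r h) (divMulLp hg hψ hc t) := by
  have hK := hg.toODE.nonneg
  obtain ⟨M, hM0, hM⟩ := exists_abs_divMul_le hg hψ hc
  obtain ⟨R, hR⟩ := hc.isCompact.isBounded.subset_closedBall (0 : Space n)
  set B := Metric.closedBall (0 : Space n) (R + K * |s - r|) with hB
  set E := Real.exp (n * K * |s - r|) with hE
  have hBm : MeasurableSet B := Metric.isClosed_closedBall.measurableSet
  -- the integrand vanishes for `z` outside the ball `B`
  have hle : ∀ t ∈ uIoc r s, ∀ z, |h z * (Real.exp (divIntegral g r t z) *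
      divMul g ψ (flow g r t z) t)| ≤ B.indicator (fun z => E * M * |h z|) z := by
    intro t ht z
    have htr : |t - r| ≤ |s - r| := abs_sub_left_of_mem_uIcc (uIoc_subset_uIcc ht)
    by_cases hz : z ∈ B
    · rw [indicator_of_mem hz, abs_mul, abs_mul, Real.abs_exp, mul_comm]
      refine mul_le_mul_of_nonneg_right (mul_le_mul (Real.exp_le_exp.2 ?_) (hM _ _)
        (abs_nonneg _) (Real.exp_pos _).le) (abs_nonneg _)
      refine (le_abs_self _).trans ((abs_divIntegral_le' hg r t z).trans ?_)
      gcongr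
    · rw [indicator_of_notMem hz, divMul_of_notMem, mul_zero, mul_zero, abs_zero]
      intro hmem
      have h1 := hR hmem
      rw [mem_closedBall_zero_iff] at h1
      refine hz (mem_closedBall_zero_iff.2 ?_)
      have h2 := norm_flow_sub_le hg.toODE hg.bound r t z
      have h3 : ‖z‖ ≤ ‖flow g r t z‖ + ‖flow g r t z - z‖ := by
        calc ‖z‖ = ‖flow g r t z - (flow g r t z - z)‖ := by congr 1; abel
          _ ≤ _ := norm_sub_le _ _
      have h4 := mul_le_mul_of_nonneg_left htr hK
      linarith
  have hint : Integrable (Function.uncurry fun (t : ℝ) (z : Space n) =>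
      h z * (Real.exp (divIntegral g r t z) * divMul g ψ (flow g r t z) t))
      ((volume.restrict (uIoc r s)).prod volume) := by
    have hb : Integrable (B.indicator fun z => E * M * |h z|) := by
      rw [integrable_indicator_iff hBm]
      exact (setIntegral_abs_le hBm measure_closedBall_lt_top.ne h).1.abs.const_mul (E * M)
    have : IsFiniteMeasure (volume.restrict (uIoc r s)) :=
      ⟨by rw [Measure.restrict_apply_univ]; exact measure_Ioc_lt_top⟩
    refine (hb.comp_snd (volume.restrict (uIoc r s))).mono' ?_ ?_
    · have m1 : AEStronglyMeasurable (fun p : ℝ × Space n => h p.2)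
          ((volume.restrict (uIoc r s)).prod volume) := (Lp.aestronglyMeasurable h).comp_snd
      have m2 : Continuous fun p : ℝ × Space n => flow g r p.1 p.2 :=
        hg.continuous_flow.comp (continuous_const.prodMk (continuous_fst.prodMk continuous_snd))
      exact m1.mul (((Real.measurable_exp.comp (measurable_divIntegral hg r)).mul
        ((measurable_divMul hg hψ).comp
          (m2.measurable.prodMk measurable_fst))).aestronglyMeasurable)
    · rw [Measure.restrict_prod_eq_prod_univ]
      refine (ae_restrict_mem (measurableSet_uIoc.prod MeasurableSet.univ)).mono fun p hp => ?_
      exact hle p.1 hp.1 p.2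
  have e1 : ∀ t, inner ℝ (compFlow hg t r h) (divMulLp hg hψ hc t) =
      ∫ z, h z * (Real.exp (divIntegral g r t z) * divMul g ψ (flow g r t z) t) := fun t => by
    rw [divMulLp, inner_toLp, integral_compFlow_mul]
  simp only [e1]
  rw [intervalIntegral_integral_swap hint, inner_toLp, inner_toLp, integral_compFlow_mul,
    ← integral_sub]
  · refine integral_congr_ae (ae_of_all _ fun z => ?_)
    simp only
    rw [intervalIntegral.integral_const_mul, ← jacobian_mul_sub hg hψ]
    ring
  · have h1 := (memLp_comp_flow hg r s (memLp_test hψ hc))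
    refine (Lp.memLp h).integrable_mul (q := 2) (h1.of_le_mul (c := E) ?_ (ae_of_all _ fun z => ?_))
    · have := (measurable_divIntegral hg r).comp (measurable_const (a := s) |>.prodMk measurable_id)
      exact (Real.measurable_exp.comp this).aestronglyMeasurable.mul h1.1
    · rw [norm_mul, Real.norm_eq_abs, Real.abs_exp]
      refine mul_le_mul_of_nonneg_right (Real.exp_le_exp.2 ?_) (norm_nonneg _)
      exact (le_abs_self _).trans (abs_divIntegral_le' hg r s z)
  · exact (Lp.memLp h).integrable_mul (memLp_test hψ hc)

end Adjoint

/-! ### Existence for the transport problem -/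

theorem integral_triangle_swap {s T : ℝ} (hs : s ≤ T) {G : ℝ → ℝ → ℝ}
    (hG : Integrable (Function.uncurry G)
      ((volume.restrict (Ioc s T)).prod (volume.restrict (Ioc s T)))) :
    ∫ r in s..T, ∫ t in s..r, G t r = ∫ t in s..T, ∫ r in t..T, G t r := by
  have h1 : ∫ r in s..T, ∫ t in s..r, G t r =
      ∫ r in Ioc s T, ∫ t in Ioc s T, {p : ℝ × ℝ | p.1 ≤ p.2}.indicator
        (Function.uncurry G) (t, r) := by
    rw [intervalIntegral.integral_of_le hs]
    refine setIntegral_congr_fun measurableSet_Ioc fun r hr => ?_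
    rw [intervalIntegral.integral_of_le hr.1.le,
      ← inter_eq_right.2 (Ioc_subset_Ioc_right hr.2 : Ioc s r ⊆ Ioc s T),
      ← setIntegral_indicator measurableSet_Ioc]
    refine setIntegral_congr_fun measurableSet_Ioc fun t ht => ?_
    simp only [indicator_apply, mem_ofPred_eq, mem_Ioc, ht.1, true_and, Function.uncurry]
  have h2 : ∫ t in s..T, ∫ r in t..T, G t r =
      ∫ t in Ioc s T, ∫ r in Ioc s T, {p : ℝ × ℝ | p.1 ≤ p.2}.indicator
        (Function.uncurry G) (t, r) := by
    rw [intervalIntegral.integral_of_le hs]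
    refine setIntegral_congr_fun measurableSet_Ioc fun t ht => ?_
    rw [intervalIntegral.integral_of_le ht.2, ← integral_Icc_eq_integral_Ioc]
    have h3 : Ioc s T ∩ Icc t T = Icc t T :=
      inter_eq_right.2 fun r hr => ⟨ht.1.trans_le hr.1, hr.2⟩
    rw [← h3, ← setIntegral_indicator measurableSet_Icc]
    refine setIntegral_congr_fun measurableSet_Ioc fun r hr => ?_
    simp only [indicator_apply, mem_ofPred_eq, mem_Icc, hr.2, and_true, Function.uncurry]
  rw [h1, h2]
  exact (integral_integral_swap (f := fun t r => {p : ℝ × ℝ | p.1 ≤ p.2}.indicator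
    (Function.uncurry G) (t, r)) (hG.indicator
    (measurableSet_le measurable_fst measurable_snd))).symm

section Existence

variable {n : ℕ} {g : Space n → ℝ → Space n} {K T : ℝ} {Φ : ℝ → H0 n} {D : Fin n → ℝ → H0 n}

theorem integrable_transportOp_duhamel (hg : IsRegularField g K)
    (hΦ : Integrable Φ (timeMeasure T)) (hDi : ∀ j, Integrable (D j) (timeMeasure T))
    (hD : ∀ j, ∀ᵐ t ∂(timeMeasure T), HasWeakPartial j (Φ t) (D j t)) :
    Integrable (fun t => transportOp hg t fun i => duhamelPartial hg T i D t) (timeMeasure T) := by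
  have hw : ∀ t ∈ Icc 0 T, ∀ i, HasWeakPartial i (duhamel hg T Φ t) (duhamelPartial hg T i D t) :=
    fun t ht i => hasWeakPartial_duhamel hg hΦ hDi hD ht i
  -- measurability in time is checked on test functions, by integration by parts
  refine Integrable.mono' (g := fun t => ∑ i, K * ‖duhamelPartial hg T i D t‖)
    (integrable_finsetSum _ fun i _ =>
      ((memLp_duhamelPartial hg hΦ hDi hD i).integrable (by norm_num)).norm.const_mul K)
    (aestronglyMeasurable_of_test fun ψ hψ hc => ?_)
    (ae_of_all _ fun t => norm_transportOp_le _ _ _)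
  have hψ1 : ContDiff ℝ 1 ψ := hψ.of_le (by norm_cast)
  refine (((memLp_duhamel hg hΦ).aestronglyMeasurable.inner (𝕜 := ℝ)
    (aestronglyMeasurable_divMulLp hg hψ1 hc (timeMeasure T))).neg).congr ?_
  filter_upwards [ae_restrict_mem measurableSet_Icc] with t ht
  rw [← inner_toLp _ (memLp_test hψ1 hc), inner_transportOp hg t (hw t ht) hψ1 hc]
  rfl

/-- Duhamel's formula solves the transport equation if the right-hand side has weak spatial
derivatives. -/
theorem duhamel_eq_integral (hg : IsRegularField g K)
    (hΦ : Integrable Φ (timeMeasure T)) (hDi : ∀ j, Integrable (D j) (timeMeasure T))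
    (hD : ∀ j, ∀ᵐ t ∂(timeMeasure T), HasWeakPartial j (Φ t) (D j t)) {s : ℝ} (hs : s ∈ Icc 0 T) :
    duhamel hg T Φ s =
      ∫ t in s..T, ((transportOp hg t fun i => duhamelPartial hg T i D t) + Φ t) := by
  have hK := hg.toODE.nonneg
  have hT : T ∈ Icc 0 T := ⟨hs.1.trans hs.2, le_rfl⟩
  have hw := integrable_transportOp_duhamel hg hΦ hDi hD
  have hsub : Ioc s T ⊆ Icc 0 T := Ioc_subset_Icc_self.trans (Icc_subset_Icc_left hs.1)
  refine eq_of_test fun ψ hψ hc => ?_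
  have hψ1 : ContDiff ℝ 1 ψ := hψ.of_le (by norm_cast)
  rw [← inner_toLp _ (memLp_test hψ1 hc), ← inner_toLp _ (memLp_test hψ1 hc)]
  set p : H0 n := (memLp_test hψ1 hc).toLp with hp
  -- the pairing of an interval integral with `p`
  have hpair : ∀ {F : ℝ → H0 n}, Integrable F (timeMeasure T) → ∀ a ∈ Icc 0 T, ∀ q : H0 n,
      inner ℝ (∫ t in a..T, F t) q = ∫ t in a..T, inner ℝ (F t) q := by
    intro F hF a ha q
    have h1 := ((innerSL ℝ) q).intervalIntegral_comp_comm
      (intervalIntegrable_of_timeMeasure hF ha hT)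
    simp only [innerSL_apply_apply] at h1
    rw [real_inner_comm, ← h1]
    exact intervalIntegral.integral_congr fun t _ => real_inner_comm _ _
  have hΦs := intervalIntegrable_of_timeMeasure hΦ hs hT
  have hws := intervalIntegrable_of_timeMeasure hw hs hT
  have hinn : ∀ {F : ℝ → H0 n}, Integrable F (timeMeasure T) →
      IntervalIntegrable (fun t => inner ℝ (F t) p) volume s T := fun hF =>
    intervalIntegrable_of_timeMeasure (hF.inner_const p) hs hT
  obtain ⟨C, hC0, hC⟩ := exists_norm_divMulLp_le hg hψ1 hc
  have hG : Integrable (Function.uncurry fun t r : ℝ =>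
      inner ℝ (compFlow hg t r (Φ r)) (divMulLp hg hψ1 hc t))
      ((volume.restrict (Ioc s T)).prod (volume.restrict (Ioc s T))) := by
    have hΦ' : Integrable Φ (volume.restrict (Ioc s T)) := IntegrableOn.mono_set hΦ hsub
    have hb : Integrable (fun q : ℝ × ℝ => Real.exp (n * K * T) * ‖Φ q.2‖ * C)
        ((volume.restrict (Ioc s T)).prod (volume.restrict (Ioc s T))) :=
      (((hΦ'.norm.const_mul _).mul_const C).comp_snd (volume.restrict (Ioc s T)))
    refine hb.mono' ?_ ?_
    · refine AEStronglyMeasurable.inner (𝕜 := ℝ) ?_ ?_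
      · exact aestronglyMeasurable_compFlow hg measurable_fst measurable_snd
          hΦ'.aestronglyMeasurable.comp_snd
      · exact (aestronglyMeasurable_divMulLp hg hψ1 hc _).comp_fst
    · rw [Measure.prod_restrict]
      refine (ae_restrict_mem (measurableSet_Ioc.prod measurableSet_Ioc)).mono fun q hq => ?_
      refine (norm_inner_le_norm _ _).trans (mul_le_mul ?_ (hC _) (norm_nonneg _) (by positivity))
      refine (norm_compFlow_apply_le' hg _ _ _).trans ?_
      gcongr
      rw [abs_le]
      constructor <;> linarith [hq.1.1, hq.1.2, hq.2.1, hq.2.2, hs.1]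
  calc inner ℝ (duhamel hg T Φ s) p
      = ∫ r in s..T, inner ℝ (compFlow hg s r (Φ r)) p := hpair (integrable_compFlow hg hΦ s) s hs p
    _ = ∫ r in s..T, (inner ℝ (Φ r) p -
          ∫ t in s..r, inner ℝ (compFlow hg t r (Φ r)) (divMulLp hg hψ1 hc t)) := by
        refine intervalIntegral.integral_congr fun r _ => ?_
        rw [intervalIntegral.integral_symm, ← inner_compFlow_sub]
        ring
    _ = (∫ r in s..T, inner ℝ (Φ r) p) -
          ∫ r in s..T, ∫ t in s..r, inner ℝ (compFlow hg t r (Φ r)) (divMulLp hg hψ1 hc t) := by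
        refine intervalIntegral.integral_sub (hinn hΦ) ?_
        refine ((hinn hΦ).sub (hinn (integrable_compFlow hg hΦ s))).congr fun r _ => ?_
        rw [intervalIntegral.integral_symm, ← inner_compFlow_sub]
        ring
    _ = (∫ r in s..T, inner ℝ (Φ r) p) +
          ∫ t in s..T, inner ℝ (transportOp hg t fun i => duhamelPartial hg T i D t) p := by
        rw [integral_triangle_swap hs.2 hG, sub_eq_add_neg, ← intervalIntegral.integral_neg]
        congr 1
        refine intervalIntegral.integral_congr fun t ht => ?_
        rw [uIcc_of_le hs.2] at ht
        have ht' : t ∈ Icc 0 T := ⟨hs.1.trans ht.1, ht.2⟩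
        rw [← hpair (integrable_compFlow hg hΦ t) t ht', inner_transportOp hg t
          (fun i => hasWeakPartial_duhamel hg hΦ hDi hD ht' i) hψ1 hc]
        rfl
    _ = inner ℝ (∫ t in s..T,
          ((transportOp hg t fun i => duhamelPartial hg T i D t) + Φ t)) p := by
        have h1 := hpair (hw.add hΦ) s hs p
        simp only [Pi.add_apply, inner_add_left] at h1
        rw [h1, intervalIntegral.integral_add (hinn hw) (hinn hΦ), add_comm]

theorem isTransportSolution_duhamelOp (hT : 0 < T) {f : Space n → ℝ → Space n}
    (hg : IsRegularField g K) (hfg : ∀ᵐ t ∂(timeMeasure T), ∀ x, f x t = g x t) (Ψ : X10 n T)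
    (hΨ : MemX1 T Ψ) : IsTransportSolution hT f Ψ (duhamelOp hg T Ψ) := by
  obtain ⟨D, h1, h2, h3⟩ := hΨ
  have hΦ := L1.integrable_coeFn Ψ
  have hDi : ∀ j, Integrable (D j) (timeMeasure T) := fun j => (h2 j).integrable (by norm_num)
  have hext : ∀ t ∈ Icc 0 T, IccExtend hT.le (duhamelOp hg T Ψ) t = duhamel hg T Ψ t :=
    fun t ht => IccExtend_of_mem hT.le _ ht
  refine ⟨fun i => duhamelPartial hg T i D,
    fun t => transportOp hg t fun i => duhamelPartial hg T i D t, ⟨?_, ?_, ?_⟩, ?_,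
    integrable_transportOp_duhamel hg hΦ hDi h3, fun s => ?_⟩
  · refine (memLp_duhamel hg hΦ).ae_eq ?_
    filter_upwards [ae_restrict_mem measurableSet_Icc] with t ht
    exact (hext t ht).symm
  · exact memLp_duhamelPartial hg hΦ hDi h3
  · intro i
    filter_upwards [ae_restrict_mem measurableSet_Icc] with t ht
    rw [hext t ht]
    exact hasWeakPartial_duhamel hg hΦ hDi h3 ht i
  · filter_upwards [hfg] with t ht
    simpa only [ht] using transportOp_coeFn hg t fun i => duhamelPartial hg T i D t
  · exact duhamel_eq_integral hg hΦ hDi h3 s.2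

end Existence

/-! ### Uniqueness for the transport problem -/

/-- The integrated form of `d/ds ‖z‖² = 2 ⟨z', z⟩` for `z(s) = ∫ₛᵀ w`; the square of the integral is
a double integral over a square, symmetric about the diagonal. -/
theorem norm_integral_sq_eq {H : Type*} [NormedAddCommGroup H] [InnerProductSpace ℝ H]
    [CompleteSpace H] {s T : ℝ} (hs : s ≤ T) {w : ℝ → H} (hw : IntervalIntegrable w volume s T) :
    ‖∫ t in s..T, w t‖ ^ 2 = 2 * ∫ t in s..T, inner ℝ (w t) (∫ r in t..T, w r) := by
  have hw' : Integrable w (volume.restrict (Ioc s T)) :=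
    (intervalIntegrable_iff_integrableOn_Ioc_of_le hs).1 hw
  have hsubi : ∀ {a b}, a ∈ Icc s T → b ∈ Icc s T → IntervalIntegrable w volume a b :=
    fun ha hb => hw.mono_set (by rw [uIcc_of_le hs]; exact uIcc_subset_Icc ha hb)
  have hsT : s ∈ Icc s T := left_mem_Icc.2 hs
  have hTT : T ∈ Icc s T := right_mem_Icc.2 hs
  have hpair : ∀ {a b}, IntervalIntegrable w volume a b → ∀ q : H,
      ∫ t in a..b, inner ℝ (w t) q = inner ℝ (∫ t in a..b, w t) q := by
    intro a b hab q
    have h1 := ((innerSL ℝ) q).intervalIntegral_comp_comm hab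
    simp only [innerSL_apply_apply] at h1
    rw [real_inner_comm, ← h1]
    exact intervalIntegral.integral_congr fun t _ => real_inner_comm _ _
  have hpair' : ∀ {a b}, IntervalIntegrable w volume a b → ∀ q : H,
      ∫ t in a..b, inner ℝ q (w t) = inner ℝ q (∫ t in a..b, w t) := fun hab q =>
    ((innerSL ℝ) q).intervalIntegral_comp_comm hab
  have hG : Integrable (Function.uncurry fun t r : ℝ => inner ℝ (w t) (w r))
      ((volume.restrict (Ioc s T)).prod (volume.restrict (Ioc s T))) := by
    refine (hw'.norm.mul_prod hw'.norm).mono'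
      (hw'.aestronglyMeasurable.comp_fst.inner (𝕜 := ℝ) hw'.aestronglyMeasurable.comp_snd) ?_
    exact ae_of_all _ fun q => norm_inner_le_norm _ _
  have hsw := integral_triangle_swap hs hG
  have hi : ∀ {F : ℝ → H}, ContinuousOn F (Icc s T) →
      IntervalIntegrable (fun t => inner ℝ (w t) (F t)) volume s T := by
    intro F hF
    rw [intervalIntegrable_iff_integrableOn_Ioc_of_le hs]
    obtain ⟨C, hC⟩ := isCompact_Icc.exists_bound_of_continuousOn hF
    refine Integrable.mono' (hw'.norm.mul_const C) (hw'.aestronglyMeasurable.inner (𝕜 := ℝ)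
      ((hF.mono Ioc_subset_Icc_self).aestronglyMeasurable measurableSet_Ioc)) ?_
    refine (ae_restrict_mem measurableSet_Ioc).mono fun t ht => ?_
    exact (norm_inner_le_norm _ _).trans
      (mul_le_mul_of_nonneg_left (hC t (Ioc_subset_Icc_self ht)) (norm_nonneg _))
  have hc1 : ContinuousOn (fun t => ∫ r in s..t, w r) (Icc s T) := by
    have := intervalIntegral.continuousOn_primitive_interval'  (a := s) hw left_mem_uIcc
    rwa [uIcc_of_le hs] at this
  have hc2 : ContinuousOn (fun t => ∫ r in t..T, w r) (Icc s T) := by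
    refine (continuousOn_const.sub hc1 (f := fun _ => ∫ r in s..T, w r)).congr fun t ht => ?_
    rw [← intervalIntegral.integral_add_adjacent_intervals (hsubi hsT ht) (hsubi ht hTT)]
    simp only [Pi.sub_apply, add_sub_cancel_left]
  have e1 : ∫ t in s..T, inner ℝ (w t) (∫ r in s..t, w r) =
      ∫ t in s..T, inner ℝ (w t) (∫ r in t..T, w r) := by
    refine Eq.trans ?_ (hsw.trans ?_)
    · refine intervalIntegral.integral_congr fun t ht => ?_
      rw [uIcc_of_le hs] at ht
      rw [real_inner_comm, hpair (hsubi hsT ht)]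
    · refine intervalIntegral.integral_congr fun t ht => ?_
      rw [uIcc_of_le hs] at ht
      exact hpair' (hsubi ht hTT) _
  rw [← real_inner_self_eq_norm_sq, ← hpair hw, two_mul]
  nth_rw 1 [← e1]
  rw [← intervalIntegral.integral_add (hi hc1) (hi hc2)]
  refine intervalIntegral.integral_congr fun t ht => ?_
  rw [uIcc_of_le hs] at ht
  rw [← inner_add_right,
    intervalIntegral.integral_add_adjacent_intervals (hsubi hsT ht) (hsubi ht hTT)]

section Uniqueness

variable {n : ℕ} {g : Space n → ℝ → Space n} {K T : ℝ}

theorem HasWeakPartial.sub {i : Fin n} {u v a b : H0 n} (h1 : HasWeakPartial i u a)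
    (h2 : HasWeakPartial i v b) : HasWeakPartial i (u - v) (a - b) := by
  intro ψ hψ hc
  have e1 := h1.inner_eq hψ hc
  have e2 := h2.inner_eq hψ hc
  rw [← inner_toLp (u - v) (memLp_fderiv_test (hψ.of_le (by norm_cast)) hc _),
    ← inner_toLp (a - b) (memLp_test (hψ.of_le (by norm_cast)) hc), inner_sub_left,
    inner_sub_left, e1, e2]
  ring

/-- Energy estimate: `2 ⟨∑ᵢ gᵢ ∂ᵢu, u⟩ = -⟨(div g) u, u⟩` is bounded by a multiple of `‖u‖²`. -/
theorem inner_transportOp_self_le (hg : IsRegularField g K) (t : ℝ) {u : H0 n} {D : Fin n → H0 n}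
    (hD : ∀ i, HasWeakPartial i u (D i)) :
    2 * inner ℝ (transportOp hg t D) u ≤ n * K * ‖u‖ ^ 2 := by
  have hC' : ∀ (i : Fin n) (x : Space n),
      |fderiv ℝ (fun x => g x t i) x (EuclideanSpace.single i 1)| ≤ K := fun i x => by
    rw [fderiv_component hg]
    refine (PiLp.norm_apply_le (_ : Space n) i).trans ((ContinuousLinearMap.le_opNorm _ _).trans ?_)
    simpa using hg.bound_fderiv x t
  have h1 : ∀ i, 2 * inner ℝ (mulOp (fun x => g x t i)
      (contDiff_component hg t i).continuous.aestronglyMeasurable K (abs_apply_le hg t i) (D i)) u ≤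
      K * ‖u‖ ^ 2 := fun i => by
    rw [inner_mulOp_partial hD (contDiff_component hg t i) (abs_apply_le hg t i) i rfl
      (measurable_fderiv_apply_const ℝ _ _).aestronglyMeasurable (hC' i), sq, ← mul_assoc]
    refine (neg_le_abs _).trans ((abs_real_inner_le_norm _ _).trans ?_)
    exact mul_le_mul_of_nonneg_right (norm_mulOp_apply_le _ _ _) (norm_nonneg _)
  rw [transportOp, sum_inner, Finset.mul_sum]
  refine (Finset.sum_le_sum fun i _ => h1 i).trans_eq ?_
  simp [mul_assoc]

theorem IsTransportSolution.unique {hT : 0 < T} {f : Space n → ℝ → Space n}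
    (hg : IsRegularField g K) (hfg : ∀ᵐ t ∂(timeMeasure T), ∀ x, f x t = g x t) {Φ : X10 n T}
    {v v' : C0 n T} (hv : IsTransportSolution hT f Φ v) (hv' : IsTransportSolution hT f Φ v') :
    v = v' := by
  have hK := hg.toODE.nonneg
  obtain ⟨D, w, hD, hw, hwi, hvs⟩ := hv
  obtain ⟨D', w', hD', hw', hwi', hvs'⟩ := hv'
  have hΦ := L1.integrable_coeFn Φ
  have hTT : T ∈ Icc 0 T := ⟨hT.le, le_rfl⟩
  set z : C0 n T := v - v' with hz
  set ζ : ℝ → H0 n := IccExtend hT.le z with hζ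
  have hζc : Continuous ζ := z.continuous.Icc_extend'
  have hζs : ∀ s (hs : s ∈ Icc 0 T), ζ s = v ⟨s, hs⟩ - v' ⟨s, hs⟩ := fun s hs =>
    IccExtend_of_mem hT.le _ hs
  have hdi : Integrable (fun t => w t - w' t) (timeMeasure T) := hwi.sub hwi'
  have hζi : ∀ s ∈ Icc 0 T, ζ s = ∫ t in s..T, (w t - w' t) := fun s hs => by
    have h1 := intervalIntegral.integral_sub
      (intervalIntegrable_of_timeMeasure (hwi.add hΦ) hs hTT)
      (intervalIntegrable_of_timeMeasure (hwi'.add hΦ) hs hTT)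
    simp only [Pi.add_apply, add_sub_add_right_eq_sub] at h1
    rw [hζs s hs, hvs ⟨s, hs⟩, hvs' ⟨s, hs⟩, h1]
  have hen : ∀ᵐ t ∂(timeMeasure T), 2 * inner ℝ (w t - w' t) (ζ t) ≤ n * K * ‖ζ t‖ ^ 2 := by
    filter_upwards [hw, hw', hfg, ae_all_iff.2 hD.weak, ae_all_iff.2 hD'.weak,
      ae_restrict_mem measurableSet_Icc] with t h1 h2 h3 h4 h5 ht
    have e1 : w t - w' t = transportOp hg t fun i => D i t - D' i t := by
      refine Lp.ext ?_
      have h6 : ∀ᵐ x : Space n, ∀ i : Fin n, (D i t - D' i t : H0 n) x = D i t x - D' i t x :=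
        ae_all_iff.2 fun i => Lp.coeFn_sub _ _
      filter_upwards [h1, h2, h6, Lp.coeFn_sub (w t) (w' t),
        transportOp_coeFn hg t fun i => D i t - D' i t] with x k1 k2 k3 k4 k5
      rw [k5, k4, Pi.sub_apply, k1, k2, ← Finset.sum_sub_distrib]
      exact Finset.sum_congr rfl fun i _ => by rw [k3, h3]; ring
    have e2 : ζ t = IccExtend hT.le v t - IccExtend hT.le v' t := by
      rw [hζs t ht, IccExtend_of_mem hT.le _ ht, IccExtend_of_mem hT.le _ ht]
    rw [e1, e2]
    exact inner_transportOp_self_le hg t fun i => (h4 i).sub (h5 i)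
  have hsq : ∀ s ∈ Icc 0 T, ‖ζ s‖ ^ 2 ≤ n * K * ∫ t in s..T, ‖ζ t‖ ^ 2 := fun s hs => by
    have hi := intervalIntegrable_of_timeMeasure hdi hs hTT
    have hsub : Ioc s T ⊆ Icc 0 T := Ioc_subset_Icc_self.trans (Icc_subset_Icc_left hs.1)
    rw [hζi s hs, norm_integral_sq_eq hs.2 hi, ← intervalIntegral.integral_const_mul,
      ← intervalIntegral.integral_const_mul]
    have e1 : ∫ t in s..T, 2 * inner ℝ (w t - w' t) (∫ r in t..T, (w r - w' r)) =
        ∫ t in s..T, 2 * inner ℝ (w t - w' t) (ζ t) := by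
      refine intervalIntegral.integral_congr fun t ht => ?_
      rw [uIcc_of_le hs.2] at ht
      rw [hζi t ⟨hs.1.trans ht.1, ht.2⟩]
    rw [e1, intervalIntegral.integral_of_le hs.2, intervalIntegral.integral_of_le hs.2]
    refine integral_mono_ae ?_ ?_ (ae_mono (Measure.restrict_mono hsub le_rfl) hen)
    · obtain ⟨C, hC⟩ := isCompact_Icc (a := (0 : ℝ)) (b := T) |>.exists_bound_of_continuousOn
        hζc.continuousOn
      have hd' : Integrable (fun t => w t - w' t) (volume.restrict (Ioc s T)) :=
        IntegrableOn.mono_set hdi hsub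
      refine Integrable.const_mul (Integrable.mono' (hd'.norm.mul_const C)
        (hd'.aestronglyMeasurable.inner (𝕜 := ℝ) hζc.aestronglyMeasurable) ?_) 2
      refine (ae_restrict_mem measurableSet_Ioc).mono fun t ht => ?_
      exact (norm_inner_le_norm _ _).trans
        (mul_le_mul_of_nonneg_left (hC t (hsub ht)) (norm_nonneg _))
    · have : Continuous fun t => n * K * ‖ζ t‖ ^ 2 := by fun_prop
      exact (this.integrableOn_Icc (a := s) (b := T)).mono_set Ioc_subset_Icc_self
  ext1 s
  have h1 := gronwall (d := fun t => ‖ζ t‖ ^ 2) (a := 0) (K := n * K) (s := T) (t := s)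
    (by positivity) (by fun_prop) (fun _ => by positivity) fun τ hτ => by
      rw [uIcc_of_ge s.2.2] at hτ
      rw [zero_add]
      refine (hsq τ ⟨s.2.1.trans hτ.1, hτ.2⟩).trans ?_
      rw [intervalIntegral.integral_symm T τ]
      exact mul_le_mul_of_nonneg_left (neg_le_abs _) (by positivity)
  have h2 : ‖ζ s‖ = 0 := by
    rw [zero_mul] at h1
    exact pow_eq_zero_iff (two_ne_zero) |>.1 (le_antisymm h1 (by positivity))
  rw [hζs s s.2, norm_eq_zero] at h2
  exact sub_eq_zero.1 h2

end Uniqueness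

/-! ### Uniqueness of the extension -/

section Density

variable {n : ℕ} {T : ℝ}

theorem memX1_indicatorConstLp {S : Set ℝ} (hS : MeasurableSet S) (hS' : timeMeasure T S ≠ ⊤)
    {c : H0 n} (hc : c ∈ testSet n) :
    MemX1 T (indicatorConstLp 1 hS hS' c : X10 n T) := by
  obtain ⟨ψ, h1, h2, h3⟩ := hc
  have h3' : ContDiff ℝ 1 ψ := h3.of_le (by norm_cast)
  let d : Fin n → H0 n := fun i => (memLp_fderiv_test h3' h2 (EuclideanSpace.single i 1)).toLp
  have hd : ∀ i, HasWeakPartial i c (d i) := fun i η hη hηc => by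
    have e1 : ∫ x, c x * fderiv ℝ η x (EuclideanSpace.single i 1) =
        ∫ x, ψ x * fderiv ℝ η x (EuclideanSpace.single i 1) :=
      integral_congr_ae (h1.mono fun x hx => by simp only [hx])
    have e2 : ∫ x, d i x * η x = ∫ x, fderiv ℝ ψ x (EuclideanSpace.single i 1) * η x :=
      integral_congr_ae ((memLp_fderiv_test h3' h2 (EuclideanSpace.single i 1)).coeFn_toLp.mono
        fun x hx => by simp only [d, hx])
    have hη1 : ContDiff ℝ 1 η := hη.of_le (by norm_cast)
    have i1 := memLp_test hη1 hηc
    have i2 := memLp_fderiv_test hη1 hηc (EuclideanSpace.single i 1)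
    have i3 := memLp_test h3' h2
    have i4 := memLp_fderiv_test h3' h2 (EuclideanSpace.single i 1)
    rw [e1, e2]
    exact integral_mul_fderiv_eq_neg_fderiv_mul_of_integrable (i4.integrable_mul i1)
      (i3.integrable_mul i2) (i3.integrable_mul i1)
      (fun x _ => h3'.differentiable (by norm_num) x)
      (fun x _ => hη1.differentiable (by norm_num) x)
  have hz : ∀ i, HasWeakPartial i (0 : H0 n) 0 := fun i => by
    simpa using (hd i).sub (hd i)
  refine ⟨fun i => S.indicator fun _ => d i, ?_, fun i => ?_, fun i => ?_⟩
  · exact (memLp_indicator_const 2 hS c (Or.inr hS')).ae_eq indicatorConstLp_coeFn.symm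
  · exact memLp_indicator_const 2 hS (d i) (Or.inr hS')
  · filter_upwards [indicatorConstLp_coeFn (p := 1) (hs := hS) (hμs := hS') (c := c)] with t ht
    rw [ht]
    by_cases htS : t ∈ S
    · rw [indicator_of_mem htS, indicator_of_mem htS]
      exact hd i
    · rw [indicator_of_notMem htS, indicator_of_notMem htS]
      exact hz i

theorem continuous_indicatorConstLp {S : Set ℝ} (hS : MeasurableSet S)
    (hS' : timeMeasure T S ≠ ⊤) :
    Continuous fun c : H0 n => (indicatorConstLp 1 hS hS' c : X10 n T) := by
  refine (LipschitzWith.of_dist_le_mul (K := (timeMeasure T S).toNNReal) fun c c' => ?_).continuous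
  rw [dist_eq_norm, dist_eq_norm, indicatorConstLp_sub, norm_indicatorConstLp (by norm_num)
    (by norm_num), mul_comm]
  simp [Measure.real, ENNReal.coe_toNNReal_eq_toReal]

/-- Continuous operators on `X₁⁰` that agree on `X¹` are equal: `X¹` contains the step functions
with smooth values, which span a dense subspace. -/
theorem ext_of_memX1 {L L' : X10 n T →L[ℝ] C0 n T} (h : ∀ Φ : X10 n T, MemX1 T Φ → L' Φ = L Φ) :
    L' = L := by
  ext1 Φ
  refine Lp.induction (by norm_num) (fun Φ => L' Φ = L Φ) ?_ ?_ ?_ Φ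
  · intro c S hS hS'
    rw [Lp.simpleFunc.coe_indicatorConst]
    have h1 : IsClosed {c : H0 n | L' (indicatorConstLp 1 hS hS'.ne c) =
        L (indicatorConstLp 1 hS hS'.ne c)} :=
      isClosed_eq (L'.continuous.comp (continuous_indicatorConstLp hS hS'.ne))
        (L.continuous.comp (continuous_indicatorConstLp hS hS'.ne))
    exact h1.closure_subset_iff.2 (fun c hc => h _ (memX1_indicatorConstLp hS hS'.ne hc))
      (dense_testSet n c)
  · intro f g hf hg _ h1 h2
    rw [map_add, map_add, h1, h2]
  · exact isClosed_eq L'.continuous L.continuous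

end Density

/-! ### Trajectories of the original field -/

section Trajectories

variable {n : ℕ} {g f : Space n → ℝ → Space n} {K T : ℝ}

theorem ae_imp_mem_Ioc {p : ℝ → Prop} (h : ∀ᵐ t ∂(timeMeasure T), p t) {s t : ℝ}
    (hs : 0 ≤ s) (ht : t ≤ T) : ∀ᵐ τ : ℝ, τ ∈ Ioc s t → p τ := by
  filter_upwards [(ae_restrict_iff' measurableSet_Icc).1 h] with τ h1 h2
  exact h1 ⟨hs.trans h2.1.le, h2.2.trans ht⟩

theorem ae_restrict_uIoc {p : ℝ → Prop} (h : ∀ᵐ t ∂(timeMeasure T), p t) {s t : ℝ}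
    (hs : 0 ≤ s) (hst : s ≤ t) (ht : t ≤ T) : ∀ᵐ τ ∂(volume.restrict (uIoc s t)), p τ := by
  rw [uIoc_of_le hst]
  exact (ae_restrict_iff' measurableSet_Ioc).2 (ae_imp_mem_Ioc h hs ht)

theorem isTrajectory_flow (hg : IsRegularField g K)
    (hfg : ∀ᵐ t ∂(timeMeasure T), ∀ x, f x t = g x t) {s : ℝ} (hs : s ∈ Icc 0 T) (x : Space n) :
    IsTrajectory f T s x (fun t => flow g s t x) := by
  have h1 := isODESolution_flow hg.toODE s x
  refine ⟨h1.1.continuousOn, ?_, fun t ht => ?_⟩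
  · refine (hg.toODE.intervalIntegrable h1.1 s T).congr_ae ?_
    filter_upwards [ae_restrict_uIoc hfg hs.1 hs.2 le_rfl] with τ hτ
    exact (hτ _).symm
  · refine (h1.2 t).trans ?_
    congr 1
    refine intervalIntegral.integral_congr_ae_restrict ?_
    filter_upwards [ae_restrict_uIoc hfg hs.1 ht.1 ht.2] with τ hτ
    exact (hτ _).symm

theorem IsTrajectory.eqOn_flow (hg : IsRegularField g K)
    (hfg : ∀ᵐ t ∂(timeMeasure T), ∀ x, f x t = g x t) {s : ℝ} (hs : s ∈ Icc 0 T) {x : Space n}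
    {z : ℝ → Space n} (hz : IsTrajectory f T s x z) :
    EqOn z (fun t => flow g s t x) (Icc s T) := by
  have hy := isTrajectory_flow hg hfg hs x
  have hc : ContinuousOn (fun t => ‖z t - flow g s t x‖) (Icc s T) :=
    (hz.continuousOn.sub hy.continuousOn).norm
  set d : ℝ → ℝ := IccExtend hs.2 ((Icc s T).domRestrict fun t => ‖z t - flow g s t x‖) with hd
  have hdc : Continuous d := (continuousOn_iff_continuous_domRestrict.1 hc).Icc_extend'
  have hdv : ∀ t ∈ Icc s T, d t = ‖z t - flow g s t x‖ := fun t ht => IccExtend_of_mem hs.2 _ ht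
  have hle : ∀ t ∈ Icc s T, d t ≤ 0 + K * ∫ τ in s..t, d τ := fun t ht => by
    have hsub : ∀ {u : ℝ → Space n}, IsTrajectory f T s x u →
        IntervalIntegrable (fun τ => f (u τ) τ) volume s t := fun hu =>
      hu.integrable.mono_set (by
        rw [uIcc_of_le ht.1, uIcc_of_le hs.2]; exact Icc_subset_Icc_right ht.2)
    rw [hdv t ht, hz.eq t ht, hy.eq t ht, add_sub_add_left_eq_sub,
      ← intervalIntegral.integral_sub (hsub hz) (hsub hy), zero_add,
      ← intervalIntegral.integral_const_mul]
    refine intervalIntegral.norm_integral_le_of_norm_le ht.1 ?_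
      ((hdc.const_mul K).intervalIntegrable s t)
    filter_upwards [ae_imp_mem_Ioc hfg hs.1 ht.2] with τ h1 h2
    rw [h1 h2, h1 h2, hdv τ ⟨h2.1.le, h2.2.trans ht.2⟩]
    exact hg.toODE.lipschitz τ _ _
  intro t ht
  have h1 := gronwall_forward hg.toODE.nonneg hdc hle ht
  rw [zero_mul, hdv t ht] at h1
  exact sub_eq_zero.1 (norm_le_zero_iff.1 h1)

theorem delta_congr {t : ℝ} (h : ∀ x, f x t = g x t) : delta f t = delta g t := by
  have h1 : (fun z => f z t) = fun z => g z t := funext h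
  simp only [delta, divergence, h1]

theorem integral_delta_congr (hfg : ∀ᵐ t ∂(timeMeasure T), ∀ x, f x t = g x t) {s : ℝ}
    (hs : s ∈ Icc 0 T) : ∫ t in s..T, delta f t = ∫ t in s..T, delta g t := by
  refine intervalIntegral.integral_congr_ae_restrict ?_
  filter_upwards [ae_restrict_uIoc hfg hs.1 hs.2 le_rfl] with t ht
  exact delta_congr ht

theorem intervalIntegrable_delta_of_ae (hT : 0 ≤ T) (hg : IsRegularField g K)
    (hfg : ∀ᵐ t ∂(timeMeasure T), ∀ x, f x t = g x t) :
    IntervalIntegrable (delta f) volume 0 T := by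
  refine (intervalIntegrable_delta hg 0 T).congr_ae ?_
  filter_upwards [ae_restrict_uIoc hfg le_rfl hT le_rfl] with t ht
  exact (delta_congr ht).symm

end Trajectories

/-! ### The trajectory functional -/

section Functional

variable {n : ℕ} {g : Space n → ℝ → Space n} {K T : ℝ}

theorem ae_null_section {μ : Measure ℝ} [SFinite μ] {N : Set (Space n × ℝ)}
    (hN : MeasurableSet N) (hN0 : (volume.prod μ) N = 0) :
    ∀ᵐ t ∂μ, volume ((fun x : Space n => (x, t)) ⁻¹' N) = 0 := by
  rw [Measure.prod_apply_symm hN, lintegral_eq_zero_iff (measurable_measure_prodMk_right hN)] at hN0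
  exact hN0

/-- Null sets of space-time points pull back to null sets, so that the integrand of the trajectory
functional depends only on the class of `φ`. -/
theorem quasiMeasurePreserving_flow_prod (hg : IsRegularField g K) (s : ℝ) (μ : Measure ℝ)
    [SFinite μ] :
    Measure.QuasiMeasurePreserving (fun p : Space n × ℝ => (flow g s p.2 p.1, p.2))
      (volume.prod μ) (volume.prod μ) := by
  have hc : Continuous fun p : Space n × ℝ => (s, p.2, p.1) := by fun_prop
  have hm : Measurable fun p : Space n × ℝ => (flow g s p.2 p.1, p.2) :=
    (hg.continuous_flow.comp hc).measurable.prodMk measurable_snd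
  refine ⟨hm, Measure.AbsolutelyContinuous.mk fun N hN hN0 => ?_⟩
  rw [Measure.map_apply hm hN, Measure.prod_apply_symm (hm hN)]
  refine (lintegral_congr_ae ?_).trans lintegral_zero
  filter_upwards [ae_null_section hN hN0] with t ht
  exact (quasiMeasurePreserving_flow hg s t).preimage_null ht

/-- Version of `quasiMeasurePreserving_flow_prod` with variable initial time. -/
theorem quasiMeasurePreserving_flow_prod_prod (hg : IsRegularField g K) (ν μ : Measure ℝ)
    [SFinite ν] [SFinite μ] :
    Measure.QuasiMeasurePreserving
      (fun p : (Space n × ℝ) × ℝ => (flow g p.1.2 p.2 p.1.1, p.2))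
      ((volume.prod ν).prod μ) (volume.prod μ) := by
  have hc : Continuous fun p : (Space n × ℝ) × ℝ => (p.1.2, p.2, p.1.1) := by fun_prop
  have hm : Measurable fun p : (Space n × ℝ) × ℝ => (flow g p.1.2 p.2 p.1.1, p.2) :=
    (hg.continuous_flow.comp hc).measurable.prodMk measurable_snd
  refine ⟨hm, Measure.AbsolutelyContinuous.mk fun N hN hN0 => ?_⟩
  rw [Measure.map_apply hm hN, Measure.prod_apply_symm (hm hN)]
  refine (lintegral_congr_ae ?_).trans lintegral_zero
  filter_upwards [ae_null_section hN hN0] with t ht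
  rw [Measure.prod_apply_symm (measurable_prodMk_right (hm hN))]
  refine (lintegral_congr fun s => ?_).trans lintegral_zero
  exact (quasiMeasurePreserving_flow hg s t).preimage_null ht

variable {φ : Space n → ℝ → ℝ}

/-- The function `(x, t) ↦ φ(x, t)` as an `L₂`-valued function of `t`. -/
theorem MemX10.exists_toX10 (hφ : MemX10 T φ) :
    ∃ Φ : X10 n T, ∀ᵐ t ∂(timeMeasure T), Φ t =ᵐ[volume] fun x => φ x t := by
  classical
  have hm := hφ.measurable.aestronglyMeasurable
  have hnorm : AEMeasurable (fun t => eLpNorm (fun x => φ x t) 2 volume) (timeMeasure T) := by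
    have h1 : ∀ t, eLpNorm (fun x => φ x t) 2 volume =
        (∫⁻ x, ‖φ x t‖ₑ ^ (2 : ℝ)) ^ (1 / (2 : ℝ)) := fun t => by
      rw [eLpNorm_eq_lintegral_rpow_enorm_toReal (by norm_num) (by norm_num)]
      simp
    simp only [h1]
    have h2 : AEMeasurable (fun p : ℝ × Space n => ‖φ p.2 p.1‖ₑ ^ (2 : ℝ))
        ((timeMeasure T).prod volume) := (hm.prod_swap.enorm).pow_const _
    exact h2.lintegral_prod_right'.pow_const _
  have hmem : ∀ᵐ t ∂(timeMeasure T), MemLp (fun x => φ x t) 2 volume := by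
    filter_upwards [hm.prod_swap.prodMk_left, ae_lt_top' hnorm hφ.summable.ne] with t h1 h2
    exact ⟨h1, h2⟩
  let F : ℝ → H0 n := fun t => if h : MemLp (fun x => φ x t) 2 volume then h.toLp else 0
  have hF : ∀ᵐ t ∂(timeMeasure T), F t =ᵐ[volume] fun x => φ x t := by
    filter_upwards [hmem] with t ht
    simp only [F, dif_pos ht]
    exact ht.coeFn_toLp
  have hFi : Integrable F (timeMeasure T) := by
    refine ⟨aestronglyMeasurable_of_section hm hF, ?_⟩
    rw [HasFiniteIntegral]
    refine (lintegral_congr_ae ?_).trans_lt hφ.summable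
    filter_upwards [hF] with t ht
    rw [Lp.enorm_def, eLpNorm_congr_ae ht]
  refine ⟨hFi.toL1, ?_⟩
  filter_upwards [hF, hFi.coeFn_toL1] with t h1 h2
  rw [h2]
  exact h1

theorem aestronglyMeasurable_comp_flow (hg : IsRegularField g K)
    (hφ : AEMeasurable (Function.uncurry φ) (spaceTimeMeasure n T)) (s : ℝ) :
    AEStronglyMeasurable (Function.uncurry fun x t => φ (flow g s t x) t)
      (spaceTimeMeasure n T) :=
  hφ.aestronglyMeasurable.comp_quasiMeasurePreserving (quasiMeasurePreserving_flow_prod hg s _)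

theorem duhamel_coeFn (hg : IsRegularField g K)
    (hφ : AEMeasurable (Function.uncurry φ) (spaceTimeMeasure n T)) (Φ : X10 n T)
    (hΦ : ∀ᵐ t ∂(timeMeasure T), Φ t =ᵐ[volume] fun x => φ x t) {s : ℝ} (hs : s ∈ Icc 0 T) :
    (∀ᵐ x, IntervalIntegrable (fun t => φ (flow g s t x) t) volume s T) ∧
      duhamel hg T Φ s =ᵐ[volume] fun x => ∫ t in s..T, φ (flow g s t x) t := by
  have hsub : Ioc s T ⊆ Icc 0 T := Ioc_subset_Icc_self.trans (Icc_subset_Icc_left hs.1)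
  have hle := Measure.restrict_mono hsub (le_refl (volume : Measure ℝ))
  have h1 := coeFn_integral_ae (μ := volume.restrict (Ioc s T))
    (F := fun t => compFlow hg s t (Φ t)) (φ := fun x t => φ (flow g s t x) t)
    ((aestronglyMeasurable_comp_flow hg hφ s).mono_ac
      (Measure.AbsolutelyContinuous.rfl.prod hle.absolutelyContinuous))
    (IntegrableOn.mono_set (integrable_compFlow hg (L1.integrable_coeFn Φ) s) hsub)
    (ae_mono hle (hΦ.mono fun t ht => compFlow_coeFn' hg s t ht))
  refine ⟨h1.1.mono fun x hx => (intervalIntegrable_iff_integrableOn_Ioc_of_le hs.2).2 hx, ?_⟩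
  rw [duhamel, intervalIntegral.integral_of_le hs.2]
  simp only [intervalIntegral.integral_of_le hs.2]
  exact h1.2

theorem integral_comp_flow_congr_ae (hg : IsRegularField g K) {φ' : Space n → ℝ → ℝ}
    (h : Function.uncurry φ' =ᵐ[spaceTimeMeasure n T] Function.uncurry φ) {s : ℝ}
    (hs : s ∈ Icc 0 T) : (fun x => ∫ t in s..T, φ' (flow g s t x) t) =ᵐ[volume]
      fun x => ∫ t in s..T, φ (flow g s t x) t := by
  have h1 := (quasiMeasurePreserving_flow_prod hg s (timeMeasure T)).ae_eq_comp h
  filter_upwards [Measure.ae_ae_of_ae_prod h1] with x hx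
  exact intervalIntegral.integral_congr_ae_restrict (ae_restrict_uIoc hx hs.1 hs.2 le_rfl)

theorem aemeasurable_integral_comp_flow (hg : IsRegularField g K)
    (hφ : AEMeasurable (Function.uncurry φ) (spaceTimeMeasure n T)) :
    AEMeasurable (fun p : Space n × ℝ => ∫ t in p.2..T, φ (flow g p.2 t p.1) t)
      (spaceTimeMeasure n T) := by
  have h1 := (hφ.aestronglyMeasurable.comp_quasiMeasurePreserving
    (quasiMeasurePreserving_flow_prod_prod hg (timeMeasure T) (timeMeasure T))).indicator
      (s := {p : (Space n × ℝ) × ℝ | p.1.2 < p.2})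
      (measurableSet_lt (measurable_snd.comp measurable_fst) measurable_snd)
  refine h1.integral_prod_right'.aemeasurable.congr ?_
  have h2 : ∀ᵐ p ∂(spaceTimeMeasure n T), p.2 ∈ Icc 0 T :=
    Measure.quasiMeasurePreserving_snd.ae (ae_restrict_mem measurableSet_Icc)
  filter_upwards [h2] with p hp
  have h3 : Icc 0 T ∩ Ioc p.2 T = Ioc p.2 T :=
    inter_eq_right.2 (Ioc_subset_Icc_self.trans (Icc_subset_Icc_left hp.1))
  rw [intervalIntegral.integral_of_le hp.2, ← h3, ← setIntegral_indicator measurableSet_Ioc]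
  refine setIntegral_congr_fun measurableSet_Icc fun t ht => ?_
  simp only [indicator_apply, mem_ofPred_eq, mem_Ioc, ht.2, and_true, Function.comp_apply,
    Function.uncurry]

theorem eLpNorm_duhamel_le (hg : IsRegularField g K) (Φ : X10 n T)
    (hΦ : ∀ᵐ t ∂(timeMeasure T), Φ t =ᵐ[volume] fun x => φ x t) {s : ℝ} (hs : s ∈ Icc 0 T) :
    eLpNorm (duhamel hg T Φ s) 2 volume ≤
      ENNReal.ofReal (Real.exp (∫ t in s..T, delta g t)) *
        ∫⁻ t in Icc s T, eLpNorm (fun x => φ x t) 2 volume := by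
  have hi := L1.integrable_coeFn Φ
  have hsub : Icc s T ⊆ Icc 0 T := Icc_subset_Icc_left hs.1
  have hi' : Integrable Φ (volume.restrict (Icc s T)) := IntegrableOn.mono_set hi hsub
  have h1 := norm_duhamel_le hg hi hs
  rw [intervalIntegral.integral_of_le hs.2 (f := fun t => ‖Φ t‖),
    ← integral_Icc_eq_integral_Ioc] at h1
  rw [← Lp.enorm_def, ← ofReal_norm]
  refine (ENNReal.ofReal_le_ofReal h1).trans_eq ?_
  rw [ENNReal.ofReal_mul (Real.exp_pos _).le, ofReal_integral_norm_eq_lintegral_enorm hi']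
  congr 1
  refine lintegral_congr_ae ?_
  filter_upwards [ae_mono (Measure.restrict_mono hsub le_rfl) hΦ] with t ht
  rw [Lp.enorm_def, eLpNorm_congr_ae ht]

end Functional

end Transport

theorem theorem1p1 (n : ℕ) (T : ℝ) (hT : 0 < T)
    (f : Transport.Space n → ℝ → Transport.Space n) (hf : Transport.IsAdmissibleField T f) :
    -- the trajectories `y^{x,s}` exist and are unique
    (∀ s ∈ Icc 0 T, ∀ x, ∃ y, Transport.IsTrajectory f T s x y ∧
      ∀ z, Transport.IsTrajectory f T s x z → EqOn z y (Icc s T)) ∧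
    IntervalIntegrable (Transport.delta f) volume 0 T ∧
    -- the transport problem is uniquely solvable for right-hand sides in `X¹`
    (∀ Φ : Transport.X10 n T, Transport.MemX1 T Φ →
      ∃! v : Transport.C0 n T, Transport.IsTransportSolution hT f Φ v) ∧
    -- its solution operator has exactly one continuous extension `L`, with the stated norm bound
    ∃ L : Transport.X10 n T →L[ℝ] Transport.C0 n T,
      Transport.ExtendsSolutionOperator hT f L ∧
      (∀ L' : Transport.X10 n T →L[ℝ] Transport.C0 n T,
        Transport.ExtendsSolutionOperator hT f L' → L' = L) ∧
      ‖L‖ ≤ Real.exp (∫ t in (0 : ℝ)..T, Transport.delta f t) ∧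
      ∀ φ : Transport.Space n → ℝ → ℝ, Transport.MemX10 T φ →
      ∀ y : Transport.Space n → ℝ → ℝ → Transport.Space n,
        (∀ s ∈ Icc 0 T, ∀ x, Transport.IsTrajectory f T s x (y x s)) →
        -- `V` is Lebesgue measurable in `(x, s)`
        AEMeasurable (Function.uncurry (Transport.trajectoryFunctional T φ y))
          (Transport.spaceTimeMeasure n T) ∧
        -- for each `s`, `V(x, s)` is defined for almost all `x` and belongs to `L₂(ℝⁿ)`
        (∀ s ∈ Icc 0 T,
          (∀ᵐ x : Transport.Space n, IntervalIntegrable (fun t => φ (y x s t) t) volume s T) ∧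
          MemLp (fun x => Transport.trajectoryFunctional T φ y x s) 2 volume) ∧
        -- as an element of `L₂(ℝⁿ)` it depends only on the equivalence class of `φ`
        (∀ φ' : Transport.Space n → ℝ → ℝ,
          Function.uncurry φ' =ᵐ[Transport.spaceTimeMeasure n T] Function.uncurry φ →
          ∀ s ∈ Icc 0 T, (fun x => Transport.trajectoryFunctional T φ' y x s) =ᵐ[volume]
            fun x => Transport.trajectoryFunctional T φ y x s) ∧
        -- `V ∈ C([0, T] → L₂)` and `V = L φ`
        (∃ Φ : Transport.X10 n T,
          (∀ᵐ t ∂(Transport.timeMeasure T), Φ t =ᵐ[volume] fun x => φ x t) ∧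
          ∀ s : Icc (0 : ℝ) T,
            L Φ s =ᵐ[volume] fun x => Transport.trajectoryFunctional T φ y x s) ∧
        -- the estimate with the constant `exp ∫_s^T δ_f`
        (∀ s ∈ Icc 0 T,
          eLpNorm (fun x => Transport.trajectoryFunctional T φ y x s) 2 volume ≤
            ENNReal.ofReal (Real.exp (∫ t in s..T, Transport.delta f t)) *
              ∫⁻ t in Icc s T, eLpNorm (fun x => φ x t) 2 volume) := by
  obtain ⟨g, K, hg, hfg⟩ := hf.exists_regular hT
  -- along any family of trajectories the functional is computed with the flow of `g`
  have htraj : ∀ y : Transport.Space n → ℝ → ℝ → Transport.Space n,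
      (∀ s ∈ Icc 0 T, ∀ x, Transport.IsTrajectory f T s x (y x s)) →
      ∀ s ∈ Icc 0 T, ∀ x, ∀ t ∈ Icc s T, y x s t = Transport.flow g s t x :=
    fun y hy s hs x t ht => (hy s hs x).eqOn_flow hg hfg hs ht
  have hext : Transport.ExtendsSolutionOperator hT f (Transport.duhamelOp hg T) :=
    fun Φ hΦ => Transport.isTransportSolution_duhamelOp hT hg hfg Φ hΦ
  refine ⟨fun s hs x => ⟨_, Transport.isTrajectory_flow hg hfg hs x,
      fun z hz => hz.eqOn_flow hg hfg hs⟩,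
    Transport.intervalIntegrable_delta_of_ae hT.le hg hfg,
    fun Φ hΦ => ⟨_, hext Φ hΦ, fun v hv => hv.unique hg hfg (hext Φ hΦ)⟩,
    Transport.duhamelOp hg T, hext,
    fun L' hL' => Transport.ext_of_memX1 fun Φ hΦ => (hL' Φ hΦ).unique hg hfg (hext Φ hΦ),
    ?_, fun φ hφ y hy => ?_⟩
  · rw [Transport.integral_delta_congr hfg ⟨le_rfl, hT.le⟩]
    exact Transport.norm_duhamelOp_le hg T
  obtain ⟨Φ, hΦ⟩ := hφ.exists_toX10
  have hV : ∀ (ψ : Transport.Space n → ℝ → ℝ), ∀ s ∈ Icc 0 T, ∀ x,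
      Transport.trajectoryFunctional T ψ y x s = ∫ t in s..T, ψ (Transport.flow g s t x) t := by
    intro ψ s hs x
    refine intervalIntegral.integral_congr fun t ht => ?_
    rw [uIcc_of_le hs.2] at ht
    simp only [htraj y hy s hs x t ht]
  have hVL : ∀ s ∈ Icc 0 T, Transport.duhamel hg T Φ s =ᵐ[volume]
      fun x => Transport.trajectoryFunctional T φ y x s := fun s hs => by
    simp only [hV φ s hs]
    exact (Transport.duhamel_coeFn hg hφ.measurable Φ hΦ hs).2
  refine ⟨?_, fun s hs => ⟨?_, ?_⟩, fun φ' hφ' s hs => ?_, ⟨Φ, hΦ, fun s => hVL s s.2⟩,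
    fun s hs => ?_⟩
  · refine (Transport.aemeasurable_integral_comp_flow hg hφ.measurable).congr ?_
    have h1 : ∀ᵐ p ∂(Transport.spaceTimeMeasure n T), p.2 ∈ Icc 0 T :=
      Measure.quasiMeasurePreserving_snd.ae (ae_restrict_mem measurableSet_Icc)
    filter_upwards [h1] with p hp
    exact (hV φ p.2 hp p.1).symm
  · filter_upwards [(Transport.duhamel_coeFn hg hφ.measurable Φ hΦ hs).1] with x hx
    refine hx.congr fun t ht => ?_
    rw [uIoc_of_le hs.2] at ht
    simp only [htraj y hy s hs x t (Ioc_subset_Icc_self ht)]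
  · exact (memLp_congr_ae (hVL s hs)).1 (Lp.memLp _)
  · simp only [hV _ s hs]
    exact Transport.integral_comp_flow_congr_ae hg hφ' hs
  · rw [← eLpNorm_congr_ae (hVL s hs), Transport.integral_delta_congr hfg hs]
    exact Transport.eLpNorm_duhamel_le hg Φ hΦ hs
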